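/- **Conventions.** $\mathbb{R}^m_s$ is $\mathbb{R}^m$ with $\langle u,v\rangle_s=-\sum_{i\le s}u^iv^i+\sum_{i>s}u^iv^i$, and $S^n_s=\{x\in\mathbb{R}^{n+1}_s:\langle x,x\rangle_s=1\}$ (for $s=n$ only the sheet $x^{n+1}>0$); $\kappa=0$ for $\mathbb{R}^n_s$ and $\kappa=1$ for $S^n_s$. $\bm e_i$ are the standard unit vectors, $E_n$ is the identity, $E^{\mathfrak a}_n$ the anti-diagonal matrix with entries $1$, $J_m(\lambda)$ the upper Jordan block. A hypersurface $M$ is a connected embedded smooth non-degenerate hypersurface with a smooth unit normal field $\xi$, $\nu=\langle\xi,\xi\rangle\in\{\pm1\}$, $\delta=\kappa\nu$; its shape operator is $A(X)=-\bar\nabla_X\xi$. It is *isoparametric* if the complex eigenvalues of $A_x$, with multiplicities, do not depend on $x$. A function $f$ on a space form is *isoparametric* if $\langle\mathrm{grad} f,\mathrm{grad} f\rangle=\Phi\circ f$ and $\Delta f=\Psi\circ f$ for smooth $\Phi,\Psi:\mathbb{R}\to\mathbb{R}$; $W_{RN}(f)$ is the set of values $c$ of $f$ with $\Phi(c)\ne0$.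 A 4-dimensional $M$ of index 2 has *Petrov type* $\tau$ if there is one fixed pair $(J,G)$ of the form listed for $\tau$ such that at every $x\in M$ some basis of $T_xM$ has Gram matrix $G$ and $A_x$ has matrix $J$ in it ($\varepsilon\in\{\pm1\}$, other parameters real, $\beta_i>0$): II: $J=\begin{pmatrix}\alpha_1&-\beta_1\\ \beta_1&\alpha_1\end{pmatrix}\oplus\begin{pmatrix}\alpha_2&-\beta_2\\ \beta_2&\alpha_2\end{pmatrix}$, $G=\mathrm{diag}(-1,1,-1,1)$; VI: $J_4(b)$, $\varepsilon E^{\mathfrak a}_4$; VII-i: $J_3(b)\oplus J_1(a_1)$, $(-E^{\mathfrak a}_3)\oplus(1)$; VII-ii: $J_3(b)\oplus J_1(a_0)$, $E^{\mathfrak a}_3\oplus(-1)$; IX-i: $J_2(b_1)\oplus J_2(b_2)$, $\varepsilon E^{\mathfrak a}_2\oplus\varepsilon E^{\mathfrak a}_2$; IX-ii: $J_2(b_1)\oplus J_2(b_2)$, $\varepsilon E^{\mathfrak a}_2\oplus(-\varepsilon E^{\mathfrak a}_2)$; X: $J_2(b)\oplus\mathrm{diag}(a_0,a_1)$, $\varepsilon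 E^{\mathfrak a}_2\oplus\mathrm{diag}(-1,1)$; XI: $J$ diagonal, $G=\mathrm{diag}(-1,-1,1,1)$. **Claim.** The following hold. A "frame $\mathcal B_x$" is always a basis of $T_xM$. *Level sets in $\mathbb{R}^5_2$.* Let $f(x)=\langle Px,x\rangle_2+2\langle p,x\rangle_2$. In (a)–(d), $P$ is self-adjoint, $f$ is an isoparametric function on $\mathbb{R}^5_2$ with $\mathrm{grad}f_x=2Px+2p$, $f(x_0)=c\in W_{RN}(f)$, and every connected component $M$ of $f^{-1}(c)$, with $\xi=\mathrm{grad}f/\sqrt{|\Phi(c)|}$, is an isoparametric hypersurface of index 2 with $\nu=1$, of the stated Petrov type, and with the stated properties at every $x\in M$. (a) $P=-E_5$, $p=0$, $c=-1$, $x_0=\bm e_3$: type XI; $M=f^{-1}(c)=S^4_2$ and $A=\mathrm{id}$. (b) $p=\bm e_3$, $c=1$, $x_0=\bm e_1$, $P=\begin{pmatrix}-1&0&0&0&1\\0&0&0&0&0\\0&0&0&0&0\\0&0&0&0&0\\-1&0&0&0&1\end{pmatrix}$: type X; with the frame $\mathcal B_x=[\bm e_1+\bm e_5,\ \bm e_1+(-x^1+x^5)\bm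 e_3,\ \bm e_2,\ \bm e_4]$ one has $A_x\mathcal B_x=\mathcal B_x(J_2(0)\oplus O_2)$. (c) $p=\bm e_4$, $c=1$, $x_0=\bm e_4/2$, $P=\begin{pmatrix}0&1&0&0&1\\1&0&-1&0&0\\0&1&0&0&1\\0&0&0&0&0\\-1&0&1&0&0\end{pmatrix}$: type IX-ii. Put $\theta_1=-\bm e_1-\bm e_3$, $\theta_2=\bm e_2+(x^1-x^3)\bm e_4$, $\eta_1=-\bm e_2+\bm e_5$, $\eta_2=\bm e_1+(x^2+x^5)\bm e_4$, $S=x^1+x^2-x^3+x^5$, $T=x^1-x^2-x^3-x^5$, $\theta_1''=\theta_1+\eta_1$, $\eta_1''=\theta_1-\eta_1$, $\theta_2''=\theta_2+\eta_2+\tfrac12ST\eta_1''$, $\eta_2''=\theta_2-\eta_2$. The frame $\bm b_1=\tfrac1{\sqrt2}\theta_1''$, $\bm b_2=\tfrac1{\sqrt2}\theta_2''-\tfrac1{4\sqrt2}(S^2-2)\theta_1''$, $\bm b_3=\tfrac1{\sqrt2}\eta_1''$, $\bm b_4=\tfrac1{\sqrt2}\eta_2''+\tfrac1{4\sqrt2}(T^2-2)\eta_1''$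 satisfies $A_x\mathcal B_x=\mathcal B_x(J_2(0)\oplus J_2(0))$ and $(\langle\bm b_i,\bm b_j\rangle_2)=E^{\mathfrak a}_2\oplus(-E^{\mathfrak a}_2)$. (d) $p=\bm e_4$, $c=1$, $x_0=\bm e_4/2$, $P=\begin{pmatrix}1&0&0&0&1\\0&1&-1&0&0\\0&1&-1&0&0\\0&0&0&0&0\\-1&0&0&0&-1\end{pmatrix}$: type IX-i. Put $\theta_1=-\bm e_1+\bm e_5$, $\eta_1=-\bm e_2-\bm e_3$, $\eta_2=\bm e_2+(x^2-x^3)\bm e_4$, $\theta_2'=\bm e_1+(x^1+x^5)\bm e_4-(x^1+x^5)(x^2-x^3)\eta_1$. The frame $\bm b_1=\theta_1$, $\bm b_2=\theta_2'-\tfrac12\{(x^1+x^5)^2-1\}\theta_1$, $\bm b_3=\eta_1$, $\bm b_4=\eta_2-\tfrac12\{(x^2-x^3)^2-1\}\eta_1$ satisfies $A_x\mathcal B_x=\mathcal B_x(J_2(0)\oplus J_2(0))$ and $(\langle\bm b_i,\bm b_j\rangle_2)=E^{\mathfrak a}_2\oplus E^{\mathfrak a}_2$. *Level sets in $S^5_s$.*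 Let $f(x)=\langle Px,x\rangle_s$ on $S^5_s$. In (e)–(j), $P$ is self-adjoint with minimal polynomial $\mu_P$ as stated, $f$ is an isoparametric function on $S^5_s$ with $\mathrm{grad}f_x=2Px-2\langle Px,x\rangle_sx$, $f(x_0)=c\in W_{RN}(f)$, and every connected component $M$ of $f^{-1}(c)$, with $\xi=\mathrm{grad}f/\sqrt{|\Phi(c)|}$, is an isoparametric hypersurface of index 2 of the stated Petrov type, with $\nu=\delta$ as stated and $A_x=\frac1{\sqrt{-\delta\mu_P(c)}}(cE_6-P)|_{T_xM}$ for all $x\in M$. ($\delta=1$, $s=2$ in (e); $\delta=-1$, $s=3$ in (f)–(j).) (e) $P=E^{\mathfrak a}_2\oplus E^{\mathfrak a}_4$, $c=0$, $x_0=\bm e_6$, $\mu_P=t^2-1$: type XI; $A$ is diagonalizable with principal curvatures $-1,-1,1,1$. (f) $P=E^{\mathfrak a}_3\oplus E^{\mathfrak a}_3$, $c=3$, $x_0=-\bm e_1/\sqrt2+\bm e_3/\sqrt2+\sqrt2\bm e_5$, $\mu_P=t^2-1$: type XI; $A$ is diagonalizable with principal curvatures $\tfrac1{\sqrt2},\tfrac1{\sqrt2},\tfrac1{\sqrt2},\sqrt2$.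 (g) $P=\begin{pmatrix}0&0&1&0&0&-1\\0&0&0&0&0&0\\1&0&0&1&0&0\\0&0&-1&0&0&1\\0&0&0&0&0&0\\1&0&0&1&0&0\end{pmatrix}$, $c=1$, $x_0=(\bm e_4+\bm e_6)/\sqrt2$, $\mu_P=t^2$: type X. If $u=x^1+x^4\ne0$ and $w=-x^3+x^6\ne0$, the vectors $\bm a_1=-\frac{x^2}u\bm e_1+\bm e_2+\frac{x^2}u\bm e_4$, $\bm a_2=(-\frac{x^3}u+\frac{x^4}w)\bm e_1+\bm e_3+(\frac{x^3}u+\frac{x^1}w)\bm e_4$, $\bm a_3=\frac{x^5}u\bm e_1-\frac{x^5}u\bm e_4+\bm e_5$, $\bm a_4=(\frac{x^6}u-\frac{x^4}w)\bm e_1+(-\frac{x^6}u-\frac{x^1}w)\bm e_4+\bm e_6$ lie in $T_xM$, and the frame $\mathcal B_x=[\bm a_2+\bm a_4,\ -\frac wu\bm a_2,\ \bm a_1,\ \bm a_3]$ satisfies $A_x\mathcal B_x=\mathcal B_x(J_2(1)\oplus E_2)$. (h) $P=\begin{bmatrix}E^{\mathfrak a}_3&E_3\\-E_3&-E^{\mathfrak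 a}_3\end{bmatrix}$, $c=-1$, $x_0=\bm e_5$, $\mu_P=t^2$: type IX-ii. If $u=x^2+x^5\ne0$, put $k=(x^3+x^4)/u^2$, $l=(x^1+x^6)/u^2$; the vectors $\bm a_1=\bm e_1+(-\frac{x^1}u-x^5k)\bm e_2+(\frac{x^1}u-x^2k)\bm e_5$, $\bm a_2=(-\frac{x^3}u-x^5l)\bm e_2+\bm e_3+(\frac{x^3}u-x^2l)\bm e_5$, $\bm a_3=(\frac{x^4}u-x^5l)\bm e_2+\bm e_4+(-\frac{x^4}u-x^2l)\bm e_5$, $\bm a_4=(\frac{x^6}u-x^5k)\bm e_2+(-\frac{x^6}u-x^2k)\bm e_5+\bm e_6$ lie in $T_xM$, and the frame $\mathcal B_x=[-\bm a_1+\bm a_4,\ \bm a_2,\ -\bm a_2+\bm a_3,\ \bm a_1]$ satisfies $A_x\mathcal B_x=\mathcal B_x(J_2(-1)\oplus J_2(-1))$. If $\bm e_5\in M$ then, with $\bm a_i=\bm a_i(\bm e_5)$, the frame $\bm b_1=\frac1{\sqrt2}(-\bm a_1-\bm a_2+\bm a_3+\bm a_4)$, $\bm b_2=\frac1{2\sqrt2}(\bm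 a_1+\bm a_2+\bm a_3+\bm a_4)$, $\bm b_3=\frac1{\sqrt2}(-\bm a_1+\bm a_2-\bm a_3+\bm a_4)$, $\bm b_4=\frac1{2\sqrt2}(-\bm a_1+\bm a_2+\bm a_3-\bm a_4)$ of $T_{\bm e_5}M$ satisfies the same equation for $A_{\bm e_5}$ and $(\langle\bm b_i,\bm b_j\rangle_3)=E^{\mathfrak a}_2\oplus(-E^{\mathfrak a}_2)$. (i) $P=\begin{bmatrix}E_3&E_3\\-E_3&-E_3\end{bmatrix}$, $c=-1$, $x_0=\bm e_5$, $\mu_P=t^2$: type IX-i. If $u=x^2+x^5\ne0$, put $k=(x^1+x^4)/u^2$, $l=(x^3+x^6)/u^2$; the vectors $\bm a_1=\bm e_1+(-\frac{x^1}u-x^5k)\bm e_2+(\frac{x^1}u-x^2k)\bm e_5$, $\bm a_2=(-\frac{x^3}u-x^5l)\bm e_2+\bm e_3+(\frac{x^3}u-x^2l)\bm e_5$, $\bm a_3=(\frac{x^4}u-x^5k)\bm e_2+\bm e_4+(-\frac{x^4}u-x^2k)\bm e_5$, $\bm a_4=(\frac{x^6}u-x^5l)\bm e_2+(-\frac{x^6}u-x^2l)\bm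 e_5+\bm e_6$ lie in $T_xM$, and the frame $\mathcal B_x=[-\bm a_1+\bm a_3,\ \bm a_1,\ -\bm a_2+\bm a_4,\ \bm a_2]$ satisfies $A_x\mathcal B_x=\mathcal B_x(J_2(-1)\oplus J_2(-1))$. If $\bm e_5\in M$ then, with $\bm a_i=\bm a_i(\bm e_5)$, the frame $[-\bm a_1+\bm a_3,\ \frac{\bm a_1+\bm a_3}2,\ -\bm a_2+\bm a_4,\ \frac{\bm a_2+\bm a_4}2]$ of $T_{\bm e_5}M$ satisfies the same equation for $A_{\bm e_5}$ and has Gram matrix $E^{\mathfrak a}_2\oplus E^{\mathfrak a}_2$. (j) $P=\begin{bmatrix}E_3&-E^{\mathfrak a}_3\\E^{\mathfrak a}_3&E_3\end{bmatrix}$, $c=1$, $x_0=\bm e_4$, $\mu_P=t^2-2t+2$: type II; $A$ is diagonalizable over $\mathbb{C}$ with principal curvatures $-\sqrt{-1},-\sqrt{-1},\sqrt{-1},\sqrt{-1}$. *Parametrized hypersurfaces in $\mathbb{R}^5_2$.* In (k)–(m), $f$ is smooth on the non-empty open set $D\subset\mathbb{R}^4$, and there is a field $\xi$ on $f(D)$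 with the stated values $\xi_{f(\bm p)}$, $\bm p\in D$, such that every connected component $M$ of $f(D)$ with $\xi$ is an isoparametric hypersurface of $\mathbb{R}^5_2$ of index 2 with $\nu=1$, of the stated Petrov type, and the stated frame $\mathcal B_{\bm p}=[\bm b_1,\dots,\bm b_4]$ of $T_{f(\bm p)}M$ satisfies the stated equation whenever $\bm p\in D$, $f(\bm p)\in M$. (k) For every $a>0$: $\bm p=(s,u,z,v)$, $D=\{z+\sqrt2\ne0\}$, $\rho=\sqrt{1+a^2v^2}$, $f(\bm p)=\int_0^sX(w)\,dw+uY(s)+zZ(s)+vV+\frac1a(1-\rho)C(s)$, where $X(s)=(\tfrac{\sqrt2(s^2+6)}8+\tfrac12,\tfrac{\sqrt2}2,\tfrac{\sqrt2(s^2+6)}8-\sqrt2+\tfrac12,-\tfrac{\sqrt2}2s,1+\tfrac{\sqrt2}2)$, $Y(s)=(\tfrac{\sqrt2(s^2+6)}8-\tfrac12,\tfrac{\sqrt2}2,\tfrac{\sqrt2(s^2+6)}8-\sqrt2-\tfrac12,-\tfrac{\sqrt2}2s,1-\tfrac{\sqrt2}2)$, $Z(s)=(\tfrac s2,0,\tfrac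 s2,-1,0)$, $V=(\tfrac12,-1,\tfrac12,0,0)$, $C(s)=(\tfrac{s^2}4+1,1,\tfrac{s^2}4-1,-s,\sqrt2)$; $\xi_{f(\bm p)}=-\frac{\sqrt2z}{z+\sqrt2}\rho Y(s)-avV+\rho C(s)$. The type is VII-ii; with $\bm b_1=f_u$, $\bm b_2=\frac{(z+\sqrt2)^2}{2\rho}f_z$, $\bm b_3=-\frac{(z+\sqrt2)^3}{2\sqrt2\rho^2}f_s$, $\bm b_4=\frac{\sqrt2azv}{(z+\sqrt2)\rho}f_u+f_v$ one has $A\mathcal B_{\bm p}=\mathcal B_{\bm p}(J_3(0)\oplus J_1(a))$, $\langle\bm b_i,\bm b_4\rangle_2=0$ for $i=1,2,3$ and $\langle\bm b_4,\bm b_4\rangle_2=-\frac1{1+a^2v^2}<0$ for all $\bm p\in D$. (l) For every $a>0$: $\bm p=(s,u,z,v)$, $D=\{z-\sqrt2\ne0,\ |v|<\frac1a\}$, $\rho=\sqrt{1-a^2v^2}$, $f(\bm p)=\int_0^sX(w)\,dw+uY(s)+zZ(s)+vV+\frac1a(1-\rho)C(s)$, where $X(s)=(\tfrac{\sqrt2(s^2+2)}8-\sqrt2,\tfrac{\sqrt2}2s,\tfrac{\sqrt2(s^2+2)}8,\tfrac{\sqrt2}2,\tfrac{\sqrt2}2)$,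 $Y(s)=(-\tfrac{\sqrt2(s^2+2)}8+\sqrt2,-\tfrac{\sqrt2}2s,-\tfrac{\sqrt2(s^2+2)}8,-\tfrac{\sqrt2}2,\tfrac{\sqrt2}2)$, $Z(s)=(\tfrac s2,1,\tfrac s2,0,0)$, $V=(\tfrac12,0,\tfrac12,-1,0)$, $C(s)=(\tfrac{s^2}4-1,s,\tfrac{s^2}4+1,1,0)$; $\xi_{f(\bm p)}=\frac{\sqrt2z}{z-\sqrt2}\rho Y(s)-avV+\rho C(s)$. The type is VII-i; with $\bm b_1=f_u$, $\bm b_2=\frac{(z-\sqrt2)^2}{2\rho}f_z$, $\bm b_3=\frac{(z-\sqrt2)^3}{2\sqrt2\rho^2}f_s$, $\bm b_4=\frac{\sqrt2azv}{(z-\sqrt2)\rho}f_u+f_v$ one has $A\mathcal B_{\bm p}=\mathcal B_{\bm p}(J_3(0)\oplus J_1(a))$, $\langle\bm b_i,\bm b_4\rangle_2=0$ for $i=1,2,3$ and $\langle\bm b_4,\bm b_4\rangle_2=\frac1{1-a^2v^2}>0$ for all $\bm p\in D$. (m) $\bm p=(s,w,z,u)$, $D=\mathbb{R}^4$, $f(\bm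 p)=\int_0^sX\,dv+wW(u)+zZ-\frac{z^2}2C(u)+\int_0^uY(v)\,dv$, where $X=(0,-1,0,0,1)$, $Y(u)=(u,-1,u,1,0)$, $Z=(1,0,1,0,0)$, $W(u)=\frac12(u^2+1,0,u^2-1,2u,0)$, $C(u)=(-u,1,-u,-1,-1)$; $\xi_{f(\bm p)}=(-w+\frac{z^3}2)X-zW(u)+C(u)$. The set $M=f(\mathbb{R}^4)$ is connected and of type VI; with $\bm b_1=f_s$, $\bm b_2=f_w$, $\bm b_3=\frac{3z^2}2f_w+f_z$, $\bm b_4=(\frac{9z^4}4+z)f_w+\frac{3z^2}2f_z+f_u$ one has $A\mathcal B_{\bm p}=\mathcal B_{\bm p}J_4(0)$. -/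

import Mathlib

open scoped ContDiff Matrix Topology TensorProduct Polynomial

noncomputable section

namespace PseudoIso

/-! ### Pseudo-Euclidean spaces and the two ambient space forms -/

abbrev Vec (m : ℕ) : Type := Fin m → ℝ

/-- The `i`-th standard unit vector (numbering starts at `0`). -/
def ev {m : ℕ} (i : Fin m) : Vec m := Pi.single i 1

/-- The pseudo-inner product of index `s` on `ℝ^m`: the first `s` coordinates are negative. -/
def pip (s m : ℕ) : LinearMap.BilinForm ℝ (Vec m) :=
  Matrix.toBilin' (Matrix.diagonal fun i : Fin m => if i.val < s then (-1 : ℝ) else 1)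

inductive SpaceKind
  | flat
  | sphere

/-- The constant curvature `κ`. -/
def SpaceKind.curv : SpaceKind → ℝ
  | .flat => 0
  | .sphere => 1

/-- Codimension of the space form in the vector space containing it. -/
def SpaceKind.codim : SpaceKind → ℕ
  | .flat => 0
  | .sphere => 1

/-- `spaceForm .flat s m` is `ℝ^m_s`, and `spaceForm .sphere s m` is `S^{m-1}_s ⊆ ℝ^m_s`;
when `s = m - 1`, only the sheet on which the last coordinate is positive is taken. -/
def spaceForm : SpaceKind → (s m : ℕ) → Set (Vec m)
  | .flat, _, _ => Set.univ
  | .sphere, s, m =>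
      {x | pip s m x x = 1 ∧ (s + 1 = m → ∀ i : Fin m, i.val + 1 = m → 0 < x i)}

/-! ### Submanifolds, tangent spaces, and the Levi-Civita connection of the ambient space -/

/-- `M` is an embedded smooth submanifold of `ℝ^m` of codimension `k`. -/
def IsSmoothSubmanifold {m : ℕ} (M : Set (Vec m)) (k : ℕ) : Prop :=
  ∀ x ∈ M, ∃ U : Set (Vec m), IsOpen U ∧ x ∈ U ∧ ∃ F : Vec m → Vec k,
    ContDiffOn ℝ ∞ F U ∧ (∀ y ∈ U, Function.Surjective (fderiv ℝ F y)) ∧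
    M ∩ U = {y | y ∈ U ∧ F y = 0}

/-- `γ` is (near `0`) a smooth curve in `S` that passes through `x` at time `0`. -/
def IsCurveAt {m : ℕ} (S : Set (Vec m)) (x : Vec m) (γ : ℝ → Vec m) : Prop :=
  γ 0 = x ∧ ∃ ε > 0, ContDiffOn ℝ ∞ γ (Set.Ioo (-ε) ε) ∧ ∀ t ∈ Set.Ioo (-ε) ε, γ t ∈ S

/-- The tangent space `T_x S`, spanned by the velocities of the smooth curves in `S` through `x`
(for a submanifold these velocities already form a subspace). -/
def tangentAt {m : ℕ} (S : Set (Vec m)) (x : Vec m) : Submodule ℝ (Vec m) :=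
  Submodule.span ℝ {v | ∃ γ : ℝ → Vec m, IsCurveAt S x γ ∧ deriv γ 0 = v}

/-- The orthogonal projection of `ℝ^m_s` onto the tangent space of the space form at `x`. -/
def projTangent (g : SpaceKind) (s : ℕ) {m : ℕ} (x v : Vec m) : Vec m :=
  v - (g.curv * pip s m v x) • x

/-- `L` is the map `X ↦ ∇̄_X V` on `T_x S`, where `V` is a vector field of the space form along the
submanifold `S`, and where the Levi-Civita connection `∇̄` of the space form is the tangential part
of the ordinary derivative. -/
def IsCovDerivAt (g : SpaceKind) (s : ℕ) {m : ℕ} (S : Set (Vec m)) (V : Vec m → Vec m)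
    (x : Vec m) (L : tangentAt S x →ₗ[ℝ] Vec m) : Prop :=
  ∀ γ : ℝ → Vec m, IsCurveAt S x γ → ∀ X : tangentAt S x, (X : Vec m) = deriv γ 0 →
    L X = projTangent g s x (deriv (fun t => V (γ t)) 0)

/-- `A` is the shape operator `X ↦ -∇̄_X ξ` of `M` at `x` with respect to `ξ`. -/
def IsShapeOperatorAt (g : SpaceKind) (s : ℕ) {m : ℕ} (M : Set (Vec m)) (ξ : Vec m → Vec m)
    (x : Vec m) (A : Module.End ℝ (tangentAt M x)) : Prop :=
  IsCovDerivAt g s M ξ x (-((tangentAt M x).subtype ∘ₗ A))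

/-- The complex eigenvalues of `A`, with algebraic multiplicities. -/
def principalCurvatures {V : Type*} [AddCommGroup V] [Module ℝ V] [Module.Finite ℝ V]
    (A : Module.End ℝ V) : Multiset ℂ :=
  (A.charpoly.map (algebraMap ℝ ℂ)).roots

def IsDiagonalizable {K V : Type*} [Field K] [AddCommGroup V] [Module K V]
    (A : Module.End K V) : Prop :=
  ∃ (ι : Type) (b : Module.Basis ι K V), ∀ i, ∃ μ : K, A (b i) = μ • b i

/-- `M` is a connected non-degenerate isoparametric hypersurface of index `q` in the space form,
with unit normal field `ξ` satisfying `⟨ξ, ξ⟩ = ν`. -/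
structure IsIsoparametricHypersurface (g : SpaceKind) (s : ℕ) {m : ℕ} (q : ℕ)
    (M : Set (Vec m)) (ξ : Vec m → Vec m) (ν : ℝ) : Prop where
  connected : IsConnected M
  subset : M ⊆ spaceForm g s m
  submanifold : IsSmoothSubmanifold M (g.codim + 1)
  nondegenerate : ∀ x ∈ M, ((pip s m).restrict (tangentAt M x)).Nondegenerate
  index : ∀ x ∈ M,
    sigNeg (LinearMap.BilinMap.toQuadraticMap ((pip s m).restrict (tangentAt M x))) = q
  smooth_normal : ContDiffOn ℝ ∞ ξ M
  normal_mem : ∀ x ∈ M, ξ x ∈ tangentAt (spaceForm g s m) x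
  normal : ∀ x ∈ M, ∀ v ∈ tangentAt M x, pip s m (ξ x) v = 0
  unit_sign : ν = 1 ∨ ν = -1
  unit : ∀ x ∈ M, pip s m (ξ x) (ξ x) = ν
  isoparametric : ∃ χ : Multiset ℂ, ∀ x ∈ M, ∃ A : Module.End ℝ (tangentAt M x),
    IsShapeOperatorAt g s M ξ x A ∧ principalCurvatures A = χ

/-- `b` is a basis of `T_x M`, and the shape operator satisfies `A_x [b] = [b] J`. -/
def HasShapeMatrix (g : SpaceKind) (s : ℕ) {m : ℕ} (M : Set (Vec m)) (ξ : Vec m → Vec m)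
    (x : Vec m) (b : Fin 4 → Vec m) (J : Matrix (Fin 4) (Fin 4) ℝ) : Prop :=
  ∃ A : Module.End ℝ (tangentAt M x), IsShapeOperatorAt g s M ξ x A ∧
    ∃ B : Module.Basis (Fin 4) ℝ (tangentAt M x),
      (∀ i, (B i : Vec m) = b i) ∧ LinearMap.toMatrix B B A = J

def gram (s : ℕ) {m : ℕ} (b : Fin 4 → Vec m) : Matrix (Fin 4) (Fin 4) ℝ :=
  Matrix.of fun i j => pip s m (b i) (b j)

/-! ### Petrov types of index 2 in dimension 4 (types V and VIII need dimension at least 5) -/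

inductive PetrovType
  | I | II | III | IV | VI | VIIi | VIIii | IXi | IXii | X | XI

/-- `(J, G)` is a normal form (shape operator, metric) of the given type. -/
def IsPetrovForm : PetrovType → Matrix (Fin 4) (Fin 4) ℝ → Matrix (Fin 4) (Fin 4) ℝ → Prop
  | .I, J, G => ∃ α β : ℝ, 0 < β ∧
      J = !![α, -β, 1, 0; β, α, 0, 1; 0, 0, α, -β; 0, 0, β, α] ∧
      G = !![0, 0, -1, 0; 0, 0, 0, 1; -1, 0, 0, 0; 0, 1, 0, 0]
  | .II, J, G => ∃ α₁ β₁ α₂ β₂ : ℝ, 0 < β₁ ∧ 0 < β₂ ∧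
      J = !![α₁, -β₁, 0, 0; β₁, α₁, 0, 0; 0, 0, α₂, -β₂; 0, 0, β₂, α₂] ∧
      G = !![-1, 0, 0, 0; 0, 1, 0, 0; 0, 0, -1, 0; 0, 0, 0, 1]
  | .III, J, G => ∃ α β a₀ a₁ : ℝ, 0 < β ∧
      J = !![α, -β, 0, 0; β, α, 0, 0; 0, 0, a₀, 0; 0, 0, 0, a₁] ∧
      G = !![-1, 0, 0, 0; 0, 1, 0, 0; 0, 0, -1, 0; 0, 0, 0, 1]
  | .IV, J, G => ∃ α β b ε : ℝ, 0 < β ∧ (ε = 1 ∨ ε = -1) ∧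
      J = !![α, -β, 0, 0; β, α, 0, 0; 0, 0, b, 1; 0, 0, 0, b] ∧
      G = !![-1, 0, 0, 0; 0, 1, 0, 0; 0, 0, 0, ε; 0, 0, ε, 0]
  | .VI, J, G => ∃ b ε : ℝ, (ε = 1 ∨ ε = -1) ∧
      J = !![b, 1, 0, 0; 0, b, 1, 0; 0, 0, b, 1; 0, 0, 0, b] ∧
      G = !![0, 0, 0, ε; 0, 0, ε, 0; 0, ε, 0, 0; ε, 0, 0, 0]
  | .VIIi, J, G => ∃ b a₁ : ℝ,
      J = !![b, 1, 0, 0; 0, b, 1, 0; 0, 0, b, 0; 0, 0, 0, a₁] ∧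
      G = !![0, 0, -1, 0; 0, -1, 0, 0; -1, 0, 0, 0; 0, 0, 0, 1]
  | .VIIii, J, G => ∃ b a₀ : ℝ,
      J = !![b, 1, 0, 0; 0, b, 1, 0; 0, 0, b, 0; 0, 0, 0, a₀] ∧
      G = !![0, 0, 1, 0; 0, 1, 0, 0; 1, 0, 0, 0; 0, 0, 0, -1]
  | .IXi, J, G => ∃ b₁ b₂ ε : ℝ, (ε = 1 ∨ ε = -1) ∧
      J = !![b₁, 1, 0, 0; 0, b₁, 0, 0; 0, 0, b₂, 1; 0, 0, 0, b₂] ∧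
      G = !![0, ε, 0, 0; ε, 0, 0, 0; 0, 0, 0, ε; 0, 0, ε, 0]
  | .IXii, J, G => ∃ b₁ b₂ ε : ℝ, (ε = 1 ∨ ε = -1) ∧
      J = !![b₁, 1, 0, 0; 0, b₁, 0, 0; 0, 0, b₂, 1; 0, 0, 0, b₂] ∧
      G = !![0, ε, 0, 0; ε, 0, 0, 0; 0, 0, 0, -ε; 0, 0, -ε, 0]
  | .X, J, G => ∃ b a₀ a₁ ε : ℝ, (ε = 1 ∨ ε = -1) ∧
      J = !![b, 1, 0, 0; 0, b, 0, 0; 0, 0, a₀, 0; 0, 0, 0, a₁] ∧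
      G = !![0, ε, 0, 0; ε, 0, 0, 0; 0, 0, -1, 0; 0, 0, 0, 1]
  | .XI, J, G => ∃ a b c d : ℝ,
      J = !![a, 0, 0, 0; 0, b, 0, 0; 0, 0, c, 0; 0, 0, 0, d] ∧
      G = !![-1, 0, 0, 0; 0, -1, 0, 0; 0, 0, 1, 0; 0, 0, 0, 1]

/-- At every point of `M`, the shape operator and the metric have one and the same normal form of
type `τ`. -/
def HasPetrovType (g : SpaceKind) (s : ℕ) {m : ℕ} (M : Set (Vec m)) (ξ : Vec m → Vec m)
    (τ : PetrovType) : Prop :=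
  ∃ J G, IsPetrovForm τ J G ∧
    ∀ x ∈ M, ∃ b : Fin 4 → Vec m, HasShapeMatrix g s M ξ x b J ∧ gram s b = G

/-! ### Isoparametric functions and their level sets -/

/-- `v` is the gradient at `x` of the function `f` on the space form. -/
def IsGradientAt (g : SpaceKind) (s : ℕ) {m : ℕ} (f : Vec m → ℝ) (x v : Vec m) : Prop :=
  v ∈ tangentAt (spaceForm g s m) x ∧
    ∀ γ : ℝ → Vec m, IsCurveAt (spaceForm g s m) x γ →
      deriv (fun t => f (γ t)) 0 = pip s m v (deriv γ 0)

/-- `l` is the value at `x` of the Laplacian on the space form of the function with gradient field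
`G`, that is, the trace of `X ↦ ∇̄_X G`. -/
def IsLaplacianAt (g : SpaceKind) (s : ℕ) {m : ℕ} (G : Vec m → Vec m) (x : Vec m) (l : ℝ) :
    Prop :=
  ∃ H : Module.End ℝ (tangentAt (spaceForm g s m) x),
    IsCovDerivAt g s (spaceForm g s m) G x ((tangentAt (spaceForm g s m) x).subtype ∘ₗ H) ∧
    LinearMap.trace ℝ _ H = l

/-- `f` is an isoparametric function on the space form with gradient field `G`:
`⟨grad f, grad f⟩ = Φ ∘ f` and `Δ f = Ψ ∘ f`. -/
structure IsIsoparametricFunction (g : SpaceKind) (s : ℕ) {m : ℕ} (f : Vec m → ℝ)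
    (G : Vec m → Vec m) (Φ Ψ : ℝ → ℝ) : Prop where
  smooth : ContDiffOn ℝ ∞ f (spaceForm g s m)
  smooth_grad : ContDiffOn ℝ ∞ G (spaceForm g s m)
  smooth_left : ContDiff ℝ ∞ Φ
  smooth_right : ContDiff ℝ ∞ Ψ
  grad : ∀ x ∈ spaceForm g s m, IsGradientAt g s f x (G x)
  grad_sq : ∀ x ∈ spaceForm g s m, pip s m (G x) (G x) = Φ (f x)
  laplacian : ∀ x ∈ spaceForm g s m, IsLaplacianAt g s G x (Ψ (f x))

/-- The set `W_RN(f)` of the values `c` of `f` with `Φ c ≠ 0`. -/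
def regularValues (g : SpaceKind) (s : ℕ) {m : ℕ} (f : Vec m → ℝ) (Φ : ℝ → ℝ) : Set ℝ :=
  {c | c ∈ f '' spaceForm g s m ∧ Φ c ≠ 0}

/-- The level set `f⁻¹(c)` in the space form. -/
def levelSet (g : SpaceKind) (s : ℕ) {m : ℕ} (f : Vec m → ℝ) (c : ℝ) : Set (Vec m) :=
  {x | x ∈ spaceForm g s m ∧ f x = c}

/-- `M` is a connected component of `L`. -/
def IsComponentOf {m : ℕ} (M L : Set (Vec m)) : Prop :=
  ∃ x ∈ L, M = connectedComponentIn L x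

/-- `f` is an isoparametric function with gradient field `G`; the point `x₀` lies in `f⁻¹(c)`; `c`
lies in `W_RN(f)`; and every connected component `M` of `f⁻¹(c)`, with the unit normal
`ξ = grad f / √|Φ c|`, is an isoparametric hypersurface of index 2 and of Petrov type `τ`, has
`⟨ξ, ξ⟩ = ν`, and satisfies the further claim `Q M ξ`. -/
def IsLevelSetExample (g : SpaceKind) (s : ℕ) {m : ℕ} (f : Vec m → ℝ) (G : Vec m → Vec m)
    (c : ℝ) (x₀ : Vec m) (ν : ℝ) (τ : PetrovType)
    (Q : Set (Vec m) → (Vec m → Vec m) → Prop) : Prop :=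
  x₀ ∈ levelSet g s f c ∧
  ∃ Φ Ψ : ℝ → ℝ, IsIsoparametricFunction g s f G Φ Ψ ∧ c ∈ regularValues g s f Φ ∧
    ∀ M, IsComponentOf M (levelSet g s f c) →
      IsIsoparametricHypersurface g s 2 M (fun x => (√|Φ c|)⁻¹ • G x) ν ∧
      HasPetrovType g s M (fun x => (√|Φ c|)⁻¹ • G x) τ ∧
      Q M (fun x => (√|Φ c|)⁻¹ • G x)

/-- `P ∈ Sym(ℝ^m_s, ⟨·,·⟩_s)`. -/
def IsSym (s : ℕ) {m : ℕ} (P : Matrix (Fin m) (Fin m) ℝ) : Prop :=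
  ∀ u v : Vec m, pip s m (P *ᵥ u) v = pip s m u (P *ᵥ v)

/-- A level set example in `ℝ^5_2`, with `f x = ⟨P x, x⟩ + 2 ⟨p, x⟩` and `grad f = 2 P x + 2 p`. -/
def IsFlatQuadricExample (P : Matrix (Fin 5) (Fin 5) ℝ) (p : Vec 5) (c : ℝ) (x₀ : Vec 5) (ν : ℝ)
    (τ : PetrovType) (Q : Set (Vec 5) → (Vec 5 → Vec 5) → Prop) : Prop :=
  IsSym 2 P ∧
  IsLevelSetExample .flat 2 (fun x => pip 2 5 (P *ᵥ x) x + 2 * pip 2 5 p x)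
    (fun x => (2 : ℝ) • (P *ᵥ x) + (2 : ℝ) • p) c x₀ ν τ Q

/-- A level set example in `S^5_s`, with `f x = ⟨P x, x⟩`, `grad f = 2 P x - 2 ⟨P x, x⟩ x`, where `P`
has minimal polynomial `μ`, and where the shape operator is the restriction of
`(c E - P) / √(-δ μ(c))` to the tangent space (with `δ = κ ν = ν`). -/
def IsSphereQuadricExample (s : ℕ) (P : Matrix (Fin 6) (Fin 6) ℝ) (μ : ℝ[X]) (c : ℝ)
    (x₀ : Vec 6) (ν : ℝ) (τ : PetrovType) (Q : Set (Vec 6) → (Vec 6 → Vec 6) → Prop) : Prop :=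
  IsSym s P ∧ minpoly ℝ P = μ ∧
  IsLevelSetExample .sphere s (fun x => pip s 6 (P *ᵥ x) x)
    (fun x => (2 : ℝ) • (P *ᵥ x) - (2 * pip s 6 (P *ᵥ x) x) • x) c x₀ ν τ
    fun M ξ =>
      (∀ x ∈ M, ∃ A : Module.End ℝ (tangentAt M x), IsShapeOperatorAt .sphere s M ξ x A ∧
        ∀ v : tangentAt M x,
          (A v : Vec 6) = (√(-(ν * μ.eval c)))⁻¹ • (c • (v : Vec 6) - P *ᵥ (v : Vec 6))) ∧
      Q M ξ

/-! ### Data of the level set examples -/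

def PB : Matrix (Fin 5) (Fin 5) ℝ :=
  !![-1, 0, 0, 0, 1; 0, 0, 0, 0, 0; 0, 0, 0, 0, 0; 0, 0, 0, 0, 0; -1, 0, 0, 0, 1]

def frameB (x : Vec 5) : Fin 4 → Vec 5 :=
  ![ev 0 + ev 4, ev 0 + (-x 0 + x 4) • ev 2, ev 1, ev 3]

def PC : Matrix (Fin 5) (Fin 5) ℝ :=
  !![0, 1, 0, 0, 1; 1, 0, -1, 0, 0; 0, 1, 0, 0, 1; 0, 0, 0, 0, 0; -1, 0, 1, 0, 0]

def frameC (x : Vec 5) : Fin 4 → Vec 5 :=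
  let θ₁ : Vec 5 := -ev 0 - ev 2
  let θ₂ : Vec 5 := ev 1 + (x 0 - x 2) • ev 3
  let η₁ : Vec 5 := -ev 1 + ev 4
  let η₂ : Vec 5 := ev 0 + (x 1 + x 4) • ev 3
  let S : ℝ := x 0 + x 1 - x 2 + x 4
  let T : ℝ := x 0 - x 1 - x 2 - x 4
  let θ₁'' : Vec 5 := θ₁ + η₁
  let η₁'' : Vec 5 := θ₁ - η₁
  let θ₂'' : Vec 5 := θ₂ + η₂ + (1 / 2 * S * T) • η₁''
  let η₂'' : Vec 5 := θ₂ - η₂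
  ![(1 / √2) • θ₁'',
    (1 / √2) • θ₂'' - (1 / (4 * √2) * (S ^ 2 - 2)) • θ₁'',
    (1 / √2) • η₁'',
    (1 / √2) • η₂'' + (1 / (4 * √2) * (T ^ 2 - 2)) • η₁'']

def PD : Matrix (Fin 5) (Fin 5) ℝ :=
  !![1, 0, 0, 0, 1; 0, 1, -1, 0, 0; 0, 1, -1, 0, 0; 0, 0, 0, 0, 0; -1, 0, 0, 0, -1]

def frameD (x : Vec 5) : Fin 4 → Vec 5 :=
  let θ₁ : Vec 5 := -ev 0 + ev 4
  let η₁ : Vec 5 := -ev 1 - ev 2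
  let η₂ : Vec 5 := ev 1 + (x 1 - x 2) • ev 3
  let θ₂' : Vec 5 := ev 0 + (x 0 + x 4) • ev 3 - ((x 0 + x 4) * (x 1 - x 2)) • η₁
  ![θ₁, θ₂' - (1 / 2 * ((x 0 + x 4) ^ 2 - 1)) • θ₁,
    η₁, η₂ - (1 / 2 * ((x 1 - x 2) ^ 2 - 1)) • η₁]

def PE : Matrix (Fin 6) (Fin 6) ℝ :=
  !![0, 1, 0, 0, 0, 0; 1, 0, 0, 0, 0, 0; 0, 0, 0, 0, 0, 1;
     0, 0, 0, 0, 1, 0; 0, 0, 0, 1, 0, 0; 0, 0, 1, 0, 0, 0]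

def PF : Matrix (Fin 6) (Fin 6) ℝ :=
  !![0, 0, 1, 0, 0, 0; 0, 1, 0, 0, 0, 0; 1, 0, 0, 0, 0, 0;
     0, 0, 0, 0, 0, 1; 0, 0, 0, 0, 1, 0; 0, 0, 0, 1, 0, 0]

def PG : Matrix (Fin 6) (Fin 6) ℝ :=
  !![0, 0, 1, 0, 0, -1; 0, 0, 0, 0, 0, 0; 1, 0, 0, 1, 0, 0;
     0, 0, -1, 0, 0, 1; 0, 0, 0, 0, 0, 0; 1, 0, 0, 1, 0, 0]

def vecG (x : Vec 6) : Fin 4 → Vec 6 :=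
  let u : ℝ := x 0 + x 3
  let w : ℝ := -x 2 + x 5
  ![(-(x 1 / u)) • ev 0 + ev 1 + (x 1 / u) • ev 3,
    (-(x 2 / u) + x 3 / w) • ev 0 + ev 2 + (x 2 / u + x 0 / w) • ev 3,
    (x 4 / u) • ev 0 - (x 4 / u) • ev 3 + ev 4,
    (x 5 / u - x 3 / w) • ev 0 + (-(x 5 / u) - x 0 / w) • ev 3 + ev 5]

def frameG (x : Vec 6) : Fin 4 → Vec 6 :=
  ![vecG x 1 + vecG x 3, (-((-x 2 + x 5) / (x 0 + x 3))) • vecG x 1, vecG x 0, vecG x 2]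

def PH : Matrix (Fin 6) (Fin 6) ℝ :=
  !![0, 0, 1, 1, 0, 0; 0, 1, 0, 0, 1, 0; 1, 0, 0, 0, 0, 1;
     -1, 0, 0, 0, 0, -1; 0, -1, 0, 0, -1, 0; 0, 0, -1, -1, 0, 0]

def vecH (x : Vec 6) : Fin 4 → Vec 6 :=
  let u : ℝ := x 1 + x 4
  let k : ℝ := (x 2 + x 3) / u ^ 2
  let l : ℝ := (x 0 + x 5) / u ^ 2
  ![ev 0 + (-(x 0 / u) - x 4 * k) • ev 1 + (x 0 / u - x 1 * k) • ev 4,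
    (-(x 2 / u) - x 4 * l) • ev 1 + ev 2 + (x 2 / u - x 1 * l) • ev 4,
    (x 3 / u - x 4 * l) • ev 1 + ev 3 + (-(x 3 / u) - x 1 * l) • ev 4,
    (x 5 / u - x 4 * k) • ev 1 + (-(x 5 / u) - x 1 * k) • ev 4 + ev 5]

def frameH (x : Vec 6) : Fin 4 → Vec 6 :=
  ![-vecH x 0 + vecH x 3, vecH x 1, -vecH x 1 + vecH x 2, vecH x 0]

/-- The frame at the single point `ev 4` in which the metric is also in normal form. -/
def pointFrameH : Fin 4 → Vec 6 :=
  let a : Fin 4 → Vec 6 := vecH (ev 4)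
  ![(1 / √2) • (-a 0 - a 1 + a 2 + a 3),
    (1 / (2 * √2)) • (a 0 + a 1 + a 2 + a 3),
    (1 / √2) • (-a 0 + a 1 - a 2 + a 3),
    (1 / (2 * √2)) • (-a 0 + a 1 + a 2 - a 3)]

def PI : Matrix (Fin 6) (Fin 6) ℝ :=
  !![1, 0, 0, 1, 0, 0; 0, 1, 0, 0, 1, 0; 0, 0, 1, 0, 0, 1;
     -1, 0, 0, -1, 0, 0; 0, -1, 0, 0, -1, 0; 0, 0, -1, 0, 0, -1]

def vecI (x : Vec 6) : Fin 4 → Vec 6 :=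
  let u : ℝ := x 1 + x 4
  let k : ℝ := (x 0 + x 3) / u ^ 2
  let l : ℝ := (x 2 + x 5) / u ^ 2
  ![ev 0 + (-(x 0 / u) - x 4 * k) • ev 1 + (x 0 / u - x 1 * k) • ev 4,
    (-(x 2 / u) - x 4 * l) • ev 1 + ev 2 + (x 2 / u - x 1 * l) • ev 4,
    (x 3 / u - x 4 * k) • ev 1 + ev 3 + (-(x 3 / u) - x 1 * k) • ev 4,
    (x 5 / u - x 4 * l) • ev 1 + (-(x 5 / u) - x 1 * l) • ev 4 + ev 5]

def frameI (x : Vec 6) : Fin 4 → Vec 6 :=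
  ![-vecI x 0 + vecI x 2, vecI x 0, -vecI x 1 + vecI x 3, vecI x 1]

/-- The frame at the single point `ev 4` in which the metric is also in normal form. -/
def pointFrameI : Fin 4 → Vec 6 :=
  let a : Fin 4 → Vec 6 := vecI (ev 4)
  ![-a 0 + a 2, (1 / 2 : ℝ) • (a 0 + a 2), -a 1 + a 3, (1 / 2 : ℝ) • (a 1 + a 3)]

def PJ : Matrix (Fin 6) (Fin 6) ℝ :=
  !![1, 0, 0, 0, 0, -1; 0, 1, 0, 0, -1, 0; 0, 0, 1, -1, 0, 0;
     0, 0, 1, 1, 0, 0; 0, 1, 0, 0, 1, 0; 1, 0, 0, 0, 0, 1]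

/-! ### Parametrized examples in `ℝ^5_2` -/

/-- The partial derivative of `f` at `p` with respect to the `i`-th coordinate. -/
def partialD (f : Vec 4 → Vec 5) (i : Fin 4) (p : Vec 4) : Vec 5 :=
  fderiv ℝ f p (ev i)

/-- `f` is smooth on the open set `D`; the unit normal is given by `ξ (f p) = N p`; every connected
component of `f(D)` is an isoparametric hypersurface of `ℝ^5_2` of index 2 and of Petrov type `τ`,
with `⟨ξ, ξ⟩ = ν`; and the shape operator has the matrix `J` in the frame `b p` at `f p`. -/
def IsParametrizedExample (f : Vec 4 → Vec 5) (D : Set (Vec 4)) (N : Vec 4 → Vec 5) (ν : ℝ)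
    (τ : PetrovType) (b : Vec 4 → Fin 4 → Vec 5) (J : Matrix (Fin 4) (Fin 4) ℝ) : Prop :=
  IsOpen D ∧ D.Nonempty ∧ ContDiffOn ℝ ∞ f D ∧ ∃ ξ : Vec 5 → Vec 5, (∀ p ∈ D, ξ (f p) = N p) ∧
    ∀ M, IsComponentOf M (f '' D) →
      IsIsoparametricHypersurface .flat 2 2 M ξ ν ∧ HasPetrovType .flat 2 M ξ τ ∧
      ∀ p ∈ D, f p ∈ M → HasShapeMatrix .flat 2 M ξ (f p) (b p) J

/- The coordinates of `p` are `(s, u, z, v)` in the next two families. -/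

def XK (s : ℝ) : Vec 5 :=
  ![√2 * (s ^ 2 + 6) / 8 + 1 / 2, √2 / 2, √2 * (s ^ 2 + 6) / 8 - √2 + 1 / 2, -(√2 / 2) * s,
    1 + √2 / 2]

def YK (s : ℝ) : Vec 5 :=
  ![√2 * (s ^ 2 + 6) / 8 - 1 / 2, √2 / 2, √2 * (s ^ 2 + 6) / 8 - √2 - 1 / 2, -(√2 / 2) * s,
    1 - √2 / 2]

def ZK (s : ℝ) : Vec 5 := ![s / 2, 0, s / 2, -1, 0]

def VK : Vec 5 := ![1 / 2, -1, 1 / 2, 0, 0]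

def CK (s : ℝ) : Vec 5 := ![s ^ 2 / 4 + 1, 1, s ^ 2 / 4 - 1, -s, √2]

def fK (a : ℝ) (p : Vec 4) : Vec 5 :=
  (∫ w in (0 : ℝ)..p 0, XK w) + p 1 • YK (p 0) + p 2 • ZK (p 0) + p 3 • VK
    + (1 / a * (1 - √(1 + a ^ 2 * p 3 ^ 2))) • CK (p 0)

def domK : Set (Vec 4) := {p | p 2 + √2 ≠ 0}

def normalK (a : ℝ) (p : Vec 4) : Vec 5 :=
  (-(√2 * p 2 / (p 2 + √2)) * √(1 + a ^ 2 * p 3 ^ 2)) • YK (p 0) - (a * p 3) • VK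
    + √(1 + a ^ 2 * p 3 ^ 2) • CK (p 0)

def frameK (a : ℝ) (p : Vec 4) : Fin 4 → Vec 5 :=
  ![partialD (fK a) 1 p,
    ((p 2 + √2) ^ 2 / (2 * √(1 + a ^ 2 * p 3 ^ 2))) • partialD (fK a) 2 p,
    (-((p 2 + √2) ^ 3 / (2 * √2 * (1 + a ^ 2 * p 3 ^ 2)))) • partialD (fK a) 0 p,
    (√2 * a * p 2 * p 3 / ((p 2 + √2) * √(1 + a ^ 2 * p 3 ^ 2))) • partialD (fK a) 1 p
      + partialD (fK a) 3 p]

def XL (s : ℝ) : Vec 5 :=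
  ![√2 * (s ^ 2 + 2) / 8 - √2, √2 / 2 * s, √2 * (s ^ 2 + 2) / 8, √2 / 2, √2 / 2]

def YL (s : ℝ) : Vec 5 :=
  ![-(√2 * (s ^ 2 + 2) / 8) + √2, -(√2 / 2) * s, -(√2 * (s ^ 2 + 2) / 8), -(√2 / 2), √2 / 2]

def ZL (s : ℝ) : Vec 5 := ![s / 2, 1, s / 2, 0, 0]

def VL : Vec 5 := ![1 / 2, 0, 1 / 2, -1, 0]

def CL (s : ℝ) : Vec 5 := ![s ^ 2 / 4 - 1, s, s ^ 2 / 4 + 1, 1, 0]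

def fL (a : ℝ) (p : Vec 4) : Vec 5 :=
  (∫ w in (0 : ℝ)..p 0, XL w) + p 1 • YL (p 0) + p 2 • ZL (p 0) + p 3 • VL
    + (1 / a * (1 - √(1 - a ^ 2 * p 3 ^ 2))) • CL (p 0)

def domL (a : ℝ) : Set (Vec 4) := {p | p 2 - √2 ≠ 0 ∧ p 3 ∈ Set.Ioo (-(1 / a)) (1 / a)}

def normalL (a : ℝ) (p : Vec 4) : Vec 5 :=
  (√2 * p 2 / (p 2 - √2) * √(1 - a ^ 2 * p 3 ^ 2)) • YL (p 0) - (a * p 3) • VL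
    + √(1 - a ^ 2 * p 3 ^ 2) • CL (p 0)

def frameL (a : ℝ) (p : Vec 4) : Fin 4 → Vec 5 :=
  ![partialD (fL a) 1 p,
    ((p 2 - √2) ^ 2 / (2 * √(1 - a ^ 2 * p 3 ^ 2))) • partialD (fL a) 2 p,
    ((p 2 - √2) ^ 3 / (2 * √2 * (1 - a ^ 2 * p 3 ^ 2))) • partialD (fL a) 0 p,
    (√2 * a * p 2 * p 3 / ((p 2 - √2) * √(1 - a ^ 2 * p 3 ^ 2))) • partialD (fL a) 1 p
      + partialD (fL a) 3 p]

/- The coordinates of `p` are `(s, w, z, u)` in the last example. -/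

def XM : Vec 5 := ![0, -1, 0, 0, 1]

def YM (u : ℝ) : Vec 5 := ![u, -1, u, 1, 0]

def ZM : Vec 5 := ![1, 0, 1, 0, 0]

def WM (u : ℝ) : Vec 5 := (1 / 2 : ℝ) • ![u ^ 2 + 1, 0, u ^ 2 - 1, 2 * u, 0]

def CM (u : ℝ) : Vec 5 := ![-u, 1, -u, -1, -1]

def fM (p : Vec 4) : Vec 5 :=
  (∫ _v in (0 : ℝ)..p 0, XM) + p 1 • WM (p 3) + p 2 • ZM - (p 2 ^ 2 / 2) • CM (p 3)
    + ∫ v in (0 : ℝ)..p 3, YM v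

def normalM (p : Vec 4) : Vec 5 :=
  (-p 1 + p 2 ^ 3 / 2) • XM - p 2 • WM (p 3) + CM (p 3)

def frameM (p : Vec 4) : Fin 4 → Vec 5 :=
  ![partialD fM 0 p,
    partialD fM 1 p,
    (3 * p 2 ^ 2 / 2) • partialD fM 1 p + partialD fM 2 p,
    (9 * p 2 ^ 4 / 4 + p 2) • partialD fM 1 p + (3 * p 2 ^ 2 / 2) • partialD fM 2 p
      + partialD fM 3 p]

end PseudoIso

end

open PseudoIso

set_option linter.unusedSimpArgs false
set_option linter.unnecessarySeqFocus false
set_option linter.unreachableTactic false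
set_option linter.unusedTactic false

namespace PseudoIso

/-! ### Local parametrizations of submanifolds -/

/-- A smooth regular level set is locally the image of a ball under a smooth map whose derivative
at the centre is the inclusion of the kernel. -/
theorem exists_local_parametrization {m k : ℕ} {U : Set (Vec m)} (hU : IsOpen U) {x : Vec m}
    (hx : x ∈ U) {F : Vec m → Vec k} (hF : ContDiffOn ℝ ∞ F U)
    (hs : Function.Surjective (fderiv ℝ F x)) (hFx : F x = 0) :
    ∃ W : Set (Vec m), IsOpen W ∧ x ∈ W ∧ W ⊆ U ∧ ∃ (r : ℝ) (φ : (fderiv ℝ F x).ker → Vec m),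
      0 < r ∧ ContDiffOn ℝ ∞ φ (Metric.ball 0 r) ∧ φ 0 = x ∧
      HasFDerivAt φ (fderiv ℝ F x).ker.subtypeL 0 ∧
      φ '' Metric.ball 0 r = {y | y ∈ W ∧ F y = 0} := by
  have hFa : ContDiffAt ℝ ∞ F x := hF.contDiffAt (hU.mem_nhds hx)
  have hst : HasStrictFDerivAt F (fderiv ℝ F x) x := hFa.hasStrictFDerivAt (by simp)
  have hr : (fderiv ℝ F x).range = ⊤ := LinearMap.range_eq_top.2 hs
  have hker : (fderiv ℝ F x).ker.ClosedComplemented :=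
    Submodule.ClosedComplemented.of_finiteDimensional_quotient (Submodule.closed_of_finiteDimensional _)
  set e := hst.implicitToOpenPartialHomeomorphOfComplemented F _ hr hker with he
  set π := Classical.choose hker
  have hx_src : x ∈ e.source :=
    hst.mem_implicitToOpenPartialHomeomorphOfComplemented_source hr hker
  have hex : e x = (0, 0) := by
    rw [← hFx]
    exact hst.implicitToOpenPartialHomeomorphOfComplemented_self hr hker
  have hder : ∀ y ∈ U, HasFDerivAt e ((fderiv ℝ F y).prod π) y := by
    intro y hy
    have h1 : HasFDerivAt F (fderiv ℝ F y) y :=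
      ((hF.contDiffAt (hU.mem_nhds hy)).differentiableAt (by simp)).hasFDerivAt
    exact h1.prodMk (π.hasFDerivAt.comp y ((hasFDerivAt_id y).sub_const x))
  have hsm : ∀ y ∈ U, ContDiffAt ℝ ∞ e y := by
    intro y hy
    refine ContDiffAt.prodMk (hF.contDiffAt (hU.mem_nhds hy)) ?_
    exact π.contDiff.contDiffAt.comp y (contDiffAt_id.sub contDiffAt_const)
  obtain ⟨E, hE⟩ : ∃ E : Vec m ≃L[ℝ] Vec k × (fderiv ℝ F x).ker,
      (E : Vec m →L[ℝ] _) = (fderiv ℝ F x).prod π :=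
    ⟨(fderiv ℝ F x).equivProdOfSurjectiveOfIsCompl π hr
      (LinearMap.range_eq_of_proj (Classical.choose_spec hker))
      (LinearMap.isCompl_of_proj (Classical.choose_spec hker)), rfl⟩
  have hcont : ContinuousOn (fun y => (fderiv ℝ F y).prod π) U := by
    have h1 : ContinuousOn (fderiv ℝ F) U := hF.continuousOn_fderiv_of_isOpen hU (by simp)
    have h2 : ContinuousOn (fun y => (ContinuousLinearMap.inl ℝ (Vec k) (fderiv ℝ F x).ker).comp
        (fderiv ℝ F y) + (ContinuousLinearMap.inr ℝ (Vec k) (fderiv ℝ F x).ker).comp π) U :=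
      (continuousOn_const.clm_comp h1).add continuousOn_const
    refine h2.congr fun y _ => ?_
    ext v <;> simp
  have hopen : IsOpen (U ∩ (fun y => (fderiv ℝ F y).prod π) ⁻¹'
      Set.range ((↑) : (Vec m ≃L[ℝ] Vec k × (fderiv ℝ F x).ker) → _)) :=
    hcont.isOpen_inter_preimage hU ContinuousLinearEquiv.isOpen
  set U' := U ∩ (fun y => (fderiv ℝ F y).prod π) ⁻¹'
      Set.range ((↑) : (Vec m ≃L[ℝ] Vec k × (fderiv ℝ F x).ker) → _) with hU'
  have hxU' : x ∈ U' := ⟨hx, E, hE⟩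
  have hV : e.target ∩ e.symm ⁻¹' U' ∈ 𝓝 ((0 : Vec k), (0 : (fderiv ℝ F x).ker)) := by
    refine (e.isOpen_inter_preimage_symm hopen).mem_nhds ⟨?_, ?_⟩
    · rw [← hex]; exact e.map_source hx_src
    · rw [← hex, Set.mem_preimage, e.left_inv hx_src]; exact hxU'
  obtain ⟨r, hr0, hball⟩ := Metric.mem_nhds_iff.1 hV
  have hprod : ∀ v : (fderiv ℝ F x).ker, v ∈ Metric.ball (0 : (fderiv ℝ F x).ker) r →
      ((0 : Vec k), v) ∈ Metric.ball ((0 : Vec k), (0 : (fderiv ℝ F x).ker)) r := by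
    intro v hv
    rw [← ball_prod_same]
    exact ⟨Metric.mem_ball_self hr0, hv⟩
  refine ⟨e.source ∩ e ⁻¹' Metric.ball (0, 0) r, e.isOpen_inter_preimage Metric.isOpen_ball,
    ⟨hx_src, by rw [Set.mem_preimage, hex]; exact Metric.mem_ball_self hr0⟩, ?_,
    r, fun v => e.symm (0, v), hr0, ?_, ?_, ?_, ?_⟩
  · rintro y ⟨hy, hy'⟩
    have := (hball hy').2
    rw [Set.mem_preimage, e.left_inv hy] at this
    exact this.1
  · intro v hv
    obtain ⟨h1, h2, E', hE'⟩ := hball (hprod v hv)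
    have h3 : ContDiffAt ℝ ∞ e.symm ((0 : Vec k), v) :=
      e.contDiffAt_symm h1 (f₀' := E') (by rw [hE']; exact hder _ h2) (hsm _ h2)
    exact (h3.comp v (contDiffAt_const.prodMk contDiffAt_id)).contDiffWithinAt
  · show e.symm (0, 0) = x
    rw [← hex, e.left_inv hx_src]
  · have := (hst.to_implicitFunctionOfComplemented hr hker).hasFDerivAt
    rw [hFx] at this
    exact this
  · ext y
    constructor
    · rintro ⟨v, hv, rfl⟩
      have h1 := (hball (hprod v hv)).1
      refine ⟨⟨e.map_target h1, ?_⟩, ?_⟩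
      · rw [Set.mem_preimage, e.right_inv h1]; exact hprod v hv
      · have : (e (e.symm (0, v))).1 = 0 := by rw [e.right_inv h1]
        exact this
    · rintro ⟨⟨hy, hy'⟩, hFy⟩
      have h0 : e y = (0, (e y).2) := Prod.ext hFy rfl
      refine ⟨(e y).2, ?_, ?_⟩
      · rw [Set.mem_preimage, ← ball_prod_same] at hy'
        exact hy'.2
      · show e.symm (0, (e y).2) = y
        rw [← h0, e.left_inv hy]

theorem IsCurveAt.differentiableAt {m : ℕ} {S : Set (Vec m)} {x : Vec m} {γ : ℝ → Vec m}
    (h : IsCurveAt S x γ) : DifferentiableAt ℝ γ 0 := by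
  obtain ⟨-, ε, hε, hγ, -⟩ := h
  exact (hγ.contDiffAt (Ioo_mem_nhds (by linarith) hε)).differentiableAt (by simp)

theorem IsCurveAt.eventually_mem {m : ℕ} {S : Set (Vec m)} {x : Vec m} {γ : ℝ → Vec m}
    (h : IsCurveAt S x γ) : ∀ᶠ t in 𝓝 (0 : ℝ), γ t ∈ S := by
  obtain ⟨-, ε, hε, -, hS⟩ := h
  filter_upwards [Ioo_mem_nhds (by linarith : -ε < 0) hε] with t ht using hS t ht

theorem IsCurveAt.deriv_mem {m : ℕ} {S : Set (Vec m)} {x : Vec m} {γ : ℝ → Vec m}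
    (h : IsCurveAt S x γ) : deriv γ 0 ∈ tangentAt S x :=
  Submodule.subset_span ⟨γ, h, rfl⟩

/-- A function of one variable that is smooth on a neighbourhood of `0` and takes values in `S`
there is a curve in `S`. -/
theorem isCurveAt_of_isOpen {m : ℕ} {S : Set (Vec m)} {x : Vec m} {γ : ℝ → Vec m} {I : Set ℝ}
    (hI : IsOpen I) (h0 : (0 : ℝ) ∈ I) (hγ : ContDiffOn ℝ ∞ γ I) (hS : ∀ t ∈ I, γ t ∈ S)
    (hx : γ 0 = x) : IsCurveAt S x γ := by
  obtain ⟨ε, hε, hb⟩ := Metric.isOpen_iff.1 hI 0 h0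
  rw [Real.ball_eq_Ioo, zero_sub, zero_add] at hb
  exact ⟨hx, ε, hε, hγ.mono hb, fun t ht => hS t (hb ht)⟩

theorem fderiv_apply_deriv_eq_zero {m k : ℕ} {S : Set (Vec m)} {x : Vec m} {γ : ℝ → Vec m}
    (h : IsCurveAt S x γ) {U : Set (Vec m)} (hU : IsOpen U) (hx : x ∈ U) {F : Vec m → Vec k}
    (hF : DifferentiableAt ℝ F x) (hS : ∀ y ∈ S, y ∈ U → F y = 0) :
    fderiv ℝ F x (deriv γ 0) = 0 := by
  have h0 : γ 0 = x := h.1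
  have h1 : HasDerivAt (F ∘ γ) (fderiv ℝ F x (deriv γ 0)) 0 := by
    have : HasFDerivAt F (fderiv ℝ F x) (γ 0) := by rw [h0]; exact hF.hasFDerivAt
    exact this.comp_hasDerivAt 0 h.differentiableAt.hasDerivAt
  have h2 : (F ∘ γ) =ᶠ[𝓝 0] fun _ => (0 : Vec k) := by
    have : ∀ᶠ t in 𝓝 (0 : ℝ), γ t ∈ U :=
      h.differentiableAt.continuousAt.eventually_mem (by rw [h0]; exact hU.mem_nhds hx)
    filter_upwards [this, h.eventually_mem] with t ht ht'
    exact hS _ ht' ht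
  exact h1.unique ((hasDerivAt_const 0 (0 : Vec k)).congr_of_eventuallyEq h2)

/-- The tangent space of a regular level set. -/
theorem tangentAt_eq_ker {m k : ℕ} {M U : Set (Vec m)} (hU : IsOpen U) {x : Vec m}
    (hx : x ∈ U) {F : Vec m → Vec k} (hF : ContDiffOn ℝ ∞ F U)
    (hs : Function.Surjective (fderiv ℝ F x)) (hM : M ∩ U = {y | y ∈ U ∧ F y = 0})
    (hxM : x ∈ M) : tangentAt M x = (fderiv ℝ F x).ker := by
  have hFx : F x = 0 := (hM.subset ⟨hxM, hx⟩).2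
  apply le_antisymm
  · refine Submodule.span_le.2 ?_
    rintro v ⟨γ, hγ, rfl⟩
    exact fderiv_apply_deriv_eq_zero hγ hU hx
      ((hF.contDiffAt (hU.mem_nhds hx)).differentiableAt (by simp))
      fun y hy hyU => (hM.subset ⟨hy, hyU⟩).2
  · intro v hv
    obtain ⟨W, hW, hxW, hWU, r, φ, hr, hφ, hφ0, hφd, him⟩ :=
      exists_local_parametrization hU hx hF hs hFx
    set w : (fderiv ℝ F x).ker := ⟨v, hv⟩
    refine Submodule.subset_span ⟨fun t => φ (t • w), ?_, ?_⟩
    · have hc : Continuous fun t : ℝ => t • w := by fun_prop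
      refine isCurveAt_of_isOpen (I := (fun t : ℝ => t • w) ⁻¹' Metric.ball 0 r)
        (Metric.isOpen_ball.preimage hc) (by simpa using hr) ?_ ?_ (by simpa using hφ0)
      · exact hφ.comp (by fun_prop) (fun t ht => ht)
      · intro t ht
        have : φ (t • w) ∈ φ '' Metric.ball 0 r := ⟨_, ht, rfl⟩
        rw [him] at this
        exact (hM.superset ⟨hWU this.1, this.2⟩).1
    · have h1 : HasDerivAt (fun t : ℝ => t • w) w 0 := by
        simpa using (hasDerivAt_id (0 : ℝ)).smul_const w
      have h2 : HasFDerivAt φ (fderiv ℝ F x).ker.subtypeL ((0 : ℝ) • w) := by simpa using hφd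
      exact (h2.comp_hasDerivAt 0 h1).deriv

/-- Near each of its points, a connected component of a submanifold agrees with the submanifold. -/
theorem IsSmoothSubmanifold.exists_isOpen_subset_component {m k : ℕ} {L : Set (Vec m)}
    (hL : IsSmoothSubmanifold L k) {M : Set (Vec m)} (hM : IsComponentOf M L) {x : Vec m}
    (hx : x ∈ M) : ∃ W : Set (Vec m), IsOpen W ∧ x ∈ W ∧ M ∩ W = L ∩ W := by
  obtain ⟨x₀, hx₀, rfl⟩ := hM
  have hxL : x ∈ L := connectedComponentIn_subset L x₀ hx
  obtain ⟨U, hU, hxU, F, hF, hs, hLU⟩ := hL x hxL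
  obtain ⟨W, hW, hxW, hWU, r, φ, hr, hφ, hφ0, hφd, him⟩ :=
    exists_local_parametrization hU hxU hF (hs x hxU) (hLU.subset ⟨hxL, hxU⟩).2
  have hLW : L ∩ W = φ '' Metric.ball 0 r := by
    rw [him]
    ext y
    constructor
    · rintro ⟨hy, hyW⟩
      exact ⟨hyW, (hLU.subset ⟨hy, hWU hyW⟩).2⟩
    · rintro ⟨hyW, hy⟩
      exact ⟨(hLU.superset ⟨hWU hyW, hy⟩).1, hyW⟩
  have hpre : IsPreconnected (L ∩ W) := by
    rw [hLW]
    exact (convex_ball 0 r).isPreconnected.image φ hφ.continuousOn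
  refine ⟨W, hW, hxW, ?_⟩
  apply Set.Subset.antisymm
  · exact fun y hy => ⟨connectedComponentIn_subset L x₀ hy.1, hy.2⟩
  · rw [connectedComponentIn_eq hx]
    exact fun y hy => ⟨hpre.subset_connectedComponentIn ⟨hxL, hxW⟩ Set.inter_subset_left hy, hy.2⟩

theorem IsSmoothSubmanifold.component {m k : ℕ} {L : Set (Vec m)}
    (hL : IsSmoothSubmanifold L k) {M : Set (Vec m)} (hM : IsComponentOf M L) :
    IsSmoothSubmanifold M k := by
  intro x hx
  obtain ⟨W, hW, hxW, hMW⟩ := hL.exists_isOpen_subset_component hM hx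
  have hxL : x ∈ L := (hMW.subset ⟨hx, hxW⟩).1
  obtain ⟨U, hU, hxU, F, hF, hs, hLU⟩ := hL x hxL
  refine ⟨U ∩ W, hU.inter hW, ⟨hxU, hxW⟩, F, hF.mono Set.inter_subset_left,
    fun y hy => hs y hy.1, ?_⟩
  ext y
  constructor
  · rintro ⟨hy, hyU, hyW⟩
    exact ⟨⟨hyU, hyW⟩, (hLU.subset ⟨(hMW.subset ⟨hy, hyW⟩).1, hyU⟩).2⟩
  · rintro ⟨⟨hyU, hyW⟩, hy⟩
    exact ⟨(hMW.superset ⟨(hLU.superset ⟨hyU, hy⟩).1, hyW⟩).1, hyU, hyW⟩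

theorem tangentAt_congr {m : ℕ} {M L W : Set (Vec m)} (hW : IsOpen W) {x : Vec m} (hx : x ∈ W)
    (h : M ∩ W = L ∩ W) : tangentAt M x = tangentAt L x := by
  have key : ∀ {A B : Set (Vec m)}, A ∩ W = B ∩ W → ∀ γ, IsCurveAt A x γ → IsCurveAt B x γ := by
    rintro A B hAB γ ⟨h0, ε, hε, hγ, hm⟩
    have hI : IsOpen (Set.Ioo (-ε) ε ∩ γ ⁻¹' W) :=
      hγ.continuousOn.isOpen_inter_preimage isOpen_Ioo hW
    refine isCurveAt_of_isOpen hI ⟨⟨by linarith, hε⟩, by rw [Set.mem_preimage, h0]; exact hx⟩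
      (hγ.mono Set.inter_subset_left) (fun t ht => (hAB.subset ⟨hm t ht.1, ht.2⟩).1) h0
  unfold tangentAt
  congr 1
  ext v
  exact ⟨fun ⟨γ, hγ, hv⟩ => ⟨γ, key h γ hγ, hv⟩, fun ⟨γ, hγ, hv⟩ => ⟨γ, key h.symm γ hγ, hv⟩⟩

theorem IsComponentOf.subset {m : ℕ} {M L : Set (Vec m)} (h : IsComponentOf M L) : M ⊆ L := by
  obtain ⟨x, -, rfl⟩ := h
  exact connectedComponentIn_subset L x

theorem IsComponentOf.isConnected {m : ℕ} {M L : Set (Vec m)} (h : IsComponentOf M L) :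
    IsConnected M := by
  obtain ⟨x, hx, rfl⟩ := h
  exact isConnected_connectedComponentIn_iff.2 hx

theorem IsSmoothSubmanifold.tangentAt_component {m k : ℕ} {L : Set (Vec m)}
    (hL : IsSmoothSubmanifold L k) {M : Set (Vec m)} (hM : IsComponentOf M L) {x : Vec m}
    (hx : x ∈ M) : tangentAt M x = tangentAt L x := by
  obtain ⟨W, hW, hxW, hMW⟩ := hL.exists_isOpen_subset_component hM hx
  exact tangentAt_congr hW hxW hMW

end PseudoIso

namespace PseudoIso

/-! ### Gram matrices and the Petrov normal forms -/

theorem pip_apply (s : ℕ) {m : ℕ} (x y : Vec m) :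
    pip s m x y = ∑ i : Fin m, (if i.val < s then (-1 : ℝ) else 1) * x i * y i := by
  unfold pip
  rw [Matrix.toBilin'_apply]
  refine Finset.sum_congr rfl fun i _ => ?_
  rw [Finset.sum_eq_single i]
  · rw [Matrix.diagonal_apply_eq]; ring
  · intro j _ hj
    rw [Matrix.diagonal_apply_ne' _ hj]; ring
  · simp

theorem pip_comm (s : ℕ) {m : ℕ} (x y : Vec m) : pip s m x y = pip s m y x := by
  rw [pip_apply, pip_apply]
  exact Finset.sum_congr rfl fun i _ => by ring

theorem IsPetrovForm.exists_diagonal {τ : PetrovType} {J G : Matrix (Fin 4) (Fin 4) ℝ}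
    (h : IsPetrovForm τ J G) : ∃ (S : Matrix (Fin 4) (Fin 4) ℝ) (w : Fin 4 → ℝ),
      w 0 < 0 ∧ w 1 < 0 ∧ 0 < w 2 ∧ 0 < w 3 ∧ Sᵀ * G * S = Matrix.diagonal w := by
  cases τ
  case I =>
    obtain ⟨α, β, -, -, rfl⟩ := h
    refine ⟨!![1, 0, 1, 0; 0, 1, 0, 1; 1, 0, -1, 0; 0, -1, 0, 1], ![-2, -2, 2, 2],
      by simp, by simp, by simp, by simp, ?_⟩
    ext i j
    fin_cases i <;> fin_cases j <;>
      simp [Matrix.mul_apply, Fin.sum_univ_four] <;> norm_num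
  case II =>
    obtain ⟨α, β, α', β', -, -, -, rfl⟩ := h
    refine ⟨!![1, 0, 0, 0; 0, 0, 1, 0; 0, 1, 0, 0; 0, 0, 0, 1], ![-1, -1, 1, 1],
      by simp, by simp, by simp, by simp, ?_⟩
    ext i j
    fin_cases i <;> fin_cases j <;>
      simp [Matrix.mul_apply, Fin.sum_univ_four]
  case III =>
    obtain ⟨α, β, a, b, -, -, rfl⟩ := h
    refine ⟨!![1, 0, 0, 0; 0, 0, 1, 0; 0, 1, 0, 0; 0, 0, 0, 1], ![-1, -1, 1, 1],
      by simp, by simp, by simp, by simp, ?_⟩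
    ext i j
    fin_cases i <;> fin_cases j <;>
      simp [Matrix.mul_apply, Fin.sum_univ_four]
  case IV =>
    obtain ⟨α, β, b, ε, -, hε, -, rfl⟩ := h
    refine ⟨!![1, 0, 0, 0; 0, 0, 1, 0; 0, 1, 0, 1; 0, -ε, 0, ε], ![-1, -2, 1, 2],
      by simp, by simp, by simp, by simp, ?_⟩
    rcases hε with rfl | rfl <;> ext i j <;>
    fin_cases i <;> fin_cases j <;>
      simp [Matrix.mul_apply, Fin.sum_univ_four] <;> norm_num
  case VI =>
    obtain ⟨b, ε, hε, -, rfl⟩ := h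
    refine ⟨!![1, 0, 1, 0; 0, 1, 0, 1; 0, -ε, 0, ε; -ε, 0, ε, 0], ![-2, -2, 2, 2],
      by simp, by simp, by simp, by simp, ?_⟩
    rcases hε with rfl | rfl <;> ext i j <;>
    fin_cases i <;> fin_cases j <;>
      simp [Matrix.mul_apply, Fin.sum_univ_four] <;> norm_num
  case VIIi =>
    obtain ⟨b, a, -, rfl⟩ := h
    refine ⟨!![1, 0, 1, 0; 0, 1, 0, 0; 1, 0, -1, 0; 0, 0, 0, 1], ![-2, -1, 2, 1],
      by simp, by simp, by simp, by simp, ?_⟩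
    ext i j
    fin_cases i <;> fin_cases j <;>
      simp [Matrix.mul_apply, Fin.sum_univ_four] <;> norm_num
  case VIIii =>
    obtain ⟨b, a, -, rfl⟩ := h
    refine ⟨!![1, 0, 1, 0; 0, 0, 0, 1; -1, 0, 1, 0; 0, 1, 0, 0], ![-2, -1, 2, 1],
      by simp, by simp, by simp, by simp, ?_⟩
    ext i j
    fin_cases i <;> fin_cases j <;>
      simp [Matrix.mul_apply, Fin.sum_univ_four] <;> norm_num
  case IXi =>
    obtain ⟨b, b', ε, hε, -, rfl⟩ := h
    refine ⟨!![1, 0, 1, 0; -ε, 0, ε, 0; 0, 1, 0, 1; 0, -ε, 0, ε], ![-2, -2, 2, 2],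
      by simp, by simp, by simp, by simp, ?_⟩
    rcases hε with rfl | rfl <;> ext i j <;>
    fin_cases i <;> fin_cases j <;>
      simp [Matrix.mul_apply, Fin.sum_univ_four] <;> norm_num
  case IXii =>
    obtain ⟨b, b', ε, hε, -, rfl⟩ := h
    refine ⟨!![1, 0, 1, 0; -ε, 0, ε, 0; 0, 1, 0, 1; 0, ε, 0, -ε], ![-2, -2, 2, 2],
      by simp, by simp, by simp, by simp, ?_⟩
    rcases hε with rfl | rfl <;> ext i j <;>
    fin_cases i <;> fin_cases j <;>
      simp [Matrix.mul_apply, Fin.sum_univ_four] <;> norm_num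
  case X =>
    obtain ⟨b, a, a', ε, hε, -, rfl⟩ := h
    refine ⟨!![1, 0, 1, 0; -ε, 0, ε, 0; 0, 1, 0, 0; 0, 0, 0, 1], ![-2, -1, 2, 1],
      by simp, by simp, by simp, by simp, ?_⟩
    rcases hε with rfl | rfl <;> ext i j <;>
    fin_cases i <;> fin_cases j <;>
      simp [Matrix.mul_apply, Fin.sum_univ_four] <;> norm_num
  case XI =>
    obtain ⟨a, b, c, d, -, rfl⟩ := h
    refine ⟨1, ![-1, -1, 1, 1],
      by simp, by simp, by simp, by simp, ?_⟩
    ext i j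
    fin_cases i <;> fin_cases j <;> simp

theorem IsPetrovForm.det_ne_zero {τ : PetrovType} {J G : Matrix (Fin 4) (Fin 4) ℝ}
    (h : IsPetrovForm τ J G) : G.det ≠ 0 := by
  obtain ⟨S, w, h0, h1, h2, h3, hS⟩ := h.exists_diagonal
  intro h
  have := congrArg Matrix.det hS
  rw [Matrix.det_mul, Matrix.det_mul, h, Matrix.det_diagonal, Fin.prod_univ_four] at this
  simp [h0.ne, h1.ne, h2.ne', h3.ne'] at this

theorem gram_combination (s : ℕ) {m : ℕ} (b : Fin 4 → Vec m) (S : Matrix (Fin 4) (Fin 4) ℝ) :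
    gram s (fun j => ∑ i, S i j • b i) = Sᵀ * gram s b * S := by
  ext i j
  simp only [gram, Matrix.of_apply, Matrix.mul_apply, Matrix.transpose_apply, map_sum, map_smul,
    LinearMap.sum_apply, LinearMap.smul_apply, smul_eq_mul, Finset.sum_mul, Finset.mul_sum]
  refine Finset.sum_congr rfl fun k _ => Finset.sum_congr rfl fun l _ => by ring

theorem linearIndependent_of_gram {s m : ℕ} {b : Fin 4 → Vec m} (h : (gram s b).det ≠ 0) :
    LinearIndependent ℝ b := by
  rw [Fintype.linearIndependent_iff]
  intro c hc
  by_contra hne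
  push Not at hne
  have hc0 : c ≠ 0 := fun h0 => by simp [h0] at hne
  refine h (Matrix.exists_mulVec_eq_zero_iff.1 ⟨c, hc0, ?_⟩)
  ext i
  have : pip s m (b i) (∑ j, c j • b j) = 0 := by rw [hc, map_zero]
  rw [map_sum] at this
  simpa [Matrix.mulVec, dotProduct, gram, mul_comm] using this

theorem exists_basis_of_linearIndependent {m : ℕ} {T : Submodule ℝ (Vec m)} (hT : Module.finrank ℝ T = 4)
    {b : Fin 4 → Vec m} (hb : ∀ i, b i ∈ T) (hli : LinearIndependent ℝ b) :
    ∃ B : Module.Basis (Fin 4) ℝ T, ∀ i, (B i : Vec m) = b i := by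
  have hli' : LinearIndependent ℝ (fun i => (⟨b i, hb i⟩ : T)) :=
    LinearIndependent.of_comp T.subtype hli
  exact ⟨basisOfLinearIndependentOfCardEqFinrank hli' (by simp [hT]), fun i => by simp⟩

theorem sigNeg_eq_two_of_gram_diagonal {s m : ℕ} {T : Submodule ℝ (Vec m)}
    (B : Module.Basis (Fin 4) ℝ T) {w : Fin 4 → ℝ} (h0 : w 0 < 0) (h1 : w 1 < 0) (h2 : 0 < w 2)
    (h3 : 0 < w 3) (hB : gram s (fun i => (B i : Vec m)) = Matrix.diagonal w) :
    sigNeg (LinearMap.BilinMap.toQuadraticMap ((pip s m).restrict T)) = 2 := by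
  set Q : QuadraticForm ℝ T := LinearMap.BilinMap.toQuadraticMap ((pip s m).restrict T)
  have hBij : ∀ i j, pip s m (B i) (B j) = Matrix.diagonal w i j := fun i j => by
    rw [← hB]; rfl
  have hrepr : Q.basisRepr B = QuadraticMap.weightedSumSquares ℝ w := by
    ext c
    rw [QuadraticMap.basisRepr_apply, QuadraticMap.weightedSumSquares_apply,
      LinearMap.BilinMap.toQuadraticMap_apply]
    have : ((pip s m).restrict T) (∑ i, c i • B i) (∑ i, c i • B i)
        = ∑ i, ∑ j, c i * (c j * pip s m (B i) (B j)) := by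
      simp only [map_sum, map_smul, LinearMap.sum_apply, LinearMap.smul_apply, smul_eq_mul,
        Finset.mul_sum]
      exact Finset.sum_congr rfl fun i _ => Finset.sum_congr rfl fun j _ => by
        rw [show ((pip s m).restrict T) (B j) (B i) = pip s m (B j) (B i) from rfl, pip_comm]
    rw [this]
    refine Finset.sum_congr rfl fun i _ => ?_
    rw [Finset.sum_eq_single i]
    · rw [hBij, Matrix.diagonal_apply_eq, smul_eq_mul]; ring
    · intro j _ hj
      rw [hBij, Matrix.diagonal_apply_ne' _ hj]; ring
    · simp
  have he : Q.Equivalent (QuadraticMap.weightedSumSquares ℝ w) := by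
    rw [← hrepr]
    exact ⟨Q.isometryEquivBasisRepr B⟩
  rw [QuadraticForm.sigNeg_of_equiv_weightedSumSquares he]
  have : {i | w i < 0} = {0, 1} := by
    ext i
    fin_cases i <;> simp [h0, h1, h2.le, h3.le]
  rw [this, Set.ncard_pair (by decide)]

theorem IsPetrovForm.nondegenerate {τ : PetrovType} {J G : Matrix (Fin 4) (Fin 4) ℝ}
    (h : IsPetrovForm τ J G) {s m : ℕ} {T : Submodule ℝ (Vec m)} (B : Module.Basis (Fin 4) ℝ T)
    (hB : gram s (fun i => (B i : Vec m)) = G) : ((pip s m).restrict T).Nondegenerate := by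
  refine LinearMap.BilinForm.nondegenerate_of_det_ne_zero _ B ?_
  have : LinearMap.BilinForm.toMatrix B ((pip s m).restrict T) = G := by
    rw [← hB]
    ext i j
    rw [LinearMap.BilinForm.toMatrix_apply]
    rfl
  rw [this]
  exact h.det_ne_zero

theorem IsPetrovForm.sigNeg_eq_two {τ : PetrovType} {J G : Matrix (Fin 4) (Fin 4) ℝ}
    (h : IsPetrovForm τ J G) {s m : ℕ} {T : Submodule ℝ (Vec m)} (B : Module.Basis (Fin 4) ℝ T)
    (hB : gram s (fun i => (B i : Vec m)) = G) :
    sigNeg (LinearMap.BilinMap.toQuadraticMap ((pip s m).restrict T)) = 2 := by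
  obtain ⟨S, w, h0, h1, h2, h3, hS⟩ := h.exists_diagonal
  have hg : gram s (fun j => ∑ i, S i j • (B i : Vec m)) = Matrix.diagonal w := by
    rw [gram_combination, hB, hS]
  have hli : LinearIndependent ℝ (fun j => ∑ i, S i j • (B i : Vec m)) := by
    apply linearIndependent_of_gram (s := s)
    rw [hg, Matrix.det_diagonal, Fin.prod_univ_four]
    simp [h0.ne, h1.ne, h2.ne', h3.ne']
  have hfin : Module.finrank ℝ T = 4 := by simpa using Module.finrank_eq_card_basis B
  obtain ⟨B', hB'⟩ := exists_basis_of_linearIndependent hfin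
    (fun j => T.sum_mem fun i _ => T.smul_mem _ (B i).2) hli
  refine sigNeg_eq_two_of_gram_diagonal B' h0 h1 h2 h3 ?_
  simp only [hB']
  exact hg

/-! ### Shape operators induced by linear maps of the ambient space -/

/-- The linear map `L` of the ambient space restricts to the shape operator of `M` at `x`. -/
structure HasShapeMap (g : SpaceKind) (s : ℕ) {m : ℕ} (M : Set (Vec m)) (ξ : Vec m → Vec m)
    (x : Vec m) (L : Vec m →ₗ[ℝ] Vec m) : Prop where
  mapsTo : ∀ v ∈ tangentAt M x, L v ∈ tangentAt M x
  apply_deriv : ∀ γ : ℝ → Vec m, IsCurveAt M x γ →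
    L (deriv γ 0) = -projTangent g s x (deriv (fun t => ξ (γ t)) 0)

section ShapeMap

variable {g : SpaceKind} {s m : ℕ} {M : Set (Vec m)} {ξ : Vec m → Vec m} {x : Vec m}
  {L : Vec m →ₗ[ℝ] Vec m}

theorem HasShapeMap.isShapeOperatorAt (h : HasShapeMap g s M ξ x L) :
    IsShapeOperatorAt g s M ξ x (L.restrict h.mapsTo) := by
  intro γ hγ X hX
  have := h.apply_deriv γ hγ
  simp only [LinearMap.neg_apply, LinearMap.comp_apply, Submodule.subtype_apply,
    LinearMap.coe_restrict_apply, hX]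
  rw [this, neg_neg]

theorem toMatrix_restrict (h : ∀ v ∈ tangentAt M x, L v ∈ tangentAt M x)
    (B : Module.Basis (Fin 4) ℝ (tangentAt M x)) {b : Fin 4 → Vec m}
    (hB : ∀ i, (B i : Vec m) = b i) {J : Matrix (Fin 4) (Fin 4) ℝ}
    (hJ : ∀ j, L (b j) = ∑ i, J i j • b i) :
    LinearMap.toMatrix B B (L.restrict h) = J := by
  have : Matrix.toLin B B J = L.restrict h := by
    refine B.ext fun j => Subtype.ext ?_
    rw [Matrix.toLin_self]
    simp [hB, hJ]
  rw [← this, LinearMap.toMatrix_toLin]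

theorem HasShapeMap.hasShapeMatrix (h : HasShapeMap g s M ξ x L)
    (hT : Module.finrank ℝ (tangentAt M x) = 4) {b : Fin 4 → Vec m}
    (hb : ∀ i, b i ∈ tangentAt M x) (hli : LinearIndependent ℝ b)
    {J : Matrix (Fin 4) (Fin 4) ℝ} (hJ : ∀ j, L (b j) = ∑ i, J i j • b i) :
    HasShapeMatrix g s M ξ x b J := by
  obtain ⟨B, hB⟩ := exists_basis_of_linearIndependent hT hb hli
  exact ⟨_, h.isShapeOperatorAt, B, hB, toMatrix_restrict h.mapsTo B hB hJ⟩

theorem principalCurvatures_eq_of_toMatrix {V : Type*} [AddCommGroup V] [Module ℝ V]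
    [Module.Finite ℝ V] {A : Module.End ℝ V} (B : Module.Basis (Fin 4) ℝ V)
    {J : Matrix (Fin 4) (Fin 4) ℝ} (h : LinearMap.toMatrix B B A = J) :
    principalCurvatures A = (J.charpoly.map (algebraMap ℝ ℂ)).roots := by
  unfold principalCurvatures
  rw [← LinearMap.charpoly_toMatrix A B, h]

end ShapeMap

/-- A connected hypersurface with a unit normal field all of whose shape operators have the same
Petrov normal form is isoparametric of index `2`. -/
theorem HasPetrovType.isIsoparametricHypersurface {g : SpaceKind} {s m : ℕ} {M : Set (Vec m)}
    {ξ : Vec m → Vec m} {ν : ℝ} {τ : PetrovType} (h : HasPetrovType g s M ξ τ)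
    (hM : IsConnected M) (hsub : M ⊆ spaceForm g s m) (hman : IsSmoothSubmanifold M (g.codim + 1))
    (hξ : ContDiffOn ℝ ∞ ξ M) (hmem : ∀ x ∈ M, ξ x ∈ tangentAt (spaceForm g s m) x)
    (hnor : ∀ x ∈ M, ∀ v ∈ tangentAt M x, pip s m (ξ x) v = 0) (hν : ν = 1 ∨ ν = -1)
    (hunit : ∀ x ∈ M, pip s m (ξ x) (ξ x) = ν) : IsIsoparametricHypersurface g s 2 M ξ ν := by
  obtain ⟨J, G, hJG, hx⟩ := h
  refine ⟨hM, hsub, hman, ?_, ?_, hξ, hmem, hnor, hν, hunit,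
    (J.charpoly.map (algebraMap ℝ ℂ)).roots, ?_⟩
  · intro x hxM
    obtain ⟨b, ⟨A, hA, B, hB, hBJ⟩, hG⟩ := hx x hxM
    exact hJG.nondegenerate B (by simpa only [hB] using hG)
  · intro x hxM
    obtain ⟨b, ⟨A, hA, B, hB, hBJ⟩, hG⟩ := hx x hxM
    exact hJG.sigNeg_eq_two B (by simpa only [hB] using hG)
  · intro x hxM
    obtain ⟨b, ⟨A, hA, B, hB, hBJ⟩, hG⟩ := hx x hxM
    exact ⟨A, hA, principalCurvatures_eq_of_toMatrix B hBJ⟩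

end PseudoIso

namespace PseudoIso

/-! ### Calculus of quadratic functions -/

/-- `v ↦ ⟨w, v⟩` as a continuous linear form. -/
noncomputable def pipL (s : ℕ) {m : ℕ} (w : Vec m) : Vec m →L[ℝ] ℝ :=
  LinearMap.toContinuousLinearMap (pip s m w)

@[simp]
theorem pipL_apply (s : ℕ) {m : ℕ} (w v : Vec m) : pipL s w v = pip s m w v := rfl

/-- `v ↦ P v` as a continuous linear map. -/
noncomputable def mulVecL {m : ℕ} (P : Matrix (Fin m) (Fin m) ℝ) : Vec m →L[ℝ] Vec m :=
  LinearMap.toContinuousLinearMap P.mulVecLin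

@[simp]
theorem mulVecL_apply {m : ℕ} (P : Matrix (Fin m) (Fin m) ℝ) (v : Vec m) :
    mulVecL P v = P *ᵥ v := rfl

section Calculus

variable {E : Type*} [NormedAddCommGroup E] [NormedSpace ℝ E] {s m : ℕ}

theorem contDiff_pip {f g : E → Vec m} (hf : ContDiff ℝ ∞ f) (hg : ContDiff ℝ ∞ g) :
    ContDiff ℝ ∞ fun y => pip s m (f y) (g y) := by
  simp only [pip_apply]
  exact ContDiff.sum fun i _ =>
    (contDiff_const.mul (contDiff_pi.1 hf i)).mul (contDiff_pi.1 hg i)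

theorem contDiff_mulVec {f : E → Vec m} (P : Matrix (Fin m) (Fin m) ℝ) (hf : ContDiff ℝ ∞ f) :
    ContDiff ℝ ∞ fun y => P *ᵥ f y :=
  (mulVecL P).contDiff.comp hf

theorem hasFDerivAt_pip {f g : E → Vec m} {f' g' : E →L[ℝ] Vec m} {x : E}
    (hf : HasFDerivAt f f' x) (hg : HasFDerivAt g g' x) :
    HasFDerivAt (fun y => pip s m (f y) (g y))
      ((pipL s (f x)).comp g' + (pipL s (g x)).comp f') x := by
  convert! (pip s m).toContinuousBilinearMap.hasFDerivAt_of_bilinear hf hg using 1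
  ext v
  simp [pip_comm s (g x)]

theorem hasFDerivAt_quadratic {P : Matrix (Fin m) (Fin m) ℝ} (hP : IsSym s P) (x : Vec m) :
    HasFDerivAt (fun y => pip s m (P *ᵥ y) y) (pipL s ((2 : ℝ) • (P *ᵥ x))) x := by
  have := hasFDerivAt_pip (s := s) (mulVecL P).hasFDerivAt (hasFDerivAt_id x)
  convert! this using 1
  ext v
  simp [← hP x v]
  ring

theorem isSym_one : IsSym s (1 : Matrix (Fin m) (Fin m) ℝ) := fun u v => by
  simp

theorem hasFDerivAt_pip_self (x : Vec m) :
    HasFDerivAt (fun y => pip s m y y) (pipL s ((2 : ℝ) • x)) x := by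
  simpa using hasFDerivAt_quadratic (s := s) isSym_one x

theorem hasFDerivAt_flat_quadric {P : Matrix (Fin m) (Fin m) ℝ} (hP : IsSym s P) (p x : Vec m) :
    HasFDerivAt (fun y => pip s m (P *ᵥ y) y + 2 * pip s m p y)
      (pipL s ((2 : ℝ) • (P *ᵥ x) + (2 : ℝ) • p)) x := by
  have := (hasFDerivAt_quadratic hP x).add ((pipL s p).hasFDerivAt.const_mul 2 (x := x))
  convert! this using 1
  ext v
  simp

theorem pipL_surjective {w v : Vec m} (h : pip s m w v ≠ 0) : Function.Surjective (pipL s w) :=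
  fun a => ⟨(a / pip s m w v) • v, by simp [h]⟩

theorem finrank_ker_of_surjective {k : ℕ} {f : Vec m →L[ℝ] Vec k} (hf : Function.Surjective f) :
    Module.finrank ℝ f.ker + k = m := by
  have h1 := LinearMap.finrank_range_add_finrank_ker (f : Vec m →ₗ[ℝ] Vec k)
  rw [LinearMap.range_eq_top.2 hf, finrank_top] at h1
  simp only [Module.finrank_fin_fun] at h1
  have h2 : Module.finrank ℝ (LinearMap.ker (f : Vec m →ₗ[ℝ] Vec k))
    = Module.finrank ℝ f.ker := rfl
  omega

end Calculus

/-! ### The ambient space forms -/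

theorem tangentAt_flat {s m : ℕ} (x : Vec m) : tangentAt (spaceForm .flat s m) x = ⊤ := by
  refine eq_top_iff.2 fun v _ => Submodule.subset_span ⟨fun t => x + t • v, ?_, ?_⟩
  · refine isCurveAt_of_isOpen isOpen_univ (Set.mem_univ 0) ?_ (fun t _ => Set.mem_univ _)
      (by simp)
    exact (contDiff_const.add (contDiff_id.smul contDiff_const)).contDiffOn
  · have : HasDerivAt (fun t : ℝ => x + t • v) v 0 := by
      simpa using ((hasDerivAt_id (0 : ℝ)).smul_const v).const_add x
    exact this.deriv

theorem mem_sphere_iff {s m : ℕ} (hs : s + 1 ≠ m) (x : Vec m) :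
    x ∈ spaceForm .sphere s m ↔ pip s m x x = 1 :=
  ⟨fun h => h.1, fun h => ⟨h, fun h' => absurd h' hs⟩⟩

theorem mem_tangentAt_sphere_iff {s m : ℕ} (hs : s + 1 ≠ m) {x : Vec m} (hx : pip s m x x = 1)
    (v : Vec m) : v ∈ tangentAt (spaceForm .sphere s m) x ↔ pip s m x v = 0 := by
  set F : Vec m → Vec 1 := fun y _ => pip s m y y - 1 with hF
  have hd : ∀ y, HasFDerivAt F (ContinuousLinearMap.pi fun _ => pipL s ((2 : ℝ) • y)) y :=
    fun y => hasFDerivAt_pi.2 fun _ => (hasFDerivAt_pip_self y).sub_const 1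
  have hsm : ContDiff ℝ ∞ F :=
    contDiff_pi.2 fun _ => (contDiff_pip contDiff_id contDiff_id).sub contDiff_const
  have := tangentAt_eq_ker (M := spaceForm .sphere s m) isOpen_univ (Set.mem_univ x)
    hsm.contDiffOn (by
      rw [(hd x).fderiv]
      intro a
      refine ⟨(a 0 / 2) • x, ?_⟩
      ext i
      rw [Subsingleton.elim i 0]
      simp [hx]) (by
      ext y
      simp only [Set.inter_univ, Set.mem_univ, true_and, Set.mem_ofPred_eq, mem_sphere_iff hs, hF]
      constructor
      · intro h; ext; simp [h]
      · intro h; have := congrFun h 0; simp at this; linarith)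
    ((mem_sphere_iff hs x).2 hx)
  rw [this, (hd x).fderiv]
  constructor
  · intro h
    have h0 : (ContinuousLinearMap.pi fun _ : Fin 1 => pipL s ((2 : ℝ) • x)) v = 0 := h
    have := congrFun h0 0
    simpa using this
  · intro h
    show (ContinuousLinearMap.pi fun _ : Fin 1 => pipL s ((2 : ℝ) • x)) v = 0
    ext; simp [h]

theorem IsCurveAt.pip_deriv_eq_zero {s m : ℕ} (hs : s + 1 ≠ m) {x : Vec m} {γ : ℝ → Vec m}
    (h : IsCurveAt (spaceForm .sphere s m) x γ) : pip s m x (deriv γ 0) = 0 := by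
  have hx : pip s m x x = 1 := by
    rw [← mem_sphere_iff hs]
    have := h.eventually_mem.self_of_nhds
    rwa [h.1] at this
  exact (mem_tangentAt_sphere_iff hs hx _).1 h.deriv_mem

theorem IsCurveAt.hasDerivAt_comp {m : ℕ} {E : Type*} [NormedAddCommGroup E] [NormedSpace ℝ E]
    {S : Set (Vec m)} {x : Vec m} {γ : ℝ → Vec m} (h : IsCurveAt S x γ) {f : Vec m → E}
    {f' : Vec m →L[ℝ] E} (hf : HasFDerivAt f f' x) :
    HasDerivAt (fun t => f (γ t)) (f' (deriv γ 0)) 0 := by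
  have h0 : γ 0 = x := h.1
  rw [← h0] at hf
  exact hf.comp_hasDerivAt 0 h.differentiableAt.hasDerivAt

/-! ### Level sets of quadratic functions on the flat space -/

section Flat

variable {m : ℕ} {s : ℕ} {P : Matrix (Fin (m + 1)) (Fin (m + 1)) ℝ} {p : Vec (m + 1)}

theorem hasFDerivAt_flat_grad (P : Matrix (Fin (m + 1)) (Fin (m + 1)) ℝ) (p x : Vec (m + 1))
    (k : ℝ) : HasFDerivAt (fun x => k • ((2 : ℝ) • (P *ᵥ x) + (2 : ℝ) • p))
      ((2 * k) • mulVecL P) x := by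
  have := ((((mulVecL P).hasFDerivAt (x := x)).const_smul (2 : ℝ)).add_const
    ((2 : ℝ) • p)).const_smul k
  convert! this using 1
  ext v
  simp
  ring

theorem contDiff_flat_grad (P : Matrix (Fin (m + 1)) (Fin (m + 1)) ℝ) (p : Vec (m + 1)) (k : ℝ) :
    ContDiff ℝ ∞ fun x => k • ((2 : ℝ) • (P *ᵥ x) + (2 : ℝ) • p) :=
  ((((mulVecL P).contDiff (n := ∞)).const_smul (2 : ℝ)).add contDiff_const).const_smul k

theorem isIsoparametricFunction_flat (hP : IsSym s P) {Φ : ℝ → ℝ} (hΦ : ContDiff ℝ ∞ Φ)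
    (hgrad : ∀ x, pip s _ ((2 : ℝ) • (P *ᵥ x) + (2 : ℝ) • p) ((2 : ℝ) • (P *ᵥ x) + (2 : ℝ) • p)
      = Φ (pip s _ (P *ᵥ x) x + 2 * pip s _ p x)) :
    IsIsoparametricFunction .flat s (fun x => pip s _ (P *ᵥ x) x + 2 * pip s _ p x)
      (fun x => (2 : ℝ) • (P *ᵥ x) + (2 : ℝ) • p) Φ (fun _ => 2 * P.trace) := by
  refine ⟨?_, ?_, hΦ, contDiff_const, fun x _ => ⟨?_, fun γ hγ => ?_⟩, fun x _ => hgrad x,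
    fun x _ => ?_⟩
  · exact ((contDiff_pip (contDiff_mulVec P contDiff_id) contDiff_id).add
      (contDiff_const.mul (contDiff_pip contDiff_const contDiff_id))).contDiffOn
  · simpa using (contDiff_flat_grad P p 1).contDiffOn
  · rw [tangentAt_flat]; trivial
  · exact (hγ.hasDerivAt_comp (hasFDerivAt_flat_quadric hP p x)).deriv
  · have hT := tangentAt_flat (s := s) x
    have hmem : ∀ v, ((2 : ℝ) • P.mulVecLin) v ∈ tangentAt (spaceForm .flat s (m + 1)) x := by
      intro v; rw [hT]; trivial
    refine ⟨((2 : ℝ) • P.mulVecLin).restrict fun v _ => hmem v, ?_, ?_⟩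
    · intro γ hγ X hX
      have := (hγ.hasDerivAt_comp (hasFDerivAt_flat_grad P p x 1)).deriv
      simp only [one_smul] at this
      rw [this]
      simp [projTangent, SpaceKind.curv, hX]
    · rw [LinearMap.trace_restrict_eq_of_forall_mem _ _ hmem, map_smul, ← Matrix.toLin'_apply',
        Matrix.trace_toLin'_eq, smul_eq_mul]

/-- What is needed to know about a component `M` of a level set with unit normal field `ξ`: the
tangent spaces are the spaces `T x`, and the shape operators are induced by `L`. -/
structure IsLevelComponent (g : SpaceKind) (s : ℕ) {m : ℕ} (N : Set (Vec m)) (T : Vec m → Set (Vec m))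
    (L : Vec m →ₗ[ℝ] Vec m) (M : Set (Vec m)) (ξ : Vec m → Vec m) : Prop where
  component : IsComponentOf M N
  mem_tangentAt : ∀ x ∈ M, ∀ v, v ∈ tangentAt M x ↔ v ∈ T x
  finrank : ∀ x ∈ M, Module.finrank ℝ (tangentAt M x) = 4
  shape : ∀ x ∈ M, HasShapeMap g s M ξ x L

theorem IsLevelComponent.hasShapeMatrix {g : SpaceKind} {s : ℕ} {m : ℕ} {N : Set (Vec m)}
    {T : Vec m → Set (Vec m)} {L : Vec m →ₗ[ℝ] Vec m} {M : Set (Vec m)} {ξ : Vec m → Vec m}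
    (h : IsLevelComponent g s N T L M ξ) {x : Vec m} (hx : x ∈ M) {b : Fin 4 → Vec m}
    (hb : ∀ i, b i ∈ T x) (hli : LinearIndependent ℝ b) {J : Matrix (Fin 4) (Fin 4) ℝ}
    (hJ : ∀ j, L (b j) = ∑ i, J i j • b i) : HasShapeMatrix g s M ξ x b J :=
  (h.shape x hx).hasShapeMatrix (h.finrank x hx) (fun i => (h.mem_tangentAt x hx _).2 (hb i)) hli hJ

theorem IsLevelComponent.hasPetrovType {g : SpaceKind} {s : ℕ} {m : ℕ} {N : Set (Vec m)}
    {T : Vec m → Set (Vec m)} {L : Vec m →ₗ[ℝ] Vec m} {M : Set (Vec m)} {ξ : Vec m → Vec m}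
    (h : IsLevelComponent g s N T L M ξ) {τ : PetrovType} {J G : Matrix (Fin 4) (Fin 4) ℝ}
    (hJG : IsPetrovForm τ J G)
    (hN : ∀ x ∈ N, ∃ b : Fin 4 → Vec m, (∀ i, b i ∈ T x) ∧ (∀ j, L (b j) = ∑ i, J i j • b i) ∧
      gram s b = G) : HasPetrovType g s M ξ τ := by
  refine ⟨J, G, hJG, fun x hx => ?_⟩
  obtain ⟨b, hb, hJ, hG⟩ := hN x (h.component.subset hx)
  exact ⟨b, h.hasShapeMatrix hx hb (linearIndependent_of_gram (s := s) (hG ▸ hJG.det_ne_zero)) hJ, hG⟩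

/-- The tangent space of a level set of a quadratic function on the flat space. -/
def flatTangent (s : ℕ) {m : ℕ} (P : Matrix (Fin m) (Fin m) ℝ) (p x : Vec m) : Set (Vec m) :=
  {v | pip s m (P *ᵥ x + p) v = 0}

theorem isFlatQuadricExample_of {P : Matrix (Fin 5) (Fin 5) ℝ} {p : Vec 5} {c : ℝ} {x₀ : Vec 5}
    {τ : PetrovType} {Q : Set (Vec 5) → (Vec 5 → Vec 5) → Prop} (hP : IsSym 2 P)
    {Φ : ℝ → ℝ} (hΦ : ContDiff ℝ ∞ Φ)
    (hgrad : ∀ x, pip 2 5 (P *ᵥ x + p) (P *ᵥ x + p) = Φ (pip 2 5 (P *ᵥ x) x + 2 * pip 2 5 p x))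
    (hc : Φ c = 1) (hx₀ : pip 2 5 (P *ᵥ x₀) x₀ + 2 * pip 2 5 p x₀ = c)
    {J G : Matrix (Fin 4) (Fin 4) ℝ} (hJG : IsPetrovForm τ J G)
    (hframe : ∀ x, pip 2 5 (P *ᵥ x) x + 2 * pip 2 5 p x = c →
      ∃ b : Fin 4 → Vec 5, (∀ i, b i ∈ flatTangent 2 P p x) ∧
        (∀ j, (-P.mulVecLin) (b j) = ∑ i, J i j • b i) ∧ gram 2 b = G)
    (hQ : ∀ M ξ, IsLevelComponent .flat 2
      {x | pip 2 5 (P *ᵥ x) x + 2 * pip 2 5 p x = c} (flatTangent 2 P p) (-P.mulVecLin) M ξ →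
      Q M ξ) :
    IsFlatQuadricExample P p c x₀ 1 τ Q := by
  set f : Vec 5 → ℝ := fun x => pip 2 5 (P *ᵥ x) x + 2 * pip 2 5 p x with hf
  have hgrad' : ∀ x, pip 2 5 ((2 : ℝ) • (P *ᵥ x) + (2 : ℝ) • p)
      ((2 : ℝ) • (P *ᵥ x) + (2 : ℝ) • p) = 4 * Φ (f x) := by
    intro x
    rw [← smul_add, map_smul, map_smul, LinearMap.smul_apply, hgrad x]
    simp only [smul_eq_mul]
    ring
  have hlev : levelSet .flat 2 f c = {x | f x = c} := by
    ext x; simp [levelSet, spaceForm]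
  set F : Vec 5 → Vec 1 := fun y _ => f y - c with hF
  have hd : ∀ y, HasFDerivAt F
      (ContinuousLinearMap.pi fun _ => pipL 2 ((2 : ℝ) • (P *ᵥ y) + (2 : ℝ) • p)) y :=
    fun y => hasFDerivAt_pi.2 fun _ => (hasFDerivAt_flat_quadric hP p y).sub_const c
  have hfs : ContDiff ℝ ∞ f := (contDiff_pip (contDiff_mulVec P contDiff_id) contDiff_id).add
      (contDiff_const.mul (contDiff_pip contDiff_const contDiff_id))
  have hsm : ContDiff ℝ ∞ F := contDiff_pi.2 fun _ => hfs.sub contDiff_const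
  set U : Set (Vec 5) := {y | Φ (f y) ≠ 0} with hU
  have hUo : IsOpen U := isOpen_ne_fun (hΦ.continuous.comp hfs.continuous) continuous_const
  have hsurj : ∀ y ∈ U, Function.Surjective (fderiv ℝ F y) := by
    intro y hy a
    have : pip 2 5 ((2 : ℝ) • (P *ᵥ y) + (2 : ℝ) • p) ((2 : ℝ) • (P *ᵥ y) + (2 : ℝ) • p) ≠ 0 := by
      rw [hgrad']; exact mul_ne_zero (by norm_num) hy
    obtain ⟨v, hv⟩ := pipL_surjective this (a 0)
    refine ⟨v, ?_⟩
    rw [(hd y).fderiv]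
    ext i
    rw [Subsingleton.elim i 0]
    exact hv
  have hzero : ∀ y, F y = 0 ↔ f y = c := fun y => by
    constructor
    · intro h; have := congrFun h 0; simp only [hF, Pi.zero_apply] at this; linarith
    · intro h; ext; simp [hF, h]
  have hLU : ∀ x ∈ {x | f x = c}, x ∈ U := fun x hx => by
    rw [Set.mem_ofPred_eq] at hx
    simp [hU, hx, hc]
  have hLF : {x | f x = c} ∩ U = {y | y ∈ U ∧ F y = 0} := by
    ext y; simp only [Set.mem_inter_iff, Set.mem_ofPred_eq, hzero]; exact and_comm
  have hman : IsSmoothSubmanifold {x | f x = c} 1 := fun x hx =>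
    ⟨U, hUo, hLU x hx, F, hsm.contDiffOn, hsurj, hLF⟩
  refine ⟨hP, by rw [hlev]; exact hx₀, fun t => 4 * Φ t, fun _ => 2 * P.trace,
    isIsoparametricFunction_flat hP (contDiff_const.mul hΦ) hgrad',
    ⟨⟨x₀, Set.mem_univ _, hx₀⟩, by simp [hc]⟩, ?_⟩
  intro M hM
  rw [hlev] at hM
  have hk : (√|(4 : ℝ) * Φ c|)⁻¹ = 1 / 2 := by
    rw [hc, mul_one, abs_of_pos (by norm_num), show (4 : ℝ) = 2 ^ 2 by norm_num,
      Real.sqrt_sq (by norm_num)]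
    norm_num
  simp only [hk]
  have hxL : ∀ x ∈ M, f x = c := fun x hx => hM.subset hx
  have hTM : ∀ x ∈ M, tangentAt M x = (fderiv ℝ F x).ker := fun x hx => by
    rw [hman.tangentAt_component hM hx]
    exact tangentAt_eq_ker hUo (hLU x (hxL x hx)) hsm.contDiffOn (hsurj x (hLU x (hxL x hx))) hLF
      (hxL x hx)
  have hmem : ∀ x ∈ M, ∀ v, v ∈ tangentAt M x ↔ v ∈ flatTangent 2 P p x := by
    intro x hx v
    rw [hTM x hx, (hd x).fderiv]
    have : v ∈ (ContinuousLinearMap.pi fun _ : Fin 1 =>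
        pipL 2 ((2 : ℝ) • (P *ᵥ x) + (2 : ℝ) • p)).ker ↔
        (ContinuousLinearMap.pi fun _ : Fin 1 =>
        pipL 2 ((2 : ℝ) • (P *ᵥ x) + (2 : ℝ) • p)) v = 0 := Iff.rfl
    rw [this, funext_iff]
    simp [flatTangent, ← smul_add, -smul_eq_mul]
  have hcomp : IsLevelComponent .flat 2 {x | f x = c} (flatTangent 2 P p) (-P.mulVecLin) M
      (fun x => (1 / 2 : ℝ) • ((2 : ℝ) • (P *ᵥ x) + (2 : ℝ) • p)) := by
    refine ⟨hM, hmem, fun x hx => ?_, fun x hx => ?_⟩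
    · have := finrank_ker_of_surjective (hsurj x (hLU x (hxL x hx)))
      rw [hTM x hx]
      omega
    · have hder : ∀ γ, IsCurveAt M x γ → deriv (fun t => (1 / 2 : ℝ) •
          ((2 : ℝ) • (P *ᵥ γ t) + (2 : ℝ) • p)) 0 = P *ᵥ deriv γ 0 := by
        intro γ hγ
        have := (hγ.hasDerivAt_comp (hasFDerivAt_flat_grad P p x (1 / 2))).deriv
        rw [this]
        simp
      have hap : ∀ γ, IsCurveAt M x γ → (-P.mulVecLin) (deriv γ 0) = -projTangent .flat 2 x
          (deriv (fun t => (1 / 2 : ℝ) • ((2 : ℝ) • (P *ᵥ γ t) + (2 : ℝ) • p)) 0) := by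
        intro γ hγ
        rw [hder γ hγ]
        simp [projTangent, SpaceKind.curv]
      refine ⟨fun v hv => ?_, hap⟩
      rw [hmem x hx] at hv ⊢
      have h1 : HasFDerivAt (fun y => pip 2 5 (P *ᵥ y + p) (P *ᵥ y + p) - Φ (f y)) 
          (0 : Vec 5 →L[ℝ] ℝ) x := by
        have : (fun y => pip 2 5 (P *ᵥ y + p) (P *ᵥ y + p) - Φ (f y)) = fun _ => 0 := by
          ext y; rw [hgrad]; ring
        rw [this]; exact hasFDerivAt_const _ _
      have h2 := ((mulVecL P).hasFDerivAt (x := x)).add_const p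
      have h3 := (hasFDerivAt_pip (s := 2) h2 h2).sub
        ((hΦ.differentiable (by simp) (f x)).hasDerivAt.comp_hasFDerivAt x
          (hasFDerivAt_flat_quadric hP p x))
      have h4 := congrArg (fun l : Vec 5 →L[ℝ] ℝ => l v) (h1.unique h3)
      have hv' : pip 2 5 (P *ᵥ x + p) v = 0 := hv
      simp only [_root_.zero_apply, _root_.sub_apply,
        _root_.add_apply, ContinuousLinearMap.comp_apply, pipL_apply, mulVecL_apply,
        _root_.smul_apply, ← smul_add, map_smul, LinearMap.smul_apply, hv',
        smul_zero, sub_zero] at h4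
      show pip 2 5 (P *ᵥ x + p) ((-P.mulVecLin) v) = 0
      rw [LinearMap.neg_apply, map_neg, Matrix.mulVecLin_apply]
      linarith
  have hpet := hcomp.hasPetrovType hJG hframe
  refine ⟨hpet.isIsoparametricHypersurface hM.isConnected (fun x _ => Set.mem_univ x)
    (hman.component hM) ?_ (fun x _ => by rw [tangentAt_flat]; trivial) ?_ (Or.inl rfl) ?_, hpet,
    hQ M _ hcomp⟩
  · exact (contDiff_flat_grad P p _).contDiffOn
  · intro x hx v hv
    have : pip 2 5 (P *ᵥ x + p) v = 0 := (hmem x hx v).1 hv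
    rw [← smul_add, map_smul, map_smul, LinearMap.smul_apply, LinearMap.smul_apply, this]
    simp
  · intro x hx
    have := hgrad' x
    simp only [map_smul, LinearMap.smul_apply, this, hxL x hx, hc]
    norm_num

end Flat

end PseudoIso

namespace PseudoIso

/-! ### Coordinate formulas -/

@[simp]
theorem ev_apply {m : ℕ} (i j : Fin m) : ev i j = if j = i then (1 : ℝ) else 0 := by
  simp [ev, Pi.single_apply]

theorem pip_two_five (x y : Vec 5) :
    pip 2 5 x y = -(x 0 * y 0) - x 1 * y 1 + x 2 * y 2 + x 3 * y 3 + x 4 * y 4 := by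
  simp [pip_apply, Fin.sum_univ_five]
  ring

theorem ev_five_two : (ev 2 : Vec 5) = ![0, 0, 1, 0, 0] := by
  ext i
  fin_cases i <;> simp

theorem ev_five_three : (ev 3 : Vec 5) = ![0, 0, 0, 1, 0] := by
  ext i
  fin_cases i <;> simp

theorem linearIndependent_of_forall {m : ℕ} {b : Fin 4 → Vec m}
    (h : ∀ c : Fin 4 → ℝ, c 0 • b 0 + c 1 • b 1 + c 2 • b 2 + c 3 • b 3 = 0 →
      c 0 = 0 ∧ c 1 = 0 ∧ c 2 = 0 ∧ c 3 = 0) : LinearIndependent ℝ b := by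
  rw [Fintype.linearIndependent_iff]
  intro c hc
  rw [Fin.sum_univ_four] at hc
  obtain ⟨h0, h1, h2, h3⟩ := h c hc
  intro i
  fin_cases i <;> assumption

/-- A unit vector of `ℝ³` is part of an orthonormal basis. -/
theorem exists_orthonormal_pair {a b c : ℝ} (h : a ^ 2 + b ^ 2 + c ^ 2 = 1) :
    ∃ u v : Fin 3 → ℝ, u 0 ^ 2 + u 1 ^ 2 + u 2 ^ 2 = 1 ∧ v 0 ^ 2 + v 1 ^ 2 + v 2 ^ 2 = 1 ∧
      u 0 * v 0 + u 1 * v 1 + u 2 * v 2 = 0 ∧ u 0 * a + u 1 * b + u 2 * c = 0 ∧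
      v 0 * a + v 1 * b + v 2 * c = 0 := by
  by_cases hr : a ^ 2 + b ^ 2 = 0
  · have ha : a = 0 := by nlinarith [sq_nonneg a, sq_nonneg b]
    have hb : b = 0 := by nlinarith [sq_nonneg a, sq_nonneg b]
    exact ⟨![1, 0, 0], ![0, 1, 0], by simp, by simp, by simp, by simp [ha], by simp [hb]⟩
  · have hpos : 0 < a ^ 2 + b ^ 2 := lt_of_le_of_ne (by positivity) (Ne.symm hr)
    set r := √(a ^ 2 + b ^ 2)
    have hr2 : r ^ 2 = a ^ 2 + b ^ 2 := Real.sq_sqrt hpos.le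
    have hr0 : r ≠ 0 := (Real.sqrt_pos.2 hpos).ne'
    refine ⟨![b / r, -a / r, 0], ![c * a / r, c * b / r, -r], ?_, ?_, ?_, ?_, ?_⟩
    · simp; field_simp; linarith
    · simp; field_simp; linear_combination (r ^ 2 + a ^ 2 + b ^ 2 - 1) * hr2
        + (a ^ 2 + b ^ 2) * h
    · simp; field_simp; ring
    · simp; field_simp; ring
    · simp; field_simp; linear_combination -c * hr2

/-! ### Level sets in `ℝ^5_2` -/

theorem PB_mulVec (x : Vec 5) : PB *ᵥ x = ![-x 0 + x 4, 0, 0, 0, -x 0 + x 4] := by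
  ext i
  fin_cases i <;> simp [PB, Matrix.mulVec, dotProduct, Fin.sum_univ_five]

theorem PC_mulVec (x : Vec 5) :
    PC *ᵥ x = ![x 1 + x 4, x 0 - x 2, x 1 + x 4, 0, -x 0 + x 2] := by
  ext i
  fin_cases i <;> simp [PC, Matrix.mulVec, dotProduct, Fin.sum_univ_five, sub_eq_add_neg]

theorem PD_mulVec (x : Vec 5) :
    PD *ᵥ x = ![x 0 + x 4, x 1 - x 2, x 1 - x 2, 0, -x 0 - x 4] := by
  ext i
  fin_cases i <;> simp [PD, Matrix.mulVec, dotProduct, Fin.sum_univ_five, sub_eq_add_neg]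

theorem frameB_apply (x : Vec 5) : frameB x =
    ![![1, 0, 0, 0, 1], ![1, 0, -x 0 + x 4, 0, 0], ![0, 1, 0, 0, 0], ![0, 0, 0, 1, 0]] := by
  ext i j
  fin_cases i <;> fin_cases j <;> simp [frameB]

theorem example_b : IsFlatQuadricExample PB (ev 2) 1 (ev 0) 1 .X (fun M ξ => ∀ x ∈ M,
      HasShapeMatrix .flat 2 M ξ x (frameB x)
        !![0, 1, 0, 0; 0, 0, 0, 0; 0, 0, 0, 0; 0, 0, 0, 0]) := by
  refine isFlatQuadricExample_of (Φ := fun _ => 1) ?_ contDiff_const ?_ rfl ?_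
    (J := !![0, 1, 0, 0; 0, 0, 0, 0; 0, 0, 0, 0; 0, 0, 0, 0])
    (G := !![0, -1, 0, 0; -1, 0, 0, 0; 0, 0, -1, 0; 0, 0, 0, 1]) ?_ ?_ ?_
  · intro u v
    simp [PB_mulVec, pip_two_five, ev_five_two, ev_five_three]
    ring
  · intro x
    simp [PB_mulVec, pip_two_five, ev_five_two, ev_five_three]
  · simp [PB_mulVec, pip_two_five, ev_five_two, ev_five_three]
  · exact ⟨0, 0, 0, -1, Or.inr rfl, rfl, rfl⟩
  · intro x _
    refine ⟨![![1, 0, 0, 0, 1], ![1 + ((-x 0 + x 4) ^ 2 - 1) / 2, 0, -x 0 + x 4, 0,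
      ((-x 0 + x 4) ^ 2 - 1) / 2], ![0, 1, 0, 0, 0], ![0, 0, 0, 1, 0]], ?_, ?_, ?_⟩
    · intro i
      fin_cases i <;> simp [flatTangent, PB_mulVec, pip_two_five, ev_five_two, ev_five_three] <;> ring
    · intro j
      ext i
      fin_cases j <;> fin_cases i <;> simp [PB_mulVec, Fin.sum_univ_four]
    · ext i j
      fin_cases i <;> fin_cases j <;> simp [gram, pip_two_five, ev_five_two, ev_five_three] <;> ring
  · intro M ξ h x hx
    rw [frameB_apply]
    refine h.hasShapeMatrix hx ?_ ?_ ?_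
    · intro i
      fin_cases i <;> simp [flatTangent, PB_mulVec, pip_two_five, ev_five_two, ev_five_three]
    · refine linearIndependent_of_forall fun c hc => ?_
      have h0 := congrFun hc 0
      have h1 := congrFun hc 1
      have h3 := congrFun hc 3
      have h4 := congrFun hc 4
      simp at h0 h1 h3 h4
      exact ⟨h4, by linarith, h1, h3⟩
    · intro j
      ext i
      fin_cases j <;> fin_cases i <;> simp [PB_mulVec, Fin.sum_univ_four]

theorem gram_smul (s : ℕ) {m : ℕ} (r : ℝ) (b : Fin 4 → Vec m) :
    gram s (fun i => r • b i) = (r * r) • gram s b := by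
  ext i j
  simp [gram, mul_assoc]

theorem inv_sqrt_two_mul_self : (1 / √2 : ℝ) * (1 / √2) = 1 / 2 := by
  rw [div_mul_div_comm, Real.mul_self_sqrt (by norm_num)]
  norm_num

/-- The frame `frameC`, multiplied by `√2`. -/
noncomputable def scaledFrameC (x : Vec 5) : Fin 4 → Vec 5 :=
  let S : ℝ := x 0 + x 1 - x 2 + x 4
  let T : ℝ := x 0 - x 1 - x 2 - x 4
  let θ : Vec 5 := ![-1, -1, -1, 0, 1]
  let η : Vec 5 := ![-1, 1, -1, 0, -1]
  ![θ, ![1, 1, 0, S, 0] + (1 / 2 * S * T) • η - ((S ^ 2 - 2) / 4) • θ, η,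
    ![-1, 1, 0, T, 0] + ((T ^ 2 - 2) / 4) • η]

theorem frameC_eq (x : Vec 5) : frameC x = fun i => (1 / √2) • scaledFrameC x i := by
  have h : (1 / (4 * √2) : ℝ) = 1 / √2 / 4 := by ring
  unfold frameC scaledFrameC
  simp only [h]
  generalize (1 / √2 : ℝ) = r
  ext i j
  fin_cases i <;> fin_cases j <;> simp [-mul_eq_mul_left_iff] <;> ring

theorem gram_scaledFrameC (x : Vec 5) : gram 2 (scaledFrameC x) =
    (2 : ℝ) • !![0, 1, 0, 0; 1, 0, 0, 0; 0, 0, 0, -1; 0, 0, -1, 0] := by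
  ext i j
  fin_cases i <;> fin_cases j <;> simp [gram, pip_two_five, ev_five_two, ev_five_three, scaledFrameC] <;> ring

theorem gram_frameC (x : Vec 5) : gram 2 (frameC x) =
    !![0, 1, 0, 0; 1, 0, 0, 0; 0, 0, 0, -1; 0, 0, -1, 0] := by
  rw [frameC_eq, gram_smul, inv_sqrt_two_mul_self, gram_scaledFrameC, smul_smul]
  norm_num

theorem mulVec_scaledFrameC (x : Vec 5) (j : Fin 4) : (-PC.mulVecLin) (scaledFrameC x j) =
    ∑ i, (!![0, 1, 0, 0; 0, 0, 0, 0; 0, 0, 0, 1; 0, 0, 0, 0] : Matrix (Fin 4) (Fin 4) ℝ) i j • scaledFrameC x i := by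
  ext i
  fin_cases j <;> fin_cases i <;> simp [PC_mulVec, Fin.sum_univ_four, scaledFrameC] <;> ring

theorem mulVec_frameC (x : Vec 5) (j : Fin 4) : (-PC.mulVecLin) (frameC x j) =
    ∑ i, (!![0, 1, 0, 0; 0, 0, 0, 0; 0, 0, 0, 1; 0, 0, 0, 0] : Matrix (Fin 4) (Fin 4) ℝ) i j • frameC x i := by
  simp only [frameC_eq, map_smul, mulVec_scaledFrameC, Finset.smul_sum]
  exact Finset.sum_congr rfl fun i _ => smul_comm _ _ _

theorem frameC_mem (x : Vec 5) (i : Fin 4) : frameC x i ∈ flatTangent 2 PC (ev 3) x := by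
  have : pip 2 5 (PC *ᵥ x + ev 3) (scaledFrameC x i) = 0 := by
    fin_cases i <;> simp [PC_mulVec, pip_two_five, ev_five_two, ev_five_three, scaledFrameC] <;> ring
  show pip 2 5 (PC *ᵥ x + ev 3) (frameC x i) = 0
  rw [frameC_eq, map_smul, this, smul_zero]

theorem example_c : IsFlatQuadricExample PC (ev 3) 1 ((1 / 2 : ℝ) • ev 3) 1 .IXii (fun M ξ => ∀ x ∈ M,
      HasShapeMatrix .flat 2 M ξ x (frameC x)
        !![0, 1, 0, 0; 0, 0, 0, 0; 0, 0, 0, 1; 0, 0, 0, 0] ∧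
      gram 2 (frameC x) = !![0, 1, 0, 0; 1, 0, 0, 0; 0, 0, 0, -1; 0, 0, -1, 0]) := by
  have hform : IsPetrovForm .IXii !![0, 1, 0, 0; 0, 0, 0, 0; 0, 0, 0, 1; 0, 0, 0, 0]
      !![0, 1, 0, 0; 1, 0, 0, 0; 0, 0, 0, -1; 0, 0, -1, 0] :=
    ⟨0, 0, 1, Or.inl rfl, rfl, rfl⟩
  refine isFlatQuadricExample_of (Φ := fun _ => 1) ?_ contDiff_const ?_ rfl ?_ hform
    (fun x _ => ⟨frameC x, frameC_mem x, mulVec_frameC x, gram_frameC x⟩)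
    (fun M ξ h x hx => ⟨h.hasShapeMatrix hx (frameC_mem x) ?_ (mulVec_frameC x), gram_frameC x⟩)
  · intro u v
    simp [PC_mulVec, pip_two_five, ev_five_two, ev_five_three]
    ring
  · intro x
    simp [PC_mulVec, pip_two_five, ev_five_two, ev_five_three]
    ring
  · simp [PC_mulVec, pip_two_five, ev_five_two, ev_five_three]
  · exact linearIndependent_of_gram (s := 2) (by rw [gram_frameC]; exact hform.det_ne_zero)

theorem frameD_apply (x : Vec 5) : frameD x =
    ![![-1, 0, 0, 0, 1], ![1 + ((x 0 + x 4) ^ 2 - 1) / 2, (x 0 + x 4) * (x 1 - x 2),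
      (x 0 + x 4) * (x 1 - x 2), x 0 + x 4, -(((x 0 + x 4) ^ 2 - 1) / 2)], ![0, -1, -1, 0, 0],
      ![0, 1 + ((x 1 - x 2) ^ 2 - 1) / 2, ((x 1 - x 2) ^ 2 - 1) / 2, x 1 - x 2, 0]] := by
  unfold frameD
  ext i j
  fin_cases i <;> fin_cases j <;> simp <;> ring

theorem gram_frameD (x : Vec 5) : gram 2 (frameD x) =
    !![0, 1, 0, 0; 1, 0, 0, 0; 0, 0, 0, 1; 0, 0, 1, 0] := by
  ext i j
  fin_cases i <;> fin_cases j <;> simp [gram, pip_two_five, ev_five_two, ev_five_three, frameD_apply] <;> ring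

theorem mulVec_frameD (x : Vec 5) (j : Fin 4) : (-PD.mulVecLin) (frameD x j) =
    ∑ i, (!![0, 1, 0, 0; 0, 0, 0, 0; 0, 0, 0, 1; 0, 0, 0, 0] : Matrix (Fin 4) (Fin 4) ℝ) i j • frameD x i := by
  ext i
  fin_cases j <;> fin_cases i <;> simp [PD_mulVec, Fin.sum_univ_four, frameD_apply] <;> ring

theorem frameD_mem (x : Vec 5) (i : Fin 4) : frameD x i ∈ flatTangent 2 PD (ev 3) x := by
  show pip 2 5 (PD *ᵥ x + ev 3) (frameD x i) = 0
  fin_cases i <;> simp [PD_mulVec, pip_two_five, ev_five_two, ev_five_three, frameD_apply] <;> ring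

theorem example_d : IsFlatQuadricExample PD (ev 3) 1 ((1 / 2 : ℝ) • ev 3) 1 .IXi (fun M ξ => ∀ x ∈ M,
      HasShapeMatrix .flat 2 M ξ x (frameD x)
        !![0, 1, 0, 0; 0, 0, 0, 0; 0, 0, 0, 1; 0, 0, 0, 0] ∧
      gram 2 (frameD x) = !![0, 1, 0, 0; 1, 0, 0, 0; 0, 0, 0, 1; 0, 0, 1, 0]) := by
  have hform : IsPetrovForm .IXi !![0, 1, 0, 0; 0, 0, 0, 0; 0, 0, 0, 1; 0, 0, 0, 0]
      !![0, 1, 0, 0; 1, 0, 0, 0; 0, 0, 0, 1; 0, 0, 1, 0] :=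
    ⟨0, 0, 1, Or.inl rfl, rfl, rfl⟩
  refine isFlatQuadricExample_of (Φ := fun _ => 1) ?_ contDiff_const ?_ rfl ?_ hform
    (fun x _ => ⟨frameD x, frameD_mem x, mulVec_frameD x, gram_frameD x⟩)
    (fun M ξ h x hx => ⟨h.hasShapeMatrix hx (frameD_mem x) ?_ (mulVec_frameD x), gram_frameD x⟩)
  · intro u v
    simp [PD_mulVec, pip_two_five, ev_five_two, ev_five_three]
    ring
  · intro x
    simp [PD_mulVec, pip_two_five, ev_five_two, ev_five_three]
    ring
  · simp [PD_mulVec, pip_two_five, ev_five_two, ev_five_three]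
  · exact linearIndependent_of_gram (s := 2) (by rw [gram_frameD]; exact hform.det_ne_zero)

end PseudoIso

namespace PseudoIso

/-! ### The pseudo-sphere `S^4_2` -/

theorem isConnected_pseudoSphere : IsConnected {x : Vec 5 | pip 2 5 x x = 1} := by
  set φ : (ℝ × ℝ) × EuclideanSpace ℝ (Fin 3) → Vec 5 := fun q =>
    ![q.1.1, q.1.2, √(1 + q.1.1 ^ 2 + q.1.2 ^ 2) * q.2 0, √(1 + q.1.1 ^ 2 + q.1.2 ^ 2) * q.2 1,
      √(1 + q.1.1 ^ 2 + q.1.2 ^ 2) * q.2 2]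
  have hφ : Continuous φ := by
    refine continuous_pi fun i => ?_
    fin_cases i <;> simp [φ] <;> fun_prop
  have himg : {x : Vec 5 | pip 2 5 x x = 1} =
      φ '' (Set.univ ×ˢ Metric.sphere (0 : EuclideanSpace ℝ (Fin 3)) 1) := by
    ext x
    rw [Set.mem_ofPred_eq, pip_two_five]
    constructor
    · intro hx
      have hpos : 0 < 1 + x 0 ^ 2 + x 1 ^ 2 := by positivity
      set β := √(1 + x 0 ^ 2 + x 1 ^ 2) with hβ
      have hβ2 : β ^ 2 = 1 + x 0 ^ 2 + x 1 ^ 2 := Real.sq_sqrt hpos.le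
      have hβ0 : β ≠ 0 := (Real.sqrt_pos.2 hpos).ne'
      refine ⟨((x 0, x 1), !₂[x 2 / β, x 3 / β, x 4 / β]), ⟨Set.mem_univ _, ?_⟩, ?_⟩
      · rw [mem_sphere_zero_iff_norm, EuclideanSpace.norm_eq, Real.sqrt_eq_one]
        simp [Fin.sum_univ_three]
        field_simp
        linarith
      · ext i
        fin_cases i <;> simp [φ, ← hβ] <;> field_simp
    · rintro ⟨⟨⟨a, b⟩, y⟩, ⟨-, hy⟩, rfl⟩
      rw [mem_sphere_zero_iff_norm, EuclideanSpace.norm_eq, Real.sqrt_eq_one] at hy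
      simp [Fin.sum_univ_three] at hy
      have hβ2 : √(1 + a ^ 2 + b ^ 2) ^ 2 = 1 + a ^ 2 + b ^ 2 := Real.sq_sqrt (by positivity)
      simp [φ]
      linear_combination (1 + a ^ 2 + b ^ 2) * hy + (y 0 ^ 2 + y 1 ^ 2 + y 2 ^ 2) * hβ2
  rw [himg]
  refine IsConnected.image ?_ φ hφ.continuousOn
  refine isConnected_univ.prod (isConnected_sphere ?_ 0 zero_le_one)
  rw [← Module.finrank_eq_rank]
  simp

/-- An orthonormal frame of the pseudo-sphere. -/
theorem exists_frame_pseudoSphere {x : Vec 5} (hx : pip 2 5 x x = 1) :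
    ∃ b : Fin 4 → Vec 5, (∀ i, pip 2 5 x (b i) = 0) ∧
      gram 2 b = !![-1, 0, 0, 0; 0, -1, 0, 0; 0, 0, 1, 0; 0, 0, 0, 1] := by
  rw [pip_two_five] at hx
  have hpos : 0 < 1 + x 0 ^ 2 + x 1 ^ 2 := by positivity
  obtain ⟨β, hβ⟩ : ∃ β, β = √(1 + x 0 ^ 2 + x 1 ^ 2) := ⟨_, rfl⟩
  have hβ2 : β ^ 2 = 1 + x 0 ^ 2 + x 1 ^ 2 := hβ ▸ Real.sq_sqrt hpos.le
  have hβ0 : 0 < β := hβ ▸ Real.sqrt_pos.2 hpos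
  obtain ⟨k, hk⟩ : ∃ k, k * (1 + β) = 1 := ⟨(1 + β)⁻¹, inv_mul_cancel₀ (by positivity)⟩
  obtain ⟨f, hf⟩ : ∃ f, x 2 = β * f := ⟨x 2 / β, by field_simp⟩
  obtain ⟨g, hg⟩ : ∃ g, x 3 = β * g := ⟨x 3 / β, by field_simp⟩
  obtain ⟨h, hh⟩ : ∃ h, x 4 = β * h := ⟨x 4 / β, by field_simp⟩
  have hunit : f ^ 2 + g ^ 2 + h ^ 2 = 1 := by
    have : β ^ 2 * (f ^ 2 + g ^ 2 + h ^ 2 - 1) = 0 := by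
      rw [hf, hg, hh] at hx
      linear_combination hx - hβ2
    rcases mul_eq_zero.1 this with h0 | h0
    · exact absurd h0 (by positivity)
    · linarith
  obtain ⟨u, v, hu, hv, huv, huf, hvf⟩ := exists_orthonormal_pair hunit
  refine ⟨![![1 + x 0 * x 0 * k, x 0 * x 1 * k, x 0 * f, x 0 * g, x 0 * h],
    ![x 1 * x 0 * k, 1 + x 1 * x 1 * k, x 1 * f, x 1 * g, x 1 * h],
    ![0, 0, u 0, u 1, u 2], ![0, 0, v 0, v 1, v 2]], ?_, ?_⟩
  · have hkey : -1 - (β ^ 2 - 1) * k + β = 0 := by linear_combination (1 - β) * hk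
    intro i
    fin_cases i <;> simp [pip_two_five, hf, hg, hh]
    · linear_combination x 0 * hkey + x 0 * k * hβ2 + x 0 * β * hunit
    · linear_combination x 1 * hkey + x 1 * k * hβ2 + x 1 * β * hunit
    · linear_combination β * huf
    · linear_combination β * hvf
  · have hkey : -2 * k - k ^ 2 * (β ^ 2 - 1) + 1 = 0 := by
      linear_combination (-k * β + k - 1) * hk
    ext i j
    fin_cases i <;> fin_cases j <;> simp [gram, pip_two_five]
    · linear_combination x 0 ^ 2 * hkey + x 0 ^ 2 * k ^ 2 * hβ2 + x 0 ^ 2 * hunit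
    · linear_combination x 0 * x 1 * hkey + x 0 * x 1 * k ^ 2 * hβ2 + x 0 * x 1 * hunit
    · linear_combination x 0 * huf
    · linear_combination x 0 * hvf
    · linear_combination x 0 * x 1 * hkey + x 0 * x 1 * k ^ 2 * hβ2 + x 0 * x 1 * hunit
    · linear_combination x 1 ^ 2 * hkey + x 1 ^ 2 * k ^ 2 * hβ2 + x 1 ^ 2 * hunit
    · linear_combination x 1 * huf
    · linear_combination x 1 * hvf
    · linear_combination x 0 * huf
    · linear_combination x 1 * huf
    · linear_combination hu
    · linear_combination huv
    · linear_combination x 0 * hvf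
    · linear_combination x 1 * hvf
    · linear_combination huv
    · linear_combination hv

theorem example_a : IsFlatQuadricExample (-1) 0 (-1) (ev 2) 1 .XI (fun M ξ =>
        M = spaceForm .sphere 2 5 ∧
        ∀ x ∈ M, IsShapeOperatorAt .flat 2 M ξ x LinearMap.id) ∧
      levelSet .flat 2 (fun x : Vec 5 => pip 2 5 ((-1 : Matrix (Fin 5) (Fin 5) ℝ) *ᵥ x) x
        + 2 * pip 2 5 0 x) (-1) = spaceForm .sphere 2 5 := by
  have hf : ∀ x : Vec 5, pip 2 5 ((-1 : Matrix (Fin 5) (Fin 5) ℝ) *ᵥ x) x + 2 * pip 2 5 0 x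
      = -pip 2 5 x x := fun x => by simp [Matrix.neg_mulVec]
  have hset : {x : Vec 5 | pip 2 5 ((-1 : Matrix (Fin 5) (Fin 5) ℝ) *ᵥ x) x + 2 * pip 2 5 0 x = -1}
      = spaceForm .sphere 2 5 := by
    ext x
    rw [Set.mem_ofPred_eq, hf, mem_sphere_iff (by norm_num), neg_inj]
  have hset' : spaceForm .sphere 2 5 = {x : Vec 5 | pip 2 5 x x = 1} := by
    ext x; rw [mem_sphere_iff (by norm_num)]; rfl
  refine ⟨?_, ?_⟩
  · refine isFlatQuadricExample_of (Φ := fun t => -t) ?_ contDiff_neg ?_ (by norm_num) ?_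
      (J := !![1, 0, 0, 0; 0, 1, 0, 0; 0, 0, 1, 0; 0, 0, 0, 1])
      (G := !![-1, 0, 0, 0; 0, -1, 0, 0; 0, 0, 1, 0; 0, 0, 0, 1]) ?_ ?_ ?_
    · intro u v
      simp [Matrix.neg_mulVec]
    · intro x
      rw [hf]
      simp [Matrix.neg_mulVec]
    · rw [hf]
      simp [pip_two_five]
    · exact ⟨1, 1, 1, 1, rfl, rfl⟩
    · intro x hx
      rw [hf, neg_inj] at hx
      obtain ⟨b, hb, hG⟩ := exists_frame_pseudoSphere hx
      refine ⟨b, fun i => ?_, fun j => ?_, hG⟩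
      · simp [flatTangent, Matrix.neg_mulVec, hb i]
      · ext i
        fin_cases j <;> simp [Matrix.neg_mulVec, Fin.sum_univ_four]
    · intro M ξ h
      have hM : M = spaceForm .sphere 2 5 := by
        obtain ⟨x, hx, rfl⟩ := h.component
        rw [hset] at hx ⊢
        rw [hset'] at hx ⊢
        exact isConnected_pseudoSphere.isPreconnected.connectedComponentIn hx
      refine ⟨hM, fun x hx => ?_⟩
      convert! (h.shape x hx).isShapeOperatorAt using 1
      ext v : 2
      simp [Matrix.neg_mulVec]
  · rw [← hset]
    ext x
    simp [levelSet, spaceForm]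

end PseudoIso

namespace PseudoIso

/-! ### Level sets of quadratic functions on the pseudo-sphere -/

section Sphere

variable {m s : ℕ} {P : Matrix (Fin m) (Fin m) ℝ}

/-- The orthogonal projection onto the tangent space of the pseudo-sphere, as a linear map. -/
noncomputable def sphereProj (s : ℕ) {m : ℕ} (x : Vec m) : Vec m →ₗ[ℝ] Vec m :=
  LinearMap.id - (pip s m x).smulRight x

theorem sphereProj_apply (x v : Vec m) : sphereProj s x v = v - pip s m x v • x := rfl

theorem projTangent_sphere (x v : Vec m) : projTangent .sphere s x v = sphereProj s x v := by
  simp [projTangent, SpaceKind.curv, sphereProj_apply, pip_comm s v]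

theorem pip_sphereProj {x : Vec m} (hx : pip s m x x = 1) (v : Vec m) :
    pip s m x (sphereProj s x v) = 0 := by
  simp [sphereProj_apply, hx]

theorem sphereProj_of_mem {x v : Vec m} (h : pip s m x v = 0) : sphereProj s x v = v := by
  simp [sphereProj_apply, h]

theorem trace_sphereProj_comp {x : Vec m} (hx : pip s m x x = 1) (B : Vec m →ₗ[ℝ] Vec m) :
    LinearMap.trace ℝ _ (sphereProj s x * (B * sphereProj s x)) =
      LinearMap.trace ℝ _ B - pip s m x (B x) := by
  have h1 : sphereProj s x * sphereProj s x = sphereProj s x := by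
    refine LinearMap.ext fun v => ?_
    rw [Module.End.mul_apply, sphereProj_of_mem (pip_sphereProj hx v)]
  have h2 : B * sphereProj s x = B - (pip s m x).smulRight (B x) := by
    refine LinearMap.ext fun v => ?_
    simp [sphereProj_apply]
  rw [LinearMap.trace_mul_comm, mul_assoc, h1, h2, map_sub, LinearMap.trace_smulRight]

theorem hasFDerivAt_sphere_grad (hP : IsSym s P) (x : Vec m) (k : ℝ) :
    HasFDerivAt (fun x => k • ((2 : ℝ) • (P *ᵥ x) - (2 * pip s m (P *ᵥ x) x) • x))
      (k • ((2 : ℝ) • mulVecL P - ((2 * pip s m (P *ᵥ x) x) • ContinuousLinearMap.id ℝ (Vec m) +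
        ((2 : ℝ) • pipL s ((2 : ℝ) • (P *ᵥ x))).smulRight x))) x :=
  ((((mulVecL P).hasFDerivAt (x := x)).const_smul (2 : ℝ)).sub
    (((hasFDerivAt_quadratic hP x).const_mul 2).smul (hasFDerivAt_id x))).const_smul k

theorem contDiff_sphere_grad (P : Matrix (Fin m) (Fin m) ℝ) (k : ℝ) :
    ContDiff ℝ ∞ fun x => k • ((2 : ℝ) • (P *ᵥ x) - (2 * pip s m (P *ᵥ x) x) • x) :=
  ((((mulVecL P).contDiff (n := ∞)).const_smul (2 : ℝ)).sub
    ((contDiff_const.mul (contDiff_pip (contDiff_mulVec P contDiff_id) contDiff_id)).smul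
      contDiff_id)).const_smul k

theorem pip_sphere_grad (x : Vec m) (hx : pip s m x x = 1) :
    pip s m x ((2 : ℝ) • (P *ᵥ x) - (2 * pip s m (P *ᵥ x) x) • x) = 0 := by
  simp [hx, pip_comm s x]

theorem pip_mulVec_mulVec (hP : IsSym s P) {α β : ℝ}
    (hP2 : ∀ x, P *ᵥ (P *ᵥ x) = -(α • (P *ᵥ x)) - β • x) (x v : Vec m) :
    pip s m (P *ᵥ x) (P *ᵥ v) = -(α * pip s m (P *ᵥ x) v) - β * pip s m x v := by
  rw [← hP, hP2]
  simp

theorem isIsoparametricFunction_sphere (hs : s + 1 ≠ m) (hP : IsSym s P) {α β : ℝ}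
    (hP2 : ∀ x, P *ᵥ (P *ᵥ x) = -(α • (P *ᵥ x)) - β • x) :
    IsIsoparametricFunction .sphere s (fun x => pip s m (P *ᵥ x) x)
      (fun x => (2 : ℝ) • (P *ᵥ x) - (2 * pip s m (P *ᵥ x) x) • x)
      (fun t => -4 * (t ^ 2 + α * t + β)) (fun t => 2 * P.trace - 2 * m * t) := by
  refine ⟨?_, ?_, by fun_prop, by fun_prop, fun x hx => ⟨?_, fun γ hγ => ?_⟩, fun x hx => ?_,
    fun x hx => ?_⟩
  · exact (contDiff_pip (contDiff_mulVec P contDiff_id) contDiff_id).contDiffOn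
  · simpa using (contDiff_sphere_grad (s := s) P 1).contDiffOn
  · rw [mem_sphere_iff hs] at hx
    exact (mem_tangentAt_sphere_iff hs hx _).2 (pip_sphere_grad x hx)
  · rw [(hγ.hasDerivAt_comp (hasFDerivAt_quadratic hP x)).deriv]
    have := hγ.pip_deriv_eq_zero hs
    simp [this]
  · rw [mem_sphere_iff hs] at hx
    simp only [map_sub, map_smul, LinearMap.sub_apply, LinearMap.smul_apply, smul_eq_mul, hx,
      pip_mulVec_mulVec hP hP2, pip_comm s x]
    ring
  · rw [mem_sphere_iff hs] at hx
    set B : Vec m →ₗ[ℝ] Vec m :=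
      (2 : ℝ) • P.mulVecLin - (2 * pip s m (P *ᵥ x) x) • LinearMap.id with hB
    have hmem : ∀ v, (sphereProj s x * (B * sphereProj s x)) v ∈
        tangentAt (spaceForm .sphere s m) x := fun v =>
      (mem_tangentAt_sphere_iff hs hx _).2 (pip_sphereProj hx _)
    refine ⟨(sphereProj s x * (B * sphereProj s x)).restrict fun v _ => hmem v, ?_, ?_⟩
    · intro γ hγ X hX
      have hd := (hγ.hasDerivAt_comp (hasFDerivAt_sphere_grad hP x 1)).deriv
      simp only [one_smul] at hd
      have h0 := hγ.pip_deriv_eq_zero hs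
      rw [hd, projTangent_sphere]
      simp only [LinearMap.comp_apply, Submodule.subtype_apply, LinearMap.coe_restrict_apply, hX,
        Module.End.mul_apply, sphereProj_of_mem h0]
      simp [hB, sphereProj_apply, hx, h0]
      module
    · rw [LinearMap.trace_restrict_eq_of_forall_mem _ _ hmem, trace_sphereProj_comp hx, hB,
        map_sub, map_smul, map_smul, ← Matrix.toLin'_apply', Matrix.trace_toLin'_eq,
        LinearMap.trace_id]
      simp [hx, pip_comm s x]
      ring

end Sphere

/-- The tangent space of a level set of a quadratic function on the pseudo-sphere. -/
def sphereTangent (s : ℕ) {m : ℕ} (P : Matrix (Fin m) (Fin m) ℝ) (x : Vec m) : Set (Vec m) :=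
  {v | pip s m x v = 0 ∧ pip s m (P *ᵥ x) v = 0}

/-- The linear map `v ↦ k (c v - P v)`. -/
noncomputable def sphereShape {m : ℕ} (P : Matrix (Fin m) (Fin m) ℝ) (k c : ℝ) : Vec m →ₗ[ℝ] Vec m :=
  k • (c • LinearMap.id - P.mulVecLin)

theorem sphereShape_apply {m : ℕ} (P : Matrix (Fin m) (Fin m) ℝ) (k c : ℝ) (v : Vec m) :
    sphereShape P k c v = k • (c • v - P *ᵥ v) := rfl

theorem isSphereQuadricExample_of {s : ℕ} (hs : s + 1 ≠ 6) {P : Matrix (Fin 6) (Fin 6) ℝ}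
    {μ : ℝ[X]} {c : ℝ} {x₀ : Vec 6} {ν : ℝ} {τ : PetrovType}
    {Q : Set (Vec 6) → (Vec 6 → Vec 6) → Prop} (hP : IsSym s P) {α β : ℝ}
    (hP2 : ∀ x, P *ᵥ (P *ᵥ x) = -(α • (P *ᵥ x)) - β • x) (hmin : minpoly ℝ P = μ)
    (hμ : μ.eval c = c ^ 2 + α * c + β) (hν : ν = 1 ∨ ν = -1)
    {k : ℝ} (hk : 0 < k) (hc : k ^ 2 * -(ν * (c ^ 2 + α * c + β)) = 1)
    (hx₀ : pip s 6 x₀ x₀ = 1) (hx₀f : pip s 6 (P *ᵥ x₀) x₀ = c)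
    {J G : Matrix (Fin 4) (Fin 4) ℝ} (hJG : IsPetrovForm τ J G)
    (hframe : ∀ x, pip s 6 x x = 1 → pip s 6 (P *ᵥ x) x = c →
      ∃ b : Fin 4 → Vec 6, (∀ i, b i ∈ sphereTangent s P x) ∧
        (∀ j, sphereShape P k c (b j) = ∑ i, J i j • b i) ∧ gram s b = G)
    (hQ : ∀ M ξ, IsLevelComponent .sphere s
      {x | pip s 6 x x = 1 ∧ pip s 6 (P *ᵥ x) x = c} (sphereTangent s P) (sphereShape P k c) M ξ →
      Q M ξ) :
    IsSphereQuadricExample s P μ c x₀ ν τ Q := by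
  set f : Vec 6 → ℝ := fun x => pip s 6 (P *ᵥ x) x with hf
  obtain ⟨q, hq⟩ : ∃ q, q = c ^ 2 + α * c + β := ⟨_, rfl⟩
  rw [← hq] at hc hμ
  have hνq : ν * q < 0 := by
    by_contra hcon
    nlinarith [mul_nonneg (sq_nonneg k) (not_lt.1 hcon)]
  have hq0 : q ≠ 0 := fun h => by simp [h] at hνq
  have hν2 : ν * ν = 1 := by rcases hν with rfl | rfl <;> norm_num
  have habs : |-4 * q| = (2 / k) ^ 2 := by
    have h1 : (2 / k) ^ 2 = 4 * -(ν * q) := by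
      rw [div_pow, div_eq_iff (by positivity)]
      linear_combination -4 * hc
    rw [h1, abs_mul]
    rcases hν with rfl | rfl
    · rw [abs_of_neg (by linarith : q < 0)]; norm_num
    · rw [abs_of_pos (by linarith : 0 < q)]; norm_num
  have hsqrt : (√|-4 * q|)⁻¹ = k / 2 := by
    rw [habs, Real.sqrt_sq (by positivity), inv_div]
  have hsqrt' : (√(-(ν * q)))⁻¹ = k := by
    have h1 : -(ν * q) = (1 / k) ^ 2 := by
      rw [div_pow, eq_div_iff (by positivity)]
      linear_combination hc
    rw [h1, Real.sqrt_sq (by positivity), one_div, inv_inv]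
  have hlev : levelSet .sphere s f c = {x | pip s 6 x x = 1 ∧ f x = c} := by
    ext x
    show x ∈ spaceForm .sphere s 6 ∧ _ ↔ _
    rw [mem_sphere_iff hs]; rfl
  set F : Vec 6 → Vec 2 := fun y => ![pip s 6 y y - 1, f y - c] with hF
  have hd : ∀ y, HasFDerivAt F (ContinuousLinearMap.pi
      ![pipL s ((2 : ℝ) • y), pipL s ((2 : ℝ) • (P *ᵥ y))]) y := fun y =>
    hasFDerivAt_pi.2 fun i => by
      fin_cases i
      · exact (hasFDerivAt_pip_self y).sub_const 1
      · exact (hasFDerivAt_quadratic hP y).sub_const c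
  have hfs : ContDiff ℝ ∞ f := contDiff_pip (contDiff_mulVec P contDiff_id) contDiff_id
  have hps : ContDiff ℝ ∞ fun y : Vec 6 => pip s 6 y y := contDiff_pip contDiff_id contDiff_id
  have hsm : ContDiff ℝ ∞ F := contDiff_pi.2 fun i => by
    fin_cases i
    · exact hps.sub contDiff_const
    · exact hfs.sub contDiff_const
  set U : Set (Vec 6) :=
    {y | pip s 6 y y * pip s 6 (P *ᵥ y) (P *ᵥ y) - f y ^ 2 ≠ 0} with hU
  have hUo : IsOpen U := by
    refine isOpen_ne_fun ?_ continuous_const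
    have hpp : ContDiff ℝ ∞ fun y : Vec 6 => pip s 6 (P *ᵥ y) (P *ᵥ y) :=
      contDiff_pip (contDiff_mulVec P contDiff_id) (contDiff_mulVec P contDiff_id)
    exact ((hps.mul hpp).sub (hfs.pow 2)).continuous
  have hsurj : ∀ y ∈ U, Function.Surjective (fderiv ℝ F y) := by
    intro y hy a
    have hy' : pip s 6 y y * pip s 6 (P *ᵥ y) (P *ᵥ y) - pip s 6 (P *ᵥ y) y ^ 2 ≠ 0 := hy
    set D := pip s 6 y y * pip s 6 (P *ᵥ y) (P *ᵥ y) - pip s 6 (P *ᵥ y) y ^ 2 with hD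
    refine ⟨((a 0 * pip s 6 (P *ᵥ y) (P *ᵥ y) - a 1 * pip s 6 (P *ᵥ y) y) / (2 * D)) • y +
      ((a 1 * pip s 6 y y - a 0 * pip s 6 (P *ᵥ y) y) / (2 * D)) • (P *ᵥ y), ?_⟩
    rw [(hd y).fderiv]
    ext i
    fin_cases i
    · simp [pip_comm s y (P *ᵥ y)]
      field_simp
      rw [hD]; ring
    · simp
      field_simp
      rw [hD]; ring
  have hzero : ∀ y, F y = 0 ↔ pip s 6 y y = 1 ∧ f y = c := fun y => by
    constructor
    · intro h
      have h0 := congrFun h 0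
      have h1 := congrFun h 1
      simp [hF] at h0 h1
      exact ⟨by linarith, by linarith⟩
    · rintro ⟨h, h'⟩; ext i; fin_cases i <;> simp [hF, h, h']
  have hLU : ∀ x ∈ {x | pip s 6 x x = 1 ∧ f x = c}, x ∈ U := fun x hx => by
    have h1 : pip s 6 x x = 1 := hx.1
    have h2 : pip s 6 (P *ᵥ x) x = c := hx.2
    show pip s 6 x x * pip s 6 (P *ᵥ x) (P *ᵥ x) - pip s 6 (P *ᵥ x) x ^ 2 ≠ 0
    rw [pip_mulVec_mulVec hP hP2, h1, h2]
    intro h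
    apply hq0
    linear_combination hq - h
  have hLF : {x | pip s 6 x x = 1 ∧ f x = c} ∩ U = {y | y ∈ U ∧ F y = 0} := by
    ext y; simp only [Set.mem_inter_iff, Set.mem_ofPred_eq, hzero]; exact and_comm
  have hman : IsSmoothSubmanifold {x | pip s 6 x x = 1 ∧ f x = c} 2 := fun x hx =>
    ⟨U, hUo, hLU x hx, F, hsm.contDiffOn, hsurj, hLF⟩
  refine ⟨hP, hmin, by rw [hlev]; exact ⟨hx₀, hx₀f⟩, _, _,
    isIsoparametricFunction_sphere hs hP hP2,
    ⟨⟨x₀, (mem_sphere_iff hs x₀).2 hx₀, hx₀f⟩, ?_⟩, ?_⟩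
  · show -4 * (c ^ 2 + α * c + β) ≠ 0
    rw [← hq]; exact mul_ne_zero (by norm_num) hq0
  intro M hM
  rw [hlev] at hM
  simp only [← hq, hsqrt, hμ, hsqrt']
  have hxL : ∀ x ∈ M, pip s 6 x x = 1 ∧ pip s 6 (P *ᵥ x) x = c := fun x hx => hM.subset hx
  have hTM : ∀ x ∈ M, tangentAt M x = (fderiv ℝ F x).ker := fun x hx => by
    rw [hman.tangentAt_component hM hx]
    exact tangentAt_eq_ker hUo (hLU x (hxL x hx)) hsm.contDiffOn (hsurj x (hLU x (hxL x hx))) hLF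
      (hxL x hx)
  have hmem : ∀ x ∈ M, ∀ v, v ∈ tangentAt M x ↔ v ∈ sphereTangent s P x := by
    intro x hx v
    rw [hTM x hx, (hd x).fderiv]
    have : v ∈ (ContinuousLinearMap.pi
        ![pipL s ((2 : ℝ) • x), pipL s ((2 : ℝ) • (P *ᵥ x))]).ker ↔
        (ContinuousLinearMap.pi ![pipL s ((2 : ℝ) • x), pipL s ((2 : ℝ) • (P *ᵥ x))]) v = 0 :=
      Iff.rfl
    rw [this, funext_iff, Fin.forall_fin_two]
    simp [sphereTangent]
  have hsub : M ⊆ spaceForm .sphere s 6 := fun x hx => (mem_sphere_iff hs x).2 (hxL x hx).1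
  have hcomp : IsLevelComponent .sphere s {x | pip s 6 x x = 1 ∧ f x = c} (sphereTangent s P)
      (sphereShape P k c) M
      (fun x => (k / 2) • ((2 : ℝ) • (P *ᵥ x) - (2 * pip s 6 (P *ᵥ x) x) • x)) := by
    refine ⟨hM, hmem, fun x hx => ?_, fun x hx => ⟨fun v hv => ?_, fun γ hγ => ?_⟩⟩
    · have := finrank_ker_of_surjective (hsurj x (hLU x (hxL x hx)))
      rw [hTM x hx]
      omega
    · rw [hmem x hx] at hv ⊢
      have h1 : pip s 6 x v = 0 := hv.1
      have h2 : pip s 6 (P *ᵥ x) v = 0 := hv.2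
      constructor
      · simp [sphereShape_apply, h1, ← hP x v, h2]
      · simp [sphereShape_apply, h1, h2, pip_mulVec_mulVec hP hP2]
    · have hd := (hγ.hasDerivAt_comp (hasFDerivAt_sphere_grad hP x (k / 2))).deriv
      obtain ⟨h1, h2⟩ := (hmem x hx _).1 hγ.deriv_mem
      rw [hd, projTangent_sphere, sphereShape_apply]
      simp [sphereProj_apply, (hxL x hx).1, (hxL x hx).2, h1, h2, ← hP x (deriv γ 0)]
      module
  have hpet := hcomp.hasPetrovType hJG fun x hx => hframe x hx.1 hx.2
  refine ⟨hpet.isIsoparametricHypersurface hM.isConnected hsub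
    (hman.component hM) (contDiff_sphere_grad (s := s) P _).contDiffOn ?_ ?_ hν ?_, hpet, ?_,
    hQ M _ hcomp⟩
  · intro x hx
    refine (mem_tangentAt_sphere_iff hs (hxL x hx).1 _).2 ?_
    rw [map_smul, pip_sphere_grad x (hxL x hx).1, smul_zero]
  · intro x hx v hv
    obtain ⟨h1, h2⟩ := (hmem x hx _).1 hv
    simp [h1, h2]
  · intro x hx
    obtain ⟨h1, h2⟩ := hxL x hx
    simp only [map_sub, map_smul, LinearMap.sub_apply, LinearMap.smul_apply, smul_eq_mul, h1, h2,
      pip_mulVec_mulVec hP hP2, pip_comm s x]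
    linear_combination ν * hc + k ^ 2 * q * hν2 + k ^ 2 * hq
  · intro x hx
    refine ⟨_, (hcomp.shape x hx).isShapeOperatorAt, fun v => rfl⟩

end PseudoIso

namespace PseudoIso

theorem minpoly_eq_quadratic {n : ℕ} {P : Matrix (Fin n) (Fin n) ℝ} {α β : ℝ}
    (hP2 : ∀ x, P *ᵥ (P *ᵥ x) = -(α • (P *ᵥ x)) - β • x) {i j : Fin n} (hij : i ≠ j)
    (hPij : P i j ≠ 0) :
    minpoly ℝ P = Polynomial.X ^ 2 + Polynomial.C α * Polynomial.X + Polynomial.C β := by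
  symm
  refine minpoly.unique' ℝ P ?_ ?_ fun q hq => ?_
  · monicity!
  · have : P * P = -(α • P) - β • 1 := by
      apply Matrix.mulVec_injective
      ext1 x
      rw [← Matrix.mulVec_mulVec, hP2]
      simp [Matrix.sub_mulVec, Matrix.neg_mulVec, Matrix.smul_mulVec]
    simp only [map_add, map_mul, map_pow, Polynomial.aeval_X, Polynomial.aeval_C, pow_two, this,
      Algebra.algebraMap_eq_smul_one, smul_mul_assoc, one_mul]
    abel
  · have hd : (Polynomial.X ^ 2 + Polynomial.C α * Polynomial.X + Polynomial.C β).degree = 2 := by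
      compute_degree!
    rw [hd] at hq
    have hq1 : q.natDegree ≤ 1 := by
      rcases eq_or_ne q 0 with rfl | hq0
      · simp
      · exact Nat.lt_succ_iff.1 ((Polynomial.natDegree_lt_iff_degree_lt hq0).2 hq)
    obtain ⟨a, b, rfl⟩ := Polynomial.exists_eq_X_add_C_of_natDegree_le_one hq1
    by_contra hcon
    push Not at hcon
    obtain ⟨h0, h1⟩ := hcon
    simp only [map_add, map_mul, Polynomial.aeval_X, Polynomial.aeval_C,
      Algebra.algebraMap_eq_smul_one, smul_mul_assoc, one_mul] at h1
    have h2 := congrFun (congrFun h1 i) j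
    simp [Matrix.one_apply_ne hij, hPij] at h2
    subst h2
    have h3 := congrFun (congrFun h1 i) i
    simp at h3
    simp [h3] at h0

theorem pip_two_six (x y : Vec 6) : pip 2 6 x y =
    -(x 0 * y 0) - x 1 * y 1 + x 2 * y 2 + x 3 * y 3 + x 4 * y 4 + x 5 * y 5 := by
  simp [pip_apply, Fin.sum_univ_six]
  ring

theorem pip_three_six (x y : Vec 6) : pip 3 6 x y =
    -(x 0 * y 0) - x 1 * y 1 - x 2 * y 2 + x 3 * y 3 + x 4 * y 4 + x 5 * y 5 := by
  simp [pip_apply, Fin.sum_univ_six]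
  ring

/-- A unit vector of `ℝ³_1` is part of an orthonormal basis. -/
theorem exists_lorentz_pair {t y z : ℝ} (h : -t ^ 2 + y ^ 2 + z ^ 2 = 1) :
    ∃ n w : Fin 3 → ℝ, -n 0 ^ 2 + n 1 ^ 2 + n 2 ^ 2 = -1 ∧ -w 0 ^ 2 + w 1 ^ 2 + w 2 ^ 2 = 1 ∧
      -(n 0 * w 0) + n 1 * w 1 + n 2 * w 2 = 0 ∧ -(n 0 * t) + n 1 * y + n 2 * z = 0 ∧
      -(w 0 * t) + w 1 * y + w 2 * z = 0 := by
  have hpos : 0 < y ^ 2 + z ^ 2 := by nlinarith [sq_nonneg t]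
  set r := √(y ^ 2 + z ^ 2)
  have hr2 : r ^ 2 = y ^ 2 + z ^ 2 := Real.sq_sqrt hpos.le
  have hr0 : r ≠ 0 := (Real.sqrt_pos.2 hpos).ne'
  refine ⟨![r, t * y / r, t * z / r], ![0, -z / r, y / r], ?_, ?_, ?_, ?_, ?_⟩
  · simp; field_simp; linear_combination (-r ^ 2 - y ^ 2 - z ^ 2 + 1) * hr2
      - (y ^ 2 + z ^ 2) * h
  · simp; field_simp; linarith
  · simp; field_simp; ring
  · simp; field_simp; linear_combination -t * hr2
  · simp; field_simp; ring

/-- A unit vector of `ℝ⁴_2` is part of an orthonormal basis. -/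
theorem exists_neutral_triple {a b c d : ℝ} (h : -a ^ 2 - b ^ 2 + c ^ 2 + d ^ 2 = 1) :
    ∃ n n' w : Fin 4 → ℝ, -n 0 ^ 2 - n 1 ^ 2 + n 2 ^ 2 + n 3 ^ 2 = -1 ∧
      -n' 0 ^ 2 - n' 1 ^ 2 + n' 2 ^ 2 + n' 3 ^ 2 = -1 ∧
      -w 0 ^ 2 - w 1 ^ 2 + w 2 ^ 2 + w 3 ^ 2 = 1 ∧
      -(n 0 * n' 0) - n 1 * n' 1 + n 2 * n' 2 + n 3 * n' 3 = 0 ∧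
      -(n 0 * w 0) - n 1 * w 1 + n 2 * w 2 + n 3 * w 3 = 0 ∧
      -(n' 0 * w 0) - n' 1 * w 1 + n' 2 * w 2 + n' 3 * w 3 = 0 ∧
      -(n 0 * a) - n 1 * b + n 2 * c + n 3 * d = 0 ∧
      -(n' 0 * a) - n' 1 * b + n' 2 * c + n' 3 * d = 0 ∧
      -(w 0 * a) - w 1 * b + w 2 * c + w 3 * d = 0 := by
  have hpos : 0 < 1 + a ^ 2 + b ^ 2 := by positivity
  obtain ⟨β, hβ⟩ : ∃ β, β = √(1 + a ^ 2 + b ^ 2) := ⟨_, rfl⟩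
  have hβ2 : β ^ 2 = 1 + a ^ 2 + b ^ 2 := hβ ▸ Real.sq_sqrt hpos.le
  have hβ0 : 0 < β := hβ ▸ Real.sqrt_pos.2 hpos
  obtain ⟨k, hk⟩ : ∃ k, k * (1 + β) = 1 := ⟨(1 + β)⁻¹, inv_mul_cancel₀ (by positivity)⟩
  obtain ⟨f, rfl⟩ : ∃ f, c = β * f := ⟨c / β, by field_simp⟩
  obtain ⟨g, rfl⟩ : ∃ g, d = β * g := ⟨d / β, by field_simp⟩
  have hunit : f ^ 2 + g ^ 2 = 1 := by
    have : β ^ 2 * (f ^ 2 + g ^ 2 - 1) = 0 := by linear_combination h - hβ2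
    rcases mul_eq_zero.1 this with h0 | h0
    · exact absurd h0 (by positivity)
    · linarith
  have hkey : -1 - (β ^ 2 - 1) * k + β = 0 := by linear_combination (1 - β) * hk
  have hkey' : -2 * k - k ^ 2 * (β ^ 2 - 1) + 1 = 0 := by
    linear_combination (-k * β + k - 1) * hk
  refine ⟨![1 + a * a * k, a * b * k, a * f, a * g], ![b * a * k, 1 + b * b * k, b * f, b * g],
    ![0, 0, -g, f], ?_, ?_, ?_, ?_, ?_, ?_, ?_, ?_, ?_⟩ <;> simp
  · linear_combination a ^ 2 * hkey' + a ^ 2 * k ^ 2 * hβ2 + a ^ 2 * hunit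
  · linear_combination b ^ 2 * hkey' + b ^ 2 * k ^ 2 * hβ2 + b ^ 2 * hunit
  · linear_combination hunit
  · linear_combination a * b * hkey' + a * b * k ^ 2 * hβ2 + a * b * hunit
  · ring
  · ring
  · linear_combination a * hkey + a * k * hβ2 + a * β * hunit
  · linear_combination b * hkey + b * k * hβ2 + b * β * hunit
  · ring

theorem charpoly_diagonal_four (a b c d : ℝ) :
    ((!![a, 0, 0, 0; 0, b, 0, 0; 0, 0, c, 0; 0, 0, 0, d] :
      Matrix (Fin 4) (Fin 4) ℝ).charpoly.map (algebraMap ℝ ℂ)).roots =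
      {(a : ℂ), (b : ℂ), (c : ℂ), (d : ℂ)} := by
  have h : (!![a, 0, 0, 0; 0, b, 0, 0; 0, 0, c, 0; 0, 0, 0, d] : Matrix (Fin 4) (Fin 4) ℝ) =
      Matrix.diagonal ![a, b, c, d] := by
    ext i j
    fin_cases i <;> fin_cases j <;> simp
  rw [h, Matrix.charpoly_diagonal, Polynomial.map_prod, Fin.prod_univ_four]
  have : ∀ x y z w : ℂ, ((Polynomial.X - Polynomial.C x) * (Polynomial.X - Polynomial.C y) *
      (Polynomial.X - Polynomial.C z) * (Polynomial.X - Polynomial.C w)).roots = {x, y, z, w} := by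
    intro x y z w
    have := Polynomial.roots_multiset_prod_X_sub_C ({x, y, z, w} : Multiset ℂ)
    rw [← this]
    simp [mul_assoc]
  simpa using this a b c d

theorem HasShapeMatrix.diagonal {g : SpaceKind} {s m : ℕ} {M : Set (Vec m)} {ξ : Vec m → Vec m}
    {x : Vec m} {b' : Fin 4 → Vec m} {a b c d : ℝ}
    (h : HasShapeMatrix g s M ξ x b' !![a, 0, 0, 0; 0, b, 0, 0; 0, 0, c, 0; 0, 0, 0, d]) :
    ∃ A : Module.End ℝ (tangentAt M x), IsShapeOperatorAt g s M ξ x A ∧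
        IsDiagonalizable A ∧ principalCurvatures A = {(a : ℂ), (b : ℂ), (c : ℂ), (d : ℂ)} := by
  obtain ⟨A, hA, B, -, hJ⟩ := h
  refine ⟨A, hA, ⟨Fin 4, B, fun i => ⟨![a, b, c, d] i, ?_⟩⟩,
    (principalCurvatures_eq_of_toMatrix B hJ).trans (charpoly_diagonal_four a b c d)⟩
  have : A = Matrix.toLin B B !![a, 0, 0, 0; 0, b, 0, 0; 0, 0, c, 0; 0, 0, 0, d] := by
    rw [← hJ, Matrix.toLin_toMatrix]
  rw [this, Matrix.toLin_self, Fin.sum_univ_four]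
  fin_cases i <;> simp

/-! ### Level sets in `S^5_s` with diagonalizable shape operators -/

theorem PE_mulVec (x : Vec 6) : PE *ᵥ x = ![x 1, x 0, x 5, x 4, x 3, x 2] := by
  ext i
  fin_cases i <;> simp [PE, Matrix.mulVec, dotProduct, Fin.sum_univ_six]

theorem PF_mulVec (x : Vec 6) : PF *ᵥ x = ![x 2, x 1, x 0, x 5, x 4, x 3] := by
  ext i
  fin_cases i <;> simp [PF, Matrix.mulVec, dotProduct, Fin.sum_univ_six]

theorem exists_frame_PE {x : Vec 6} (hx : pip 2 6 x x = 1) (hf : pip 2 6 (PE *ᵥ x) x = 0) :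
    ∃ b : Fin 4 → Vec 6, (∀ i, b i ∈ sphereTangent 2 PE x) ∧
        (∀ j, sphereShape PE 1 0 (b j) = ∑ i, (!![-1, 0, 0, 0; 0, 1, 0, 0; 0, 0, -1, 0; 0, 0, 0, 1] :
          Matrix (Fin 4) (Fin 4) ℝ) i j • b i) ∧
        gram 2 b = !![-1, 0, 0, 0; 0, -1, 0, 0; 0, 0, 1, 0; 0, 0, 0, 1] := by
  simp [pip_two_six, PE_mulVec] at hx hf
  obtain ⟨n, w, hn, hw, hnw, hn0, hw0⟩ := exists_lorentz_pair
    (t := x 0 + x 1) (y := x 2 + x 5) (z := x 3 + x 4) (by linear_combination hx + hf)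
  obtain ⟨n', w', hn', hw', hnw', hn0', hw0'⟩ := exists_lorentz_pair
    (t := x 0 - x 1) (y := x 2 - x 5) (z := x 3 - x 4) (by linear_combination hx - hf)
  obtain ⟨r, hr⟩ : ∃ r : ℝ, r * r = 1 / 2 := ⟨_, inv_sqrt_two_mul_self⟩
  refine ⟨fun i => r • (![![n 0, n 0, n 1, n 2, n 2, n 1], ![n' 0, -n' 0, n' 1, n' 2, -n' 2, -n' 1],
    ![w 0, w 0, w 1, w 2, w 2, w 1], ![w' 0, -w' 0, w' 1, w' 2, -w' 2, -w' 1]] :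
      Fin 4 → Vec 6) i, ?_, ?_, ?_⟩
  · intro i
    simp only [sphereTangent, Set.mem_ofPred_eq, map_smul, smul_eq_mul]
    suffices h : ∀ y : ℝ, y = 0 → r * y = 0 by
      refine ⟨h _ ?_, h _ ?_⟩
      · fin_cases i <;> simp [pip_two_six]
        · linear_combination hn0
        · linear_combination hn0'
        · linear_combination hw0
        · linear_combination hw0'
      · fin_cases i <;> simp [pip_two_six, PE_mulVec]
        · linear_combination hn0
        · linear_combination -hn0'
        · linear_combination hw0
        · linear_combination -hw0'
    rintro y rfl; simp
  · intro j
    ext i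
    fin_cases j <;> fin_cases i <;>
      simp [sphereShape_apply, PE_mulVec, Matrix.mulVec_smul, Fin.sum_univ_four]
  · rw [gram_smul, hr]
    ext i j
    fin_cases i <;> fin_cases j <;> simp [gram, pip_two_six] <;> first
      | ring1
      | linear_combination hn
      | linear_combination hn'
      | linear_combination hw
      | linear_combination hw'
      | linear_combination 2 * hnw
      | linear_combination 2 * hnw'

theorem example_e : IsSphereQuadricExample 2 PE (Polynomial.X ^ 2 - 1) 0 (ev 5) 1 .XI
    (fun M ξ => ∀ x ∈ M, ∃ A : Module.End ℝ (tangentAt M x),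
      IsShapeOperatorAt .sphere 2 M ξ x A ∧
        IsDiagonalizable A ∧ principalCurvatures A = {-1, -1, 1, 1}) := by
  have hsq : ∀ x, PE *ᵥ (PE *ᵥ x) = -((0 : ℝ) • (PE *ᵥ x)) - (-1 : ℝ) • x := by
    intro x
    ext i
    fin_cases i <;> simp [PE_mulVec]
  refine isSphereQuadricExample_of (k := 1) (by norm_num) ?_ hsq ?_ (by simp) (Or.inl rfl)
    one_pos (by norm_num) ?_ ?_ (J := !![-1, 0, 0, 0; 0, 1, 0, 0; 0, 0, -1, 0; 0, 0, 0, 1])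
    ⟨_, _, _, _, rfl, rfl⟩ (fun x hx hf => exists_frame_PE hx hf) ?_
  · intro u v
    simp [PE_mulVec, pip_two_six]
    ring
  · rw [minpoly_eq_quadratic hsq (i := 0) (j := 1) (by decide) (by simp [PE])]
    simp [sub_eq_add_neg]
  · simp [pip_two_six]
  · simp [pip_two_six, PE_mulVec]
  · intro M ξ h x hx
    obtain ⟨hx1, hx2⟩ := h.component.subset hx
    obtain ⟨b, hb, hJ, hG⟩ := exists_frame_PE hx1 hx2
    have hform : IsPetrovForm .XI !![-1, 0, 0, 0; 0, 1, 0, 0; 0, 0, -1, 0; 0, 0, 0, 1]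
        !![-1, 0, 0, 0; 0, -1, 0, 0; 0, 0, 1, 0; 0, 0, 0, 1] := ⟨_, _, _, _, rfl, rfl⟩
    obtain ⟨A, hA, hd, hp⟩ := (h.hasShapeMatrix hx hb
      (linearIndependent_of_gram (s := 2) (hG ▸ hform.det_ne_zero)) hJ).diagonal
    refine ⟨A, hA, hd, hp.trans ?_⟩
    simp only [Complex.ofReal_neg, Complex.ofReal_one, Multiset.insert_eq_cons]
    rw [Multiset.cons_swap (1 : ℂ) (-1)]

theorem exists_frame_PF {r : ℝ} (hr : r * r = 1 / 2) {x : Vec 6} (hx : pip 3 6 x x = 1)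
    (hf : pip 3 6 (PF *ᵥ x) x = 3) :
    ∃ b : Fin 4 → Vec 6, (∀ i, b i ∈ sphereTangent 3 PF x) ∧
        (∀ j, sphereShape PF (r / 2) 3 (b j) =
          ∑ i, (!![r, 0, 0, 0; 0, r, 0, 0; 0, 0, r, 0; 0, 0, 0, 2 * r] :
            Matrix (Fin 4) (Fin 4) ℝ) i j • b i) ∧
        gram 3 b = !![-1, 0, 0, 0; 0, -1, 0, 0; 0, 0, 1, 0; 0, 0, 0, 1] := by
  simp [pip_three_six, PF_mulVec] at hx hf
  obtain ⟨n, n', w, hn, hn', hw, hnn', hnw, hnw', hn0, hn0', hw0⟩ := exists_neutral_triple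
    (a := (x 0 + x 2) / 2) (b := r * x 1) (c := (x 3 + x 5) / 2) (d := r * x 4)
    (by linear_combination hx / 4 + hf / 4 + (x 4 ^ 2 - x 1 ^ 2) * hr)
  refine ⟨![![r * n 0, n 1, r * n 0, r * n 2, n 3, r * n 2],
    ![r * n' 0, n' 1, r * n' 0, r * n' 2, n' 3, r * n' 2],
    ![r * w 0, w 1, r * w 0, r * w 2, w 3, r * w 2],
    ![(x 3 - x 5) / 2, 0, -(x 3 - x 5) / 2, (x 0 - x 2) / 2, 0, -(x 0 - x 2) / 2]], ?_, ?_, ?_⟩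
  · intro i
    simp only [sphereTangent, Set.mem_ofPred_eq]
    constructor
    · fin_cases i <;> simp [pip_three_six]
      · linear_combination 2 * r * hn0 + 2 * (n 1 * x 1 - n 3 * x 4) * hr
      · linear_combination 2 * r * hn0' + 2 * (n' 1 * x 1 - n' 3 * x 4) * hr
      · linear_combination 2 * r * hw0 + 2 * (w 1 * x 1 - w 3 * x 4) * hr
      · ring
    · fin_cases i <;> simp [pip_three_six, PF_mulVec]
      · linear_combination 2 * r * hn0 + 2 * (n 1 * x 1 - n 3 * x 4) * hr
      · linear_combination 2 * r * hn0' + 2 * (n' 1 * x 1 - n' 3 * x 4) * hr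
      · linear_combination 2 * r * hw0 + 2 * (w 1 * x 1 - w 3 * x 4) * hr
      · ring
  · intro j
    ext i
    fin_cases j <;> fin_cases i <;>
      simp [sphereShape_apply, PF_mulVec, Fin.sum_univ_four] <;> ring
  · ext i j
    fin_cases i <;> fin_cases j <;> simp [gram, pip_three_six]
    · linear_combination hn + 2 * (n 2 ^ 2 - n 0 ^ 2) * hr
    · linear_combination hnn' + 2 * (n 2 * n' 2 - n 0 * n' 0) * hr
    · linear_combination hnw + 2 * (n 2 * w 2 - n 0 * w 0) * hr
    · ring
    · linear_combination hnn' + 2 * (n 2 * n' 2 - n 0 * n' 0) * hr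
    · linear_combination hn' + 2 * (n' 2 ^ 2 - n' 0 ^ 2) * hr
    · linear_combination hnw' + 2 * (n' 2 * w 2 - n' 0 * w 0) * hr
    · ring
    · linear_combination hnw + 2 * (n 2 * w 2 - n 0 * w 0) * hr
    · linear_combination hnw' + 2 * (n' 2 * w 2 - n' 0 * w 0) * hr
    · linear_combination hw + 2 * (w 2 ^ 2 - w 0 ^ 2) * hr
    · ring
    · ring
    · ring
    · ring
    · linear_combination hf / 2 - hx / 2

theorem example_f : IsSphereQuadricExample 3 PF (Polynomial.X ^ 2 - 1) 3
      ((-(1 / √2)) • ev 0 + (1 / √2) • ev 2 + √2 • ev 4) (-1) .XI (fun M ξ => ∀ x ∈ M,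
      ∃ A : Module.End ℝ (tangentAt M x), IsShapeOperatorAt .sphere 3 M ξ x A ∧
        IsDiagonalizable A ∧ principalCurvatures A =
          {((1 / √2 : ℝ) : ℂ), ((1 / √2 : ℝ) : ℂ), ((1 / √2 : ℝ) : ℂ), ((√2 : ℝ) : ℂ)}) := by
  have hsqrt : √2 = 2 * (1 / √2 : ℝ) := by
    rw [mul_one_div, Real.div_sqrt]
  have hr := inv_sqrt_two_mul_self
  have hr0 : (0 : ℝ) < 1 / √2 := by positivity
  have hx₀ : ((-(1 / √2)) • ev 0 + (1 / √2) • ev 2 + √2 • ev 4 : Vec 6) =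
      ![-(1 / √2), 0, 1 / √2, 0, 2 * (1 / √2), 0] := by
    rw [← hsqrt]
    ext i
    fin_cases i <;> simp
  rw [hx₀, hsqrt]
  have hr' : (1 / (2 * (1 / √2)) : ℝ) = 1 / √2 := by rw [← hsqrt]
  simp only [hr']
  generalize (1 / √2 : ℝ) = r at *
  have hsq : ∀ x, PF *ᵥ (PF *ᵥ x) = -((0 : ℝ) • (PF *ᵥ x)) - (-1 : ℝ) • x := by
    intro x
    ext i
    fin_cases i <;> simp [PF_mulVec]
  have hform : IsPetrovForm .XI !![r, 0, 0, 0; 0, r, 0, 0; 0, 0, r, 0; 0, 0, 0, 2 * r]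
        !![-1, 0, 0, 0; 0, -1, 0, 0; 0, 0, 1, 0; 0, 0, 0, 1] := ⟨_, _, _, _, rfl, rfl⟩
  refine isSphereQuadricExample_of (k := r / 2) (by norm_num) ?_ hsq ?_ (by simp; norm_num)
    (Or.inr rfl) (by positivity) (by linear_combination 2 * hr) ?_ ?_ hform
    (fun x hx hf => exists_frame_PF hr hx hf) ?_
  · intro u v
    simp [PF_mulVec, pip_three_six]
    ring
  · rw [minpoly_eq_quadratic hsq (i := 0) (j := 2) (by decide) (by simp [PF])]
    simp [sub_eq_add_neg]
  · simp [pip_three_six]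
    linear_combination 2 * hr
  · simp [pip_three_six, PF_mulVec]
    linear_combination 6 * hr
  · intro M ξ h x hx
    obtain ⟨hx1, hx2⟩ := h.component.subset hx
    obtain ⟨b, hb, hJ, hG⟩ := exists_frame_PF hr hx1 hx2
    exact (h.hasShapeMatrix hx hb
      (linearIndependent_of_gram (s := 3) (hG ▸ hform.det_ne_zero)) hJ).diagonal

end PseudoIso

namespace PseudoIso

/-! ### Level sets in `S^5_3` with nilpotent `P` -/

theorem PG_mulVec (x : Vec 6) :
    PG *ᵥ x = ![x 2 - x 5, 0, x 0 + x 3, -x 2 + x 5, 0, x 0 + x 3] := by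
  ext i
  fin_cases i <;> simp [PG, Matrix.mulVec, dotProduct, Fin.sum_univ_six, sub_eq_add_neg]

theorem exists_frame_PG {x : Vec 6} (hf : pip 3 6 (PG *ᵥ x) x = 1) :
    ∃ b : Fin 4 → Vec 6, (∀ i, b i ∈ sphereTangent 3 PG x) ∧
        (∀ j, sphereShape PG 1 1 (b j) = ∑ i, (!![1, 1, 0, 0; 0, 1, 0, 0; 0, 0, 1, 0; 0, 0, 0, 1] :
          Matrix (Fin 4) (Fin 4) ℝ) i j • b i) ∧
        gram 3 b = !![0, 1, 0, 0; 1, 0, 0, 0; 0, 0, -1, 0; 0, 0, 0, 1] := by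
  obtain ⟨u, hu⟩ : ∃ u, x 0 = u - x 3 := ⟨x 0 + x 3, by ring⟩
  obtain ⟨w, hw⟩ : ∃ w, x 5 = w + x 2 := ⟨-x 2 + x 5, by ring⟩
  have h : 2 * u * w = 1 := by
    simp [pip_three_six, PG_mulVec, hu, hw] at hf
    linear_combination hf
  obtain ⟨p, hp⟩ : ∃ p, p = -(2 * w * x 2) + 2 * u * x 3 := ⟨_, rfl⟩
  have hq : 2 * w * x 2 + 2 * u * x 0 = 2 * u * u - p := by rw [hp, hu]; ring
  obtain ⟨μ, hμ⟩ : ∃ μ, μ = -(w ^ 2 * (-p ^ 2 - 1 + (2 * u * u - p) ^ 2) / 2) := ⟨_, rfl⟩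
  refine ⟨![![w, 0, u, -w, 0, u],
    ![-(w * p) + μ * w, 0, -w + μ * u, -(w * (2 * u * u - p)) - μ * w, 0, μ * u],
    ![-(w * x 1), 1, u * x 1, w * x 1, 0, u * x 1],
    ![w * x 4, 0, -(u * x 4), -(w * x 4), 1, -(u * x 4)]], ?_, ?_, ?_⟩
  · intro i
    constructor
    · fin_cases i <;> simp [pip_three_six, hu, hw]
      · ring
      · rw [hp]; linear_combination (-w * x 2) * h
      · linear_combination x 1 * h
      · linear_combination -x 4 * h
    · fin_cases i <;> simp [pip_three_six, PG_mulVec, hu, hw]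
      · ring
      · linear_combination (-w * u) * h
      · ring
  · intro j
    ext i
    fin_cases j <;> fin_cases i <;>
      simp [sphereShape_apply, PG_mulVec, Fin.sum_univ_four] <;>
      first | ring1 | linear_combination u * h
  · ext i j
    fin_cases i <;> fin_cases j <;> simp [gram, pip_three_six] <;> first
      | ring1
      | linear_combination (u * w + 1) * h
      | linear_combination (-w * x 1 * u) * h
      | linear_combination (w * x 4 * u) * h
      | (rw [hμ]; linear_combination
          (-w ^ 2 * (-p ^ 2 - 1 + (2 * u * u - p) ^ 2) * (u * w + 1)) * h)

theorem vecG_apply {x : Vec 6} {u w : ℝ} (hu : x 0 + x 3 = u) (hw : -x 2 + x 5 = w) :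
    vecG x = ![![-(x 1 / u), 1, 0, x 1 / u, 0, 0],
      ![-(x 2 / u) + x 3 / w, 0, 1, x 2 / u + x 0 / w, 0, 0],
      ![x 4 / u, 0, 0, -(x 4 / u), 1, 0],
      ![x 5 / u - x 3 / w, 0, 0, -(x 5 / u) - x 0 / w, 0, 1]] := by
  unfold vecG
  rw [hu, hw]
  ext i j
  fin_cases i <;> fin_cases j <;> simp

theorem vecG_mem {x : Vec 6} (hu : x 0 + x 3 ≠ 0) (hw : -x 2 + x 5 ≠ 0) (i : Fin 4) :
    vecG x i ∈ sphereTangent 3 PG x := by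
  obtain ⟨u, hu'⟩ : ∃ u, x 0 + x 3 = u := ⟨_, rfl⟩
  obtain ⟨w, hw'⟩ : ∃ w, -x 2 + x 5 = w := ⟨_, rfl⟩
  have h0 : x 0 = u - x 3 := by linarith
  have h5 : x 5 = w + x 2 := by linarith
  rw [hu'] at hu
  rw [hw'] at hw
  rw [vecG_apply hu' hw']
  constructor <;> fin_cases i <;> simp [pip_three_six, PG_mulVec, h0, h5] <;> field_simp <;> ring

theorem sphereTangent_eq_coe (s : ℕ) (P : Matrix (Fin 6) (Fin 6) ℝ) (x : Vec 6) :
    sphereTangent s P x =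
      ((LinearMap.ker (pip s 6 x) ⊓ LinearMap.ker (pip s 6 (P *ᵥ x)) : Submodule ℝ (Vec 6)) :
        Set (Vec 6)) := rfl

theorem frameG_mem {x : Vec 6} (hu : x 0 + x 3 ≠ 0) (hw : -x 2 + x 5 ≠ 0) (i : Fin 4) :
    frameG x i ∈ sphereTangent 3 PG x := by
  have h := vecG_mem hu hw
  simp only [sphereTangent_eq_coe, SetLike.mem_coe] at h ⊢
  fin_cases i
  · exact add_mem (h 1) (h 3)
  · exact Submodule.smul_mem _ _ (h 1)
  · exact h 0
  · exact h 2

theorem linearIndependent_frameG {x : Vec 6} (hu : x 0 + x 3 ≠ 0) (hw : -x 2 + x 5 ≠ 0) :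
    LinearIndependent ℝ (frameG x) := by
  refine linearIndependent_of_forall fun c hc => ?_
  simp only [frameG, vecG_apply rfl rfl] at hc
  have h1 := congrFun hc 1
  have h2 := congrFun hc 2
  have h4 := congrFun hc 4
  have h5 := congrFun hc 5
  simp at h1 h2 h4 h5
  simp only [h5, zero_add, mul_eq_zero, neg_eq_zero, div_eq_zero_iff, hu, hw, or_false] at h2
  exact ⟨h5, h2, h1, h4⟩

theorem sphereShape_frameG {x : Vec 6} (hu : x 0 + x 3 ≠ 0) (hw : -x 2 + x 5 ≠ 0) (j : Fin 4) :
    sphereShape PG 1 1 (frameG x j) = ∑ i, (!![1, 1, 0, 0; 0, 1, 0, 0; 0, 0, 1, 0; 0, 0, 0, 1] :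
      Matrix (Fin 4) (Fin 4) ℝ) i j • frameG x i := by
  obtain ⟨u, hu'⟩ : ∃ u, x 0 + x 3 = u := ⟨_, rfl⟩
  obtain ⟨w, hw'⟩ : ∃ w, -x 2 + x 5 = w := ⟨_, rfl⟩
  have h0 : x 0 = u - x 3 := by linarith
  have h5 : x 5 = w + x 2 := by linarith
  rw [hu'] at hu
  rw [hw'] at hw
  ext i
  fin_cases j <;> fin_cases i <;>
    simp [sphereShape_apply, PG_mulVec, Fin.sum_univ_four, frameG, vecG_apply hu' hw', h0, h5] <;>
    (try field_simp) <;> (try ring)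

theorem example_g :
    IsSphereQuadricExample 3 PG (Polynomial.X ^ 2) 1 ((1 / √2) • ev 3 + (1 / √2) • ev 5) (-1) .X
      (fun M ξ => ∀ x ∈ M, x 0 + x 3 ≠ 0 → -x 2 + x 5 ≠ 0 →
        (∀ i, vecG x i ∈ tangentAt M x) ∧
        HasShapeMatrix .sphere 3 M ξ x (frameG x)
          !![1, 1, 0, 0; 0, 1, 0, 0; 0, 0, 1, 0; 0, 0, 0, 1]) := by
  have hr := inv_sqrt_two_mul_self
  have hx₀ : ((1 / √2) • ev 3 + (1 / √2) • ev 5 : Vec 6) = ![0, 0, 0, 1 / √2, 0, 1 / √2] := by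
    ext i
    fin_cases i <;> simp
  rw [hx₀]
  generalize (1 / √2 : ℝ) = r at *
  have hsq : ∀ x, PG *ᵥ (PG *ᵥ x) = -((0 : ℝ) • (PG *ᵥ x)) - (0 : ℝ) • x := by
    intro x
    ext i
    fin_cases i <;> simp [PG_mulVec]
  refine isSphereQuadricExample_of (k := 1) (by norm_num) ?_ hsq ?_ (by simp)
    (Or.inr rfl) one_pos (by norm_num) ?_ ?_ ⟨1, 1, 1, 1, Or.inl rfl, rfl, rfl⟩
    (fun x _ hf => exists_frame_PG hf) fun M ξ h x hx hu hw =>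
      ⟨fun i => (h.mem_tangentAt x hx _).2 (vecG_mem hu hw i),
        h.hasShapeMatrix hx (frameG_mem hu hw) (linearIndependent_frameG hu hw)
          (sphereShape_frameG hu hw)⟩
  · intro u v
    simp [PG_mulVec, pip_three_six]
    ring
  · rw [minpoly_eq_quadratic hsq (i := 0) (j := 2) (by decide) (by simp [PG])]
    simp
  · simp [pip_three_six]
    linear_combination 2 * hr
  · simp [pip_three_six, PG_mulVec]
    linear_combination 2 * hr

theorem PH_mulVec (x : Vec 6) :
    PH *ᵥ x = ![x 2 + x 3, x 1 + x 4, x 0 + x 5, -x 0 - x 5, -x 1 - x 4, -x 2 - x 3] := by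
  ext i
  fin_cases i <;> simp [PH, Matrix.mulVec, dotProduct, Fin.sum_univ_six, sub_eq_add_neg]

/-- A unit vector for the quadratic form `2 A D + B ^ 2` is part of an orthonormal basis. -/
theorem exists_hyperbolic_pair {a b d : ℝ} (h : 2 * a * d + b ^ 2 = 1) :
    ∃ p n : Fin 3 → ℝ, 2 * p 0 * p 2 + p 1 ^ 2 = 1 ∧ 2 * n 0 * n 2 + n 1 ^ 2 = -1 ∧
      p 0 * n 2 + p 2 * n 0 + p 1 * n 1 = 0 ∧ p 2 * a + p 0 * d + p 1 * b = 0 ∧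
      n 2 * a + n 0 * d + n 1 * b = 0 := by
  obtain ⟨r, hr⟩ : ∃ r : ℝ, r * r = 1 / 2 := ⟨_, inv_sqrt_two_mul_self⟩
  obtain ⟨n, w, hn, hw, hnw, hn0, hw0⟩ := exists_lorentz_pair (t := (a - d) * r)
    (y := (a + d) * r) (z := b) (by linear_combination h + 4 * a * d * hr)
  refine ⟨![(w 1 + w 0) * r, w 2, (w 1 - w 0) * r], ![(n 1 + n 0) * r, n 2, (n 1 - n 0) * r],
    ?_, ?_, ?_, ?_, ?_⟩ <;> simp
  · linear_combination hw + 2 * (w 1 ^ 2 - w 0 ^ 2) * hr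
  · linear_combination hn + 2 * (n 1 ^ 2 - n 0 ^ 2) * hr
  · linear_combination hnw + 2 * (w 1 * n 1 - w 0 * n 0) * hr
  · linear_combination hw0
  · linear_combination hn0

theorem exists_frame_PH {x : Vec 6} (hf : pip 3 6 (PH *ᵥ x) x = -1) :
    ∃ b : Fin 4 → Vec 6, (∀ i, b i ∈ sphereTangent 3 PH x) ∧
        (∀ j, sphereShape PH 1 (-1) (b j) =
          ∑ i, (!![-1, 1, 0, 0; 0, -1, 0, 0; 0, 0, -1, 1; 0, 0, 0, -1] :
            Matrix (Fin 4) (Fin 4) ℝ) i j • b i) ∧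
        gram 3 b = !![0, 1, 0, 0; 1, 0, 0, 0; 0, 0, 0, -1; 0, 0, -1, 0] := by
  obtain ⟨a, ha⟩ : ∃ a, x 2 = a - x 3 := ⟨x 2 + x 3, by ring⟩
  obtain ⟨b, hb⟩ : ∃ b, x 1 = b - x 4 := ⟨x 1 + x 4, by ring⟩
  obtain ⟨d, hd⟩ : ∃ d, x 0 = d - x 5 := ⟨x 0 + x 5, by ring⟩
  have h : 2 * a * d + b ^ 2 = 1 := by
    simp [pip_three_six, PH_mulVec, ha, hb, hd] at hf
    linear_combination -hf
  obtain ⟨p, n, hp, hn, hpn, hp0, hn0⟩ := exists_hyperbolic_pair h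
  obtain ⟨l, hl⟩ : ∃ l, l = (-(x 0 * p 2) - x 1 * p 1 - x 2 * p 0 + x 3 * p 0 + x 4 * p 1
    + x 5 * p 2) / 2 := ⟨_, rfl⟩
  obtain ⟨m, hm⟩ : ∃ m, m = (-(x 0 * n 2) - x 1 * n 1 - x 2 * n 0 + x 3 * n 0 + x 4 * n 1
    + x 5 * n 2) / 2 := ⟨_, rfl⟩
  rw [ha, hb, hd] at hl hm
  refine ⟨![![-p 0, -p 1, -p 2, p 2, p 1, p 0],
    ![p 2 / 2 + l * a, p 1 / 2 + l * b, p 0 / 2 + l * d, p 0 / 2 - l * d, p 1 / 2 - l * b,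
      p 2 / 2 - l * a], ![-n 0, -n 1, -n 2, n 2, n 1, n 0],
    ![n 2 / 2 + m * a, n 1 / 2 + m * b, n 0 / 2 + m * d, n 0 / 2 - m * d, n 1 / 2 - m * b,
      n 2 / 2 - m * a]], ?_, ?_, ?_⟩
  · intro i
    constructor
    · fin_cases i <;> simp [pip_three_six, ha, hb, hd]
      · linear_combination hp0
      · linear_combination -hl - l * h
      · linear_combination hn0
      · linear_combination -hm - m * h
    · fin_cases i <;> simp [pip_three_six, PH_mulVec, ha, hb, hd]
      · linear_combination -hp0
      · linear_combination -hn0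
  · intro j
    ext i
    fin_cases j <;> fin_cases i <;>
      simp [sphereShape_apply, PH_mulVec, Fin.sum_univ_four] <;> ring
  · ext i j
    fin_cases i <;> fin_cases j <;> simp [gram, pip_three_six] <;> first
      | ring1
      | linear_combination hp
      | linear_combination hn
      | linear_combination hpn
      | linear_combination -2 * l * hp0
      | linear_combination -2 * m * hn0
      | linear_combination -l * hn0 - m * hp0

theorem vecH_apply {x : Vec 6} {u k l : ℝ} (hu : x 1 + x 4 = u) (hk : (x 2 + x 3) / u ^ 2 = k)
    (hl : (x 0 + x 5) / u ^ 2 = l) :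
    vecH x = ![![1, -(x 0 / u) - x 4 * k, 0, 0, x 0 / u - x 1 * k, 0],
      ![0, -(x 2 / u) - x 4 * l, 1, 0, x 2 / u - x 1 * l, 0],
      ![0, x 3 / u - x 4 * l, 0, 1, -(x 3 / u) - x 1 * l, 0],
      ![0, x 5 / u - x 4 * k, 0, 0, -(x 5 / u) - x 1 * k, 1]] := by
  unfold vecH
  simp only [hu, hk, hl]
  ext i j
  fin_cases i <;> fin_cases j <;> simp

theorem vecH_mem {x : Vec 6} (hu : x 1 + x 4 ≠ 0) (i : Fin 4) :
    vecH x i ∈ sphereTangent 3 PH x := by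
  obtain ⟨u, hu'⟩ : ∃ u, x 1 + x 4 = u := ⟨_, rfl⟩
  have h0 : x 1 = u - x 4 := by linarith
  rw [hu'] at hu
  rw [vecH_apply hu' rfl rfl]
  constructor <;> fin_cases i <;> simp [pip_three_six, PH_mulVec, h0] <;> field_simp <;> ring

theorem frameH_mem {x : Vec 6} (hu : x 1 + x 4 ≠ 0) (i : Fin 4) :
    frameH x i ∈ sphereTangent 3 PH x := by
  have h := vecH_mem hu
  simp only [sphereTangent_eq_coe, SetLike.mem_coe] at h ⊢
  fin_cases i
  · exact add_mem (neg_mem (h 0)) (h 3)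
  · exact h 1
  · exact add_mem (neg_mem (h 1)) (h 2)
  · exact h 0

theorem linearIndependent_frameH (x : Vec 6) : LinearIndependent ℝ (frameH x) := by
  refine linearIndependent_of_forall fun c hc => ?_
  simp only [frameH, vecH_apply rfl rfl rfl] at hc
  have h0 := congrFun hc 0
  have h2 := congrFun hc 2
  have h3 := congrFun hc 3
  have h5 := congrFun hc 5
  simp at h0 h2 h3 h5
  exact ⟨h5, by linarith, h3, by linarith⟩

theorem sphereShape_frameH {x : Vec 6} (hu : x 1 + x 4 ≠ 0) (j : Fin 4) :
    sphereShape PH 1 (-1) (frameH x j) =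
      ∑ i, (!![-1, 1, 0, 0; 0, -1, 0, 0; 0, 0, -1, 1; 0, 0, 0, -1] :
        Matrix (Fin 4) (Fin 4) ℝ) i j • frameH x i := by
  obtain ⟨u, hu'⟩ : ∃ u, x 1 + x 4 = u := ⟨_, rfl⟩
  have h0 : x 1 = u - x 4 := by linarith
  rw [hu'] at hu
  ext i
  fin_cases j <;> fin_cases i <;>
    simp [sphereShape_apply, PH_mulVec, Fin.sum_univ_four, frameH, vecH_apply hu' rfl rfl, h0] <;>
    (try field_simp) <;> (try ring)

theorem ev_six_four : (ev 4 : Vec 6) = ![0, 0, 0, 0, 1, 0] := by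
  ext i
  fin_cases i <;> simp

theorem pointFrameH_apply {r : ℝ} (hr : 1 / √2 = r) : pointFrameH =
    ![![-r, 0, -r, r, 0, r], ![r / 2, 0, r / 2, r / 2, 0, r / 2], ![-r, 0, r, -r, 0, r],
      ![-(r / 2), 0, r / 2, r / 2, 0, -(r / 2)]] := by
  have h : (1 / (2 * √2) : ℝ) = r / 2 := by rw [← hr]; ring
  simp only [pointFrameH, vecH_apply rfl rfl rfl, h, hr]
  ext i j
  fin_cases i <;> fin_cases j <;> simp

theorem gram_pointFrameH :
    gram 3 pointFrameH = !![0, 1, 0, 0; 1, 0, 0, 0; 0, 0, 0, -1; 0, 0, -1, 0] := by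
  obtain ⟨r, hr⟩ : ∃ r, 1 / √2 = r := ⟨_, rfl⟩
  have hr2 : r * r = 1 / 2 := hr ▸ inv_sqrt_two_mul_self
  rw [pointFrameH_apply hr]
  ext i j
  fin_cases i <;> fin_cases j <;> simp [gram, pip_three_six] <;>
    first | ring1 | linear_combination 2 * hr2 | linear_combination -2 * hr2

theorem pointFrameH_mem (i : Fin 4) : pointFrameH i ∈ sphereTangent 3 PH (ev 4) := by
  rw [pointFrameH_apply rfl, ev_six_four]
  constructor <;> fin_cases i <;> simp [pip_three_six, PH_mulVec]

theorem sphereShape_pointFrameH (j : Fin 4) : sphereShape PH 1 (-1) (pointFrameH j) =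
    ∑ i, (!![-1, 1, 0, 0; 0, -1, 0, 0; 0, 0, -1, 1; 0, 0, 0, -1] :
      Matrix (Fin 4) (Fin 4) ℝ) i j • pointFrameH i := by
  rw [pointFrameH_apply rfl]
  generalize (1 / √2 : ℝ) = r
  ext i
  fin_cases j <;> fin_cases i <;>
    simp [sphereShape_apply, PH_mulVec, Fin.sum_univ_four] <;> ring

theorem example_h :
    IsSphereQuadricExample 3 PH (Polynomial.X ^ 2) (-1) (ev 4) (-1) .IXii
      (fun M ξ =>
        (∀ x ∈ M, x 1 + x 4 ≠ 0 → (∀ i, vecH x i ∈ tangentAt M x) ∧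
          HasShapeMatrix .sphere 3 M ξ x (frameH x)
            !![-1, 1, 0, 0; 0, -1, 0, 0; 0, 0, -1, 1; 0, 0, 0, -1]) ∧
        (ev 4 ∈ M → HasShapeMatrix .sphere 3 M ξ (ev 4) pointFrameH
            !![-1, 1, 0, 0; 0, -1, 0, 0; 0, 0, -1, 1; 0, 0, 0, -1] ∧
          gram 3 pointFrameH = !![0, 1, 0, 0; 1, 0, 0, 0; 0, 0, 0, -1; 0, 0, -1, 0])) := by
  have hsq : ∀ x, PH *ᵥ (PH *ᵥ x) = -((0 : ℝ) • (PH *ᵥ x)) - (0 : ℝ) • x := by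
    intro x
    ext i
    fin_cases i <;> simp [PH_mulVec] <;> ring
  have hform : IsPetrovForm .IXii !![-1, 1, 0, 0; 0, -1, 0, 0; 0, 0, -1, 1; 0, 0, 0, -1]
      !![0, 1, 0, 0; 1, 0, 0, 0; 0, 0, 0, -1; 0, 0, -1, 0] :=
    ⟨-1, -1, 1, Or.inl rfl, rfl, rfl⟩
  refine isSphereQuadricExample_of (k := 1) (by norm_num) ?_ hsq ?_ (by simp)
    (Or.inr rfl) one_pos (by norm_num) ?_ ?_ hform
    (fun x _ hf => exists_frame_PH hf) fun M ξ h => ⟨fun x hx hu =>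
      ⟨fun i => (h.mem_tangentAt x hx _).2 (vecH_mem hu i),
        h.hasShapeMatrix hx (frameH_mem hu) (linearIndependent_frameH x) (sphereShape_frameH hu)⟩,
      fun hx => ⟨h.hasShapeMatrix hx pointFrameH_mem (linearIndependent_of_gram (s := 3) ?_)
        sphereShape_pointFrameH, gram_pointFrameH⟩⟩
  · intro u v
    simp [PH_mulVec, pip_three_six]
    ring
  · rw [minpoly_eq_quadratic hsq (i := 0) (j := 2) (by decide) (by simp [PH])]
    simp
  · simp [pip_three_six]
  · simp [pip_three_six, PH_mulVec]
  · rw [gram_pointFrameH]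
    exact hform.det_ne_zero

theorem PI_mulVec (x : Vec 6) :
    PI *ᵥ x = ![x 0 + x 3, x 1 + x 4, x 2 + x 5, -x 0 - x 3, -x 1 - x 4, -x 2 - x 5] := by
  ext i
  fin_cases i <;> simp [PI, Matrix.mulVec, dotProduct, Fin.sum_univ_six, sub_eq_add_neg]

theorem exists_frame_PI {x : Vec 6} (hf : pip 3 6 (PI *ᵥ x) x = -1) :
    ∃ b : Fin 4 → Vec 6, (∀ i, b i ∈ sphereTangent 3 PI x) ∧
        (∀ j, sphereShape PI 1 (-1) (b j) =
          ∑ i, (!![-1, 1, 0, 0; 0, -1, 0, 0; 0, 0, -1, 1; 0, 0, 0, -1] :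
            Matrix (Fin 4) (Fin 4) ℝ) i j • b i) ∧
        gram 3 b = !![0, 1, 0, 0; 1, 0, 0, 0; 0, 0, 0, 1; 0, 0, 1, 0] := by
  obtain ⟨a, ha⟩ : ∃ a, x 0 = a - x 3 := ⟨x 0 + x 3, by ring⟩
  obtain ⟨b, hb⟩ : ∃ b, x 1 = b - x 4 := ⟨x 1 + x 4, by ring⟩
  obtain ⟨d, hd⟩ : ∃ d, x 2 = d - x 5 := ⟨x 2 + x 5, by ring⟩
  have h : a ^ 2 + b ^ 2 + d ^ 2 = 1 := by
    simp [pip_three_six, PI_mulVec, ha, hb, hd] at hf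
    linear_combination -hf
  obtain ⟨p, n, hp, hn, hpn, hp0, hn0⟩ := exists_orthonormal_pair h
  obtain ⟨l, hl⟩ : ∃ l, l = (-(x 0 * p 0) - x 1 * p 1 - x 2 * p 2 + x 3 * p 0 + x 4 * p 1
    + x 5 * p 2) / 2 := ⟨_, rfl⟩
  obtain ⟨m, hm⟩ : ∃ m, m = (-(x 0 * n 0) - x 1 * n 1 - x 2 * n 2 + x 3 * n 0 + x 4 * n 1
    + x 5 * n 2) / 2 := ⟨_, rfl⟩
  rw [ha, hb, hd] at hl hm
  refine ⟨![![-p 0, -p 1, -p 2, p 0, p 1, p 2],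
    ![p 0 / 2 + l * a, p 1 / 2 + l * b, p 2 / 2 + l * d, p 0 / 2 - l * a, p 1 / 2 - l * b,
      p 2 / 2 - l * d], ![-n 0, -n 1, -n 2, n 0, n 1, n 2],
    ![n 0 / 2 + m * a, n 1 / 2 + m * b, n 2 / 2 + m * d, n 0 / 2 - m * a, n 1 / 2 - m * b,
      n 2 / 2 - m * d]], ?_, ?_, ?_⟩
  · intro i
    constructor
    · fin_cases i <;> simp [pip_three_six, ha, hb, hd]
      · linear_combination hp0
      · linear_combination -hl - l * h
      · linear_combination hn0
      · linear_combination -hm - m * h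
    · fin_cases i <;> simp [pip_three_six, PI_mulVec, ha, hb, hd]
      · ring
      · linear_combination -hp0
      · ring
      · linear_combination -hn0
  · intro j
    ext i
    fin_cases j <;> fin_cases i <;>
      simp [sphereShape_apply, PI_mulVec, Fin.sum_univ_four] <;> ring
  · ext i j
    fin_cases i <;> fin_cases j <;> simp [gram, pip_three_six] <;> first
      | ring1
      | linear_combination hp
      | linear_combination hn
      | linear_combination hpn
      | linear_combination -2 * l * hp0
      | linear_combination -2 * m * hn0
      | linear_combination -l * hn0 - m * hp0

theorem vecI_apply {x : Vec 6} {u k l : ℝ} (hu : x 1 + x 4 = u) (hk : (x 0 + x 3) / u ^ 2 = k)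
    (hl : (x 2 + x 5) / u ^ 2 = l) :
    vecI x = ![![1, -(x 0 / u) - x 4 * k, 0, 0, x 0 / u - x 1 * k, 0],
      ![0, -(x 2 / u) - x 4 * l, 1, 0, x 2 / u - x 1 * l, 0],
      ![0, x 3 / u - x 4 * k, 0, 1, -(x 3 / u) - x 1 * k, 0],
      ![0, x 5 / u - x 4 * l, 0, 0, -(x 5 / u) - x 1 * l, 1]] := by
  unfold vecI
  simp only [hu, hk, hl]
  ext i j
  fin_cases i <;> fin_cases j <;> simp

theorem vecI_mem {x : Vec 6} (hu : x 1 + x 4 ≠ 0) (i : Fin 4) :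
    vecI x i ∈ sphereTangent 3 PI x := by
  obtain ⟨u, hu'⟩ : ∃ u, x 1 + x 4 = u := ⟨_, rfl⟩
  have h0 : x 1 = u - x 4 := by linarith
  rw [hu'] at hu
  rw [vecI_apply hu' rfl rfl]
  constructor <;> fin_cases i <;> simp [pip_three_six, PI_mulVec, h0] <;> field_simp <;> ring

theorem frameI_mem {x : Vec 6} (hu : x 1 + x 4 ≠ 0) (i : Fin 4) :
    frameI x i ∈ sphereTangent 3 PI x := by
  have h := vecI_mem hu
  simp only [sphereTangent_eq_coe, SetLike.mem_coe] at h ⊢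
  fin_cases i
  · exact add_mem (neg_mem (h 0)) (h 2)
  · exact h 0
  · exact add_mem (neg_mem (h 1)) (h 3)
  · exact h 1

theorem linearIndependent_frameI (x : Vec 6) : LinearIndependent ℝ (frameI x) := by
  refine linearIndependent_of_forall fun c hc => ?_
  simp only [frameI, vecI_apply rfl rfl rfl] at hc
  have h0 := congrFun hc 0
  have h2 := congrFun hc 2
  have h3 := congrFun hc 3
  have h5 := congrFun hc 5
  simp at h0 h2 h3 h5
  exact ⟨h3, by linarith, h5, by linarith⟩

theorem sphereShape_frameI {x : Vec 6} (hu : x 1 + x 4 ≠ 0) (j : Fin 4) :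
    sphereShape PI 1 (-1) (frameI x j) =
      ∑ i, (!![-1, 1, 0, 0; 0, -1, 0, 0; 0, 0, -1, 1; 0, 0, 0, -1] :
        Matrix (Fin 4) (Fin 4) ℝ) i j • frameI x i := by
  obtain ⟨u, hu'⟩ : ∃ u, x 1 + x 4 = u := ⟨_, rfl⟩
  have h0 : x 1 = u - x 4 := by linarith
  rw [hu'] at hu
  ext i
  fin_cases j <;> fin_cases i <;>
    simp [sphereShape_apply, PI_mulVec, Fin.sum_univ_four, frameI, vecI_apply hu' rfl rfl, h0] <;>
    (try field_simp) <;> (try ring)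

theorem pointFrameI_apply : pointFrameI =
    ![![-1, 0, 0, 1, 0, 0], ![1 / 2, 0, 0, 1 / 2, 0, 0], ![0, 0, -1, 0, 0, 1],
      ![0, 0, 1 / 2, 0, 0, 1 / 2]] := by
  simp only [pointFrameI, vecI_apply rfl rfl rfl]
  ext i j
  fin_cases i <;> fin_cases j <;> simp

theorem gram_pointFrameI :
    gram 3 pointFrameI = !![0, 1, 0, 0; 1, 0, 0, 0; 0, 0, 0, 1; 0, 0, 1, 0] := by
  rw [pointFrameI_apply]
  ext i j
  fin_cases i <;> fin_cases j <;> simp [gram, pip_three_six] <;> norm_num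

theorem pointFrameI_mem (i : Fin 4) : pointFrameI i ∈ sphereTangent 3 PI (ev 4) := by
  rw [pointFrameI_apply, ev_six_four]
  constructor <;> fin_cases i <;> simp [pip_three_six, PI_mulVec]

theorem sphereShape_pointFrameI (j : Fin 4) : sphereShape PI 1 (-1) (pointFrameI j) =
    ∑ i, (!![-1, 1, 0, 0; 0, -1, 0, 0; 0, 0, -1, 1; 0, 0, 0, -1] :
      Matrix (Fin 4) (Fin 4) ℝ) i j • pointFrameI i := by
  rw [pointFrameI_apply]
  ext i
  fin_cases j <;> fin_cases i <;>
    simp [sphereShape_apply, PI_mulVec, Fin.sum_univ_four] <;> norm_num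

theorem example_i :
    IsSphereQuadricExample 3 PI (Polynomial.X ^ 2) (-1) (ev 4) (-1) .IXi
      (fun M ξ =>
        (∀ x ∈ M, x 1 + x 4 ≠ 0 → (∀ i, vecI x i ∈ tangentAt M x) ∧
          HasShapeMatrix .sphere 3 M ξ x (frameI x)
            !![-1, 1, 0, 0; 0, -1, 0, 0; 0, 0, -1, 1; 0, 0, 0, -1]) ∧
        (ev 4 ∈ M → HasShapeMatrix .sphere 3 M ξ (ev 4) pointFrameI
            !![-1, 1, 0, 0; 0, -1, 0, 0; 0, 0, -1, 1; 0, 0, 0, -1] ∧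
          gram 3 pointFrameI = !![0, 1, 0, 0; 1, 0, 0, 0; 0, 0, 0, 1; 0, 0, 1, 0])) := by
  have hsq : ∀ x, PI *ᵥ (PI *ᵥ x) = -((0 : ℝ) • (PI *ᵥ x)) - (0 : ℝ) • x := by
    intro x
    ext i
    fin_cases i <;> simp [PI_mulVec] <;> ring
  have hform : IsPetrovForm .IXi !![-1, 1, 0, 0; 0, -1, 0, 0; 0, 0, -1, 1; 0, 0, 0, -1]
      !![0, 1, 0, 0; 1, 0, 0, 0; 0, 0, 0, 1; 0, 0, 1, 0] :=
    ⟨-1, -1, 1, Or.inl rfl, rfl, rfl⟩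
  refine isSphereQuadricExample_of (k := 1) (by norm_num) ?_ hsq ?_ (by simp)
    (Or.inr rfl) one_pos (by norm_num) ?_ ?_ hform
    (fun x _ hf => exists_frame_PI hf) fun M ξ h => ⟨fun x hx hu =>
      ⟨fun i => (h.mem_tangentAt x hx _).2 (vecI_mem hu i),
        h.hasShapeMatrix hx (frameI_mem hu) (linearIndependent_frameI x) (sphereShape_frameI hu)⟩,
      fun hx => ⟨h.hasShapeMatrix hx pointFrameI_mem (linearIndependent_of_gram (s := 3) ?_)
        sphereShape_pointFrameI, gram_pointFrameI⟩⟩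
  · intro u v
    simp [PI_mulVec, pip_three_six]
    ring
  · rw [minpoly_eq_quadratic hsq (i := 0) (j := 3) (by decide) (by simp [PI])]
    simp
  · simp [pip_three_six]
  · simp [pip_three_six, PI_mulVec]
  · rw [gram_pointFrameI]
    exact hform.det_ne_zero

end PseudoIso

namespace PseudoIso

/-! ### The level set in `S^5_3` with complex principal curvatures -/

theorem PJ_mulVec (x : Vec 6) :
    PJ *ᵥ x = ![x 0 - x 5, x 1 - x 4, x 2 - x 3, x 2 + x 3, x 1 + x 4, x 0 + x 5] := by
  ext i
  fin_cases i <;> simp [PJ, Matrix.mulVec, dotProduct, Fin.sum_univ_six, sub_eq_add_neg]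

theorem exists_complex_orthonormal_pair_of_ne {a b c : ℂ} (h : a ^ 2 + b ^ 2 + c ^ 2 = -1)
    (hab : a ^ 2 + b ^ 2 ≠ 0) :
    ∃ v w : Fin 3 → ℂ, v 0 ^ 2 + v 1 ^ 2 + v 2 ^ 2 = 1 ∧ w 0 ^ 2 + w 1 ^ 2 + w 2 ^ 2 = 1 ∧
      v 0 * w 0 + v 1 * w 1 + v 2 * w 2 = 0 ∧ v 0 * a + v 1 * b + v 2 * c = 0 ∧
      w 0 * a + w 1 * b + w 2 * c = 0 := by
  obtain ⟨r, hr⟩ := IsAlgClosed.exists_pow_nat_eq (a ^ 2 + b ^ 2) (n := 2) (by norm_num)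
  have hr0 : r ≠ 0 := by
    rintro rfl
    exact hab (by rw [← hr]; norm_num)
  have hI := Complex.I_sq
  refine ⟨![b / r, -a / r, 0], ![Complex.I * (c * a / r), Complex.I * (c * b / r),
    -(Complex.I * r)], ?_, ?_, ?_, ?_, ?_⟩
  · simp
    field_simp
    linear_combination -hr
  · simp only [Matrix.cons_val_zero, Matrix.cons_val_one, Matrix.cons_val]
    field_simp
    rw [hI]
    linear_combination (c ^ 2 + a ^ 2 + b ^ 2 - r ^ 2 - a ^ 2 - b ^ 2) * hr - r ^ 2 * h
  · simp
    field_simp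
    ring
  · simp
    field_simp
    ring
  · simp
    field_simp
    linear_combination -Complex.I * c * hr

/-- A vector of `ℂ³` of square `-1` is part of an orthogonal basis for the bilinear form. -/
theorem exists_complex_orthonormal_pair {a b c : ℂ} (h : a ^ 2 + b ^ 2 + c ^ 2 = -1) :
    ∃ v w : Fin 3 → ℂ, v 0 ^ 2 + v 1 ^ 2 + v 2 ^ 2 = 1 ∧ w 0 ^ 2 + w 1 ^ 2 + w 2 ^ 2 = 1 ∧
      v 0 * w 0 + v 1 * w 1 + v 2 * w 2 = 0 ∧ v 0 * a + v 1 * b + v 2 * c = 0 ∧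
      w 0 * a + w 1 * b + w 2 * c = 0 := by
  by_cases hab : a ^ 2 + b ^ 2 = 0
  · by_cases hbc : b ^ 2 + c ^ 2 = 0
    · obtain ⟨v, w, h1, h2, h3, h4, h5⟩ := exists_complex_orthonormal_pair_of_ne
        (a := c) (b := a) (c := b) (by linear_combination h) (fun hca => by
          have : (2 : ℂ) = 0 := by linear_combination 2 * h - hab - hbc - hca
          norm_num at this)
      exact ⟨![v 1, v 2, v 0], ![w 1, w 2, w 0], by simp; linear_combination h1,
        by simp; linear_combination h2, by simp; linear_combination h3,
        by simp; linear_combination h4, by simp; linear_combination h5⟩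
    · obtain ⟨v, w, h1, h2, h3, h4, h5⟩ := exists_complex_orthonormal_pair_of_ne
        (a := b) (b := c) (c := a) (by linear_combination h) hbc
      exact ⟨![v 2, v 0, v 1], ![w 2, w 0, w 1], by simp; linear_combination h1,
        by simp; linear_combination h2, by simp; linear_combination h3,
        by simp; linear_combination h4, by simp; linear_combination h5⟩
  · exact exists_complex_orthonormal_pair_of_ne h hab

theorem exists_frame_PJ {x : Vec 6} (hx : pip 3 6 x x = 1) (hf : pip 3 6 (PJ *ᵥ x) x = 1) :
    ∃ b : Fin 4 → Vec 6, (∀ i, b i ∈ sphereTangent 3 PJ x) ∧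
        (∀ j, sphereShape PJ 1 1 (b j) =
          ∑ i, (!![0, -1, 0, 0; 1, 0, 0, 0; 0, 0, 0, -1; 0, 0, 1, 0] :
            Matrix (Fin 4) (Fin 4) ℝ) i j • b i) ∧
        gram 3 b = !![-1, 0, 0, 0; 0, 1, 0, 0; 0, 0, -1, 0; 0, 0, 0, 1] := by
  simp [pip_three_six, PJ_mulVec] at hx hf
  obtain ⟨v, w, hv, hw, hvw, hvz, hwz⟩ := exists_complex_orthonormal_pair
    (a := ⟨x 0, x 5⟩) (b := ⟨x 1, x 4⟩) (c := ⟨x 2, x 3⟩) (by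
      apply Complex.ext
      · simp [pow_two]
        linear_combination -hx
      · simp [pow_two]
        linear_combination hf - hx)
  have hv1 := congrArg Complex.re hv
  have hv2 := congrArg Complex.im hv
  have hw1 := congrArg Complex.re hw
  have hw2 := congrArg Complex.im hw
  have hvw1 := congrArg Complex.re hvw
  have hvw2 := congrArg Complex.im hvw
  have hvz1 := congrArg Complex.re hvz
  have hvz2 := congrArg Complex.im hvz
  have hwz1 := congrArg Complex.re hwz
  have hwz2 := congrArg Complex.im hwz
  simp [pow_two] at hv1 hv2 hw1 hw2 hvw1 hvw2 hvz1 hvz2 hwz1 hwz2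
  clear hv hw hvw hvz hwz
  refine ⟨![![(v 0).re, (v 1).re, (v 2).re, (v 2).im, (v 1).im, (v 0).im],
    ![(v 0).im, (v 1).im, (v 2).im, -(v 2).re, -(v 1).re, -(v 0).re],
    ![(w 0).re, (w 1).re, (w 2).re, (w 2).im, (w 1).im, (w 0).im],
    ![(w 0).im, (w 1).im, (w 2).im, -(w 2).re, -(w 1).re, -(w 0).re]], ?_, ?_, ?_⟩
  · intro i
    constructor
    · fin_cases i <;> simp [pip_three_six]
      · linear_combination -hvz1
      · linear_combination -hvz2
      · linear_combination -hwz1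
      · linear_combination -hwz2
    · fin_cases i <;> simp [pip_three_six, PJ_mulVec]
      · linear_combination -hvz1 + hvz2
      · linear_combination -hvz2 - hvz1
      · linear_combination -hwz1 + hwz2
      · linear_combination -hwz2 - hwz1
  · intro j
    ext i
    fin_cases j <;> fin_cases i <;>
      simp [sphereShape_apply, PJ_mulVec, Fin.sum_univ_four]
  · ext i j
    fin_cases i <;> fin_cases j <;> simp [gram, pip_three_six]
    · linear_combination -hv1
    · linear_combination -hv2
    · linear_combination -hvw1
    · linear_combination -hvw2
    · linear_combination -hv2
    · linear_combination hv1
    · linear_combination -hvw2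
    · linear_combination hvw1
    · linear_combination -hvw1
    · linear_combination -hvw2
    · linear_combination -hw1
    · linear_combination -hw2
    · linear_combination -hvw2
    · linear_combination hvw1
    · linear_combination -hw2
    · linear_combination hw1

theorem charpoly_rotation_blocks :
    (!![0, -1, 0, 0; 1, 0, 0, 0; 0, 0, 0, -1; 0, 0, 1, 0] :
      Matrix (Fin 4) (Fin 4) ℝ).charpoly = (Polynomial.X ^ 2 + 1) ^ 2 := by
  refine Polynomial.funext fun t => ?_
  rw [Matrix.eval_charpoly]
  simp [Matrix.det_succ_row_zero, Fin.sum_univ_succ, Fin.succAbove]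
  ring

theorem roots_charpoly_rotation_blocks :
    ((!![0, -1, 0, 0; 1, 0, 0, 0; 0, 0, 0, -1; 0, 0, 1, 0] :
      Matrix (Fin 4) (Fin 4) ℝ).charpoly.map (algebraMap ℝ ℂ)).roots =
      {-Complex.I, -Complex.I, Complex.I, Complex.I} := by
  have h : ((Polynomial.X ^ 2 + 1) ^ 2 : ℝ[X]).map (algebraMap ℝ ℂ) =
      (({-Complex.I, -Complex.I, Complex.I, Complex.I} : Multiset ℂ).map
        fun a => Polynomial.X - Polynomial.C a).prod := by
    have hI : (Polynomial.C Complex.I) * (Polynomial.C Complex.I) = (-1 : ℂ[X]) := by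
      rw [← Polynomial.C_mul, Complex.I_mul_I]
      simp
    simp
    linear_combination (2 * Polynomial.X ^ 2 + 1 - Polynomial.C Complex.I * Polynomial.C Complex.I)
      * hI
  rw [charpoly_rotation_blocks, h, Polynomial.roots_multiset_prod_X_sub_C]

theorem isDiagonalizable_baseChange_rotation_blocks {V : Type*} [AddCommGroup V] [Module ℝ V]
    {A : Module.End ℝ V} (B : Module.Basis (Fin 4) ℝ V)
    (h : LinearMap.toMatrix B B A = !![0, -1, 0, 0; 1, 0, 0, 0; 0, 0, 0, -1; 0, 0, 1, 0]) :
    IsDiagonalizable (K := ℂ) (V := ℂ ⊗[ℝ] V) (LinearMap.baseChange ℂ A) := by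
  have hA : A = Matrix.toLin B B !![0, -1, 0, 0; 1, 0, 0, 0; 0, 0, 0, -1; 0, 0, 1, 0] := by
    rw [← h, Matrix.toLin_toMatrix]
  have h0 : A (B 0) = B 1 := by
    rw [hA, Matrix.toLin_self, Fin.sum_univ_four]; simp
  have h1 : A (B 1) = -B 0 := by
    rw [hA, Matrix.toLin_self, Fin.sum_univ_four]; simp
  have h2 : A (B 2) = B 3 := by
    rw [hA, Matrix.toLin_self, Fin.sum_univ_four]; simp
  have h3 : A (B 3) = -B 2 := by
    rw [hA, Matrix.toLin_self, Fin.sum_univ_four]; simp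
  set E := B.baseChange ℂ with hE
  set T := LinearMap.baseChange ℂ A
  have e : ∀ i, E i = (1 : ℂ) ⊗ₜ[ℝ] B i := fun i => Module.Basis.baseChange_apply ℂ B i
  have e0 : T (E 0) = E 1 := by rw [e, e, LinearMap.baseChange_tmul, h0]
  have e1 : T (E 1) = -E 0 := by rw [e, e, LinearMap.baseChange_tmul, h1, TensorProduct.tmul_neg]
  have e2 : T (E 2) = E 3 := by rw [e, e, LinearMap.baseChange_tmul, h2]
  have e3 : T (E 3) = -E 2 := by rw [e, e, LinearMap.baseChange_tmul, h3, TensorProduct.tmul_neg]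
  set v : Fin 4 → ℂ ⊗[ℝ] V := ![E 0 + Complex.I • E 1, E 0 - Complex.I • E 1,
    E 2 + Complex.I • E 3, E 2 - Complex.I • E 3] with hv
  have hI : ∀ y : ℂ, Complex.I * y = 0 → y = 0 := fun y hy =>
    (mul_eq_zero.1 hy).resolve_left Complex.I_ne_zero
  have hli : LinearIndependent ℂ v := by
    rw [Fintype.linearIndependent_iff]
    intro c hc
    have hc' : ∑ i, (![c 0 + c 1, Complex.I * (c 0 - c 1), c 2 + c 3, Complex.I * (c 2 - c 3)] :
        Fin 4 → ℂ) i • E i = 0 := by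
      rw [← hc, Fin.sum_univ_four, Fin.sum_univ_four]
      simp only [hv, Matrix.cons_val_zero, Matrix.cons_val_one, Matrix.cons_val]
      module
    have hz := Fintype.linearIndependent_iff.1 E.linearIndependent _ hc'
    have z0 : c 0 + c 1 = 0 := hz 0
    have z1 : c 0 - c 1 = 0 := hI _ (hz 1)
    have z2 : c 2 + c 3 = 0 := hz 2
    have z3 : c 2 - c 3 = 0 := hI _ (hz 3)
    intro i
    fin_cases i
    · show c 0 = 0
      linear_combination z0 / 2 + z1 / 2
    · show c 1 = 0
      linear_combination z0 / 2 - z1 / 2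
    · show c 2 = 0
      linear_combination z2 / 2 + z3 / 2
    · show c 3 = 0
      linear_combination z2 / 2 - z3 / 2
  have hcard : Fintype.card (Fin 4) = Module.finrank ℂ (ℂ ⊗[ℝ] V) := by
    rw [Module.finrank_eq_card_basis E]
  refine ⟨Fin 4, basisOfLinearIndependentOfCardEqFinrank hli hcard, fun i =>
    ⟨![-Complex.I, Complex.I, -Complex.I, Complex.I] i, ?_⟩⟩
  rw [coe_basisOfLinearIndependentOfCardEqFinrank]
  have hI2 := Complex.I_mul_I
  fin_cases i
  · show T (E 0 + Complex.I • E 1) = -Complex.I • (E 0 + Complex.I • E 1)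
    rw [map_add, map_smul, e0, e1, smul_add, smul_smul, neg_mul, hI2]
    module
  · show T (E 0 - Complex.I • E 1) = Complex.I • (E 0 - Complex.I • E 1)
    rw [map_sub, map_smul, e0, e1, smul_sub, smul_smul, hI2]
    module
  · show T (E 2 + Complex.I • E 3) = -Complex.I • (E 2 + Complex.I • E 3)
    rw [map_add, map_smul, e2, e3, smul_add, smul_smul, neg_mul, hI2]
    module
  · show T (E 2 - Complex.I • E 3) = Complex.I • (E 2 - Complex.I • E 3)
    rw [map_sub, map_smul, e2, e3, smul_sub, smul_smul, hI2]
    module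

theorem example_j :
    IsSphereQuadricExample 3 PJ (Polynomial.X ^ 2 - 2 * Polynomial.X + 2) 1 (ev 3) (-1) .II
      (fun M ξ => ∀ x ∈ M,
        ∃ A : Module.End ℝ (tangentAt M x), IsShapeOperatorAt .sphere 3 M ξ x A ∧
          IsDiagonalizable (K := ℂ) (V := ℂ ⊗[ℝ] tangentAt M x) (LinearMap.baseChange ℂ A) ∧
          principalCurvatures A = {-Complex.I, -Complex.I, Complex.I, Complex.I}) := by
  have hsq : ∀ x, PJ *ᵥ (PJ *ᵥ x) = -((-2 : ℝ) • (PJ *ᵥ x)) - (2 : ℝ) • x := by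
    intro x
    ext i
    fin_cases i <;> simp [PJ_mulVec] <;> ring
  have hform : IsPetrovForm .II !![0, -1, 0, 0; 1, 0, 0, 0; 0, 0, 0, -1; 0, 0, 1, 0]
      !![-1, 0, 0, 0; 0, 1, 0, 0; 0, 0, -1, 0; 0, 0, 0, 1] :=
    ⟨0, 1, 0, 1, one_pos, one_pos, rfl, rfl⟩
  refine isSphereQuadricExample_of (k := 1) (by norm_num) ?_ hsq ?_ (by simp)
    (Or.inr rfl) one_pos (by norm_num) ?_ ?_ hform
    (fun x hx hf => exists_frame_PJ hx hf) ?_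
  · intro u v
    simp [PJ_mulVec, pip_three_six]
    ring
  · rw [minpoly_eq_quadratic hsq (i := 0) (j := 5) (by decide) (by simp [PJ])]
    have : (Polynomial.C 2 : ℝ[X]) = 2 := rfl
    simp [sub_eq_add_neg, this]
  · simp [pip_three_six]
  · simp [pip_three_six, PJ_mulVec]
  · intro M ξ h x hx
    obtain ⟨hx1, hx2⟩ := h.component.subset hx
    obtain ⟨b, hb, hJ, hG⟩ := exists_frame_PJ hx1 hx2
    obtain ⟨A, hA, B, -, hAB⟩ := h.hasShapeMatrix hx hb
      (linearIndependent_of_gram (s := 3) (hG ▸ hform.det_ne_zero)) hJ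
    exact ⟨A, hA, isDiagonalizable_baseChange_rotation_blocks B hAB,
      (principalCurvatures_eq_of_toMatrix B hAB).trans roots_charpoly_rotation_blocks⟩

end PseudoIso

namespace PseudoIso

/-! ### Parametrized hypersurfaces of the flat space -/

/-- The image of a smooth injective map `f` with a smooth left inverse `g` on a neighbourhood of the
image that is cut out by one equation `F = 0`, with a frame `b` in which the differentials of `f` and
of the unit normal field `N` are related by the matrix `J`. -/
theorem isParametrizedExample_of {f N : Vec 4 → Vec 5} {D : Set (Vec 4)} {τ : PetrovType}
    {b : Vec 4 → Fin 4 → Vec 5} {J G : Matrix (Fin 4) (Fin 4) ℝ} (hD : IsOpen D)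
    (hne : D.Nonempty) (hf : ContDiffOn ℝ ∞ f D) (hN : ContDiffOn ℝ ∞ N D) {U : Set (Vec 5)}
    (hU : IsOpen U) {g : Vec 5 → Vec 4} (hg : ContDiffOn ℝ ∞ g U) {F : Vec 5 → ℝ}
    (hF : ContDiffOn ℝ ∞ F U) (hF' : ∀ y ∈ U, ∃ e, fderiv ℝ F y e ≠ 0)
    (hfU : ∀ p ∈ D, f p ∈ U ∧ g (f p) = p ∧ F (f p) = 0)
    (hgD : ∀ y ∈ U, F y = 0 → g y ∈ D ∧ f (g y) = y)
    (hunit : ∀ p ∈ D, pip 2 5 (N p) (N p) = 1)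
    (hnor : ∀ p ∈ D, ∀ j, pip 2 5 (N p) (b p j) = 0)
    (hb : ∀ p ∈ D, ∃ c : Fin 4 → Vec 4, ∀ j, fderiv ℝ f p (c j) = b p j ∧
      -(fderiv ℝ N p (c j)) = ∑ i, J i j • b p i)
    (hJG : IsPetrovForm τ J G)
    (hS : ∀ p ∈ D, ∃ S : Matrix (Fin 4) (Fin 4) ℝ, Sᵀ * gram 2 (b p) * S = G ∧ J * S = S * J) :
    IsParametrizedExample f D N 1 τ b J := by
  refine ⟨hD, hne, hf, N ∘ g, fun p hp => by simp [(hfU p hp).2.1], fun M hM => ?_⟩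
  set L := f '' D with hL
  set F₁ : Vec 5 → Vec 1 := fun y _ => F y with hF₁
  have hF₁s : ContDiffOn ℝ ∞ F₁ U := contDiffOn_pi.2 fun _ => hF
  have hLU : ∀ x ∈ L, x ∈ U := by
    rintro _ ⟨p, hp, rfl⟩
    exact (hfU p hp).1
  have hsurj : ∀ y ∈ U, Function.Surjective (fderiv ℝ F₁ y) := by
    intro y hy a
    obtain ⟨e, he⟩ := hF' y hy
    have h1 : HasFDerivAt F (fderiv ℝ F y) y :=
      ((hF.contDiffAt (hU.mem_nhds hy)).differentiableAt (by simp)).hasFDerivAt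
    have h2 : HasFDerivAt F₁ (ContinuousLinearMap.pi fun _ => fderiv ℝ F y) y :=
      hasFDerivAt_pi.2 fun _ => h1
    refine ⟨(a 0 / fderiv ℝ F y e) • e, ?_⟩
    rw [h2.fderiv]
    ext i
    rw [Fin.fin_one_eq_zero i]
    simp [he]
  have hLF : L ∩ U = {y | y ∈ U ∧ F₁ y = 0} := by
    ext y
    constructor
    · rintro ⟨⟨p, hp, rfl⟩, hy⟩
      exact ⟨hy, funext fun _ => (hfU p hp).2.2⟩
    · rintro ⟨hy, hy0⟩
      obtain ⟨h1, h2⟩ := hgD y hy (congrFun hy0 0)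
      exact ⟨⟨g y, h1, h2⟩, hy⟩
  have hman : IsSmoothSubmanifold L 1 := fun x hx => ⟨U, hU, hLU x hx, F₁, hF₁s, hsurj, hLF⟩
  have hgM : ∀ x ∈ M, g x ∈ D ∧ f (g x) = x := by
    intro x hx
    obtain ⟨p, hp, rfl⟩ := hM.subset hx
    rw [(hfU p hp).2.1]
    exact ⟨hp, rfl⟩
  have hdet : ∀ p ∈ D, LinearIndependent ℝ (b p) := by
    intro p hp
    obtain ⟨S, hS, -⟩ := hS p hp
    refine linearIndependent_of_gram (s := 2) fun h => hJG.det_ne_zero ?_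
    rw [← hS, Matrix.det_mul, Matrix.det_mul, h, mul_zero, zero_mul]
  have hTM : ∀ x ∈ M, tangentAt M x = tangentAt L x := fun x hx => hman.tangentAt_component hM hx
  have hrank : ∀ x ∈ M, Module.finrank ℝ (tangentAt M x) = 4 := by
    intro x hx
    have hxL := hM.subset hx
    have hxU := hLU x hxL
    have := finrank_ker_of_surjective (hsurj x hxU)
    rw [hTM x hx, tangentAt_eq_ker hU hxU hF₁s (hsurj x hxU) hLF hxL]
    omega
  have hbT : ∀ p ∈ D, f p ∈ M → ∀ j, b p j ∈ tangentAt M (f p) := by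
    intro p hp hpM j
    obtain ⟨c, hc⟩ := hb p hp
    rw [hTM _ hpM, ← (hc j).1]
    have hline : Continuous fun t : ℝ => p + t • c j := by fun_prop
    have hd : HasDerivAt (fun t : ℝ => f (p + t • c j)) (fderiv ℝ f p (c j)) 0 := by
      have h1 : HasFDerivAt f (fderiv ℝ f p) (p + (0 : ℝ) • c j) := by
        rw [zero_smul, add_zero]
        exact ((hf.contDiffAt (hD.mem_nhds hp)).differentiableAt (by simp)).hasFDerivAt
      have h2 : HasDerivAt (fun t : ℝ => p + t • c j) (c j) 0 := by
        simpa using ((hasDerivAt_id (0 : ℝ)).smul_const (c j)).const_add p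
      exact h1.comp_hasDerivAt 0 h2
    rw [← hd.deriv]
    refine IsCurveAt.deriv_mem (isCurveAt_of_isOpen (hD.preimage hline) (by simpa using hp)
      (hf.comp ?_ fun t ht => ht) (fun t ht => ⟨_, ht, rfl⟩) (by simp))
    exact (contDiff_const.add (contDiff_id.smul contDiff_const)).contDiffOn
  have hspan : ∀ p ∈ D, f p ∈ M → ∀ v ∈ tangentAt M (f p),
      ∃ a : Fin 4 → ℝ, v = ∑ i, a i • b p i := by
    intro p hp hpM v hv
    obtain ⟨B, hB⟩ := exists_basis_of_linearIndependent (hrank _ hpM) (hbT p hp hpM) (hdet p hp)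
    refine ⟨B.repr ⟨v, hv⟩, ?_⟩
    have := congrArg (tangentAt M (f p)).subtype (B.sum_repr ⟨v, hv⟩)
    simp only [map_sum, map_smul, Submodule.subtype_apply, hB] at this
    exact this.symm
  have hgd : ∀ x ∈ M, HasFDerivAt g (fderiv ℝ g x) x := fun x hx =>
    ((hg.contDiffAt (hU.mem_nhds (hLU x (hM.subset hx)))).differentiableAt (by simp)).hasFDerivAt
  have hNd : ∀ p ∈ D, HasFDerivAt N (fderiv ℝ N p) p := fun p hp =>
    ((hN.contDiffAt (hD.mem_nhds hp)).differentiableAt (by simp)).hasFDerivAt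
  have hfd : ∀ p ∈ D, HasFDerivAt f (fderiv ℝ f p) p := fun p hp =>
    ((hf.contDiffAt (hD.mem_nhds hp)).differentiableAt (by simp)).hasFDerivAt
  have hgf : ∀ p ∈ D, f p ∈ M → ∀ v, fderiv ℝ g (f p) (fderiv ℝ f p v) = v := by
    intro p hp hpM v
    have h1 := (hgd _ hpM).comp p (hfd p hp)
    have h2 : HasFDerivAt (g ∘ f) (ContinuousLinearMap.id ℝ (Vec 4)) p := by
      refine (hasFDerivAt_id p).congr_of_eventuallyEq ?_
      filter_upwards [hD.mem_nhds hp] with q hq using (hfU q hq).2.1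
    exact congrArg (fun l : Vec 4 →L[ℝ] Vec 4 => l v) (h1.unique h2)
  set A : Vec 4 → Vec 5 →ₗ[ℝ] Vec 5 := fun p =>
    -((fderiv ℝ N p).comp (fderiv ℝ g (f p)) : Vec 5 →ₗ[ℝ] Vec 5) with hA
  have hAb : ∀ p ∈ D, f p ∈ M → ∀ j, A p (b p j) = ∑ i, J i j • b p i := by
    intro p hp hpM j
    obtain ⟨c, hc⟩ := hb p hp
    rw [← (hc j).2, ← (hc j).1]
    show -(fderiv ℝ N p (fderiv ℝ g (f p) (fderiv ℝ f p (c j)))) = _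
    rw [hgf p hp hpM]
  have hshape : ∀ p ∈ D, f p ∈ M → HasShapeMap .flat 2 M (N ∘ g) (f p) (A p) := by
    intro p hp hpM
    constructor
    · intro v hv
      obtain ⟨a, rfl⟩ := hspan p hp hpM v hv
      rw [map_sum]
      refine Submodule.sum_mem _ fun i _ => ?_
      rw [map_smul, hAb p hp hpM]
      exact Submodule.smul_mem _ _ (Submodule.sum_mem _ fun k _ =>
        Submodule.smul_mem _ _ (hbT p hp hpM k))
    · intro γ hγ
      have h0 : γ 0 = f p := hγ.1
      have h1 : HasFDerivAt (N ∘ g) ((fderiv ℝ N p).comp (fderiv ℝ g (f p))) (f p) := by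
        have := hNd p hp
        rw [← (hfU p hp).2.1] at this
        have h2 := this.comp (f p) (hgd _ hpM)
        rwa [(hfU p hp).2.1] at h2
      have h2 : HasDerivAt (fun t => (N ∘ g) (γ t))
          (((fderiv ℝ N p).comp (fderiv ℝ g (f p))) (deriv γ 0)) 0 := by
        rw [← h0] at h1
        have h3 := h1.comp_hasDerivAt 0 hγ.differentiableAt.hasDerivAt
        rwa [h0] at h3
      rw [h2.deriv]
      simp [projTangent, SpaceKind.curv, hA]
  have hmat : ∀ p ∈ D, f p ∈ M → HasShapeMatrix .flat 2 M (N ∘ g) (f p) (b p) J :=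
    fun p hp hpM => (hshape p hp hpM).hasShapeMatrix (hrank _ hpM) (hbT p hp hpM) (hdet p hp)
      (hAb p hp hpM)
  have hpet : HasPetrovType .flat 2 M (N ∘ g) τ := by
    refine ⟨J, G, hJG, fun x hx => ?_⟩
    obtain ⟨p, hp, rfl⟩ := hM.subset hx
    obtain ⟨S, hSG, hSJ⟩ := hS p hp
    have hgr : gram 2 (fun j => ∑ i, S i j • b p i) = G := by rw [gram_combination, hSG]
    refine ⟨_, (hshape p hp hx).hasShapeMatrix (hrank _ hx) (fun j => Submodule.sum_mem _ fun i _ =>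
      Submodule.smul_mem _ _ (hbT p hp hx i))
      (linearIndependent_of_gram (s := 2) (hgr ▸ hJG.det_ne_zero)) fun j => ?_, hgr⟩
    simp only [map_sum, map_smul, hAb p hp hx, Finset.smul_sum, smul_smul]
    conv_lhs => rw [Finset.sum_comm]
    conv_rhs => rw [Finset.sum_comm]
    refine Finset.sum_congr rfl fun i _ => ?_
    rw [← Finset.sum_smul, ← Finset.sum_smul]
    have := congrFun (congrFun hSJ i) j
    simp only [Matrix.mul_apply] at this
    congr 1
    simpa only [mul_comm] using this
  refine ⟨hpet.isIsoparametricHypersurface hM.isConnected (fun x _ => Set.mem_univ x)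
    (hman.component hM) ?_ (fun x _ => by rw [tangentAt_flat]; trivial) ?_ (Or.inl rfl) ?_, hpet,
    hmat⟩
  · exact hN.comp (hg.mono fun x hx => hLU x (hM.subset hx)) fun x hx => (hgM x hx).1
  · intro x hx v hv
    obtain ⟨p, hp, rfl⟩ := hM.subset hx
    obtain ⟨a, rfl⟩ := hspan p hp hx v hv
    simp [map_sum, (hfU p hp).2.1, hnor p hp]
  · intro x hx
    exact hunit _ (hgM x hx).1

end PseudoIso

namespace PseudoIso

/-! ### Tubes over null curves -/

/-- A frame along a curve in `ℝ^5_2` with null vectors `X`, `Y`, and the equations of its motion. -/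
structure NullFrame (q σ : ℝ) (X Y Z C : ℝ → Vec 5) (V n k : Vec 5) : Prop where
  sq_q : q * q = 2
  sign : σ * σ = 1
  contDiff_X : ContDiff ℝ ∞ X
  contDiff_Y : ContDiff ℝ ∞ Y
  contDiff_Z : ContDiff ℝ ∞ Z
  contDiff_C : ContDiff ℝ ∞ C
  deriv_Y : ∀ s, HasDerivAt Y ((σ * q / 2) • Z s) s
  deriv_Z : ∀ s, HasDerivAt Z n s
  deriv_C : ∀ s, HasDerivAt C (Z s) s
  n_eq : ∀ s, n = σ • ((1 / q) • (X s + σ • Y s) - C s)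
  k_eq : ∀ s, k = X s - σ • Y s
  XX : ∀ s, pip 2 5 (X s) (X s) = 0
  XY : ∀ s, pip 2 5 (X s) (Y s) = -σ
  XZ : ∀ s, pip 2 5 (X s) (Z s) = 0
  XV : ∀ s, pip 2 5 (X s) V = 0
  XC : ∀ s, pip 2 5 (X s) (C s) = 0
  YY : ∀ s, pip 2 5 (Y s) (Y s) = 0
  YZ : ∀ s, pip 2 5 (Y s) (Z s) = 0
  YV : ∀ s, pip 2 5 (Y s) V = 0
  YC : ∀ s, pip 2 5 (Y s) (C s) = 0
  ZZ : ∀ s, pip 2 5 (Z s) (Z s) = σ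
  ZV : ∀ s, pip 2 5 (Z s) V = 0
  ZC : ∀ s, pip 2 5 (Z s) (C s) = 0
  VV : pip 2 5 V V = -σ
  VC : ∀ s, pip 2 5 V (C s) = 0
  CC : ∀ s, pip 2 5 (C s) (C s) = 1
  eq_zero : ∀ s w, pip 2 5 n w = 0 → pip 2 5 k w = 0 → pip 2 5 (Z s) w = 0 → pip 2 5 V w = 0 →
    pip 2 5 (C s) w = 0 → w = 0

/-- The function `1 + σ a² v²`. -/
def radSq (σ a v : ℝ) : ℝ := 1 + σ * (a ^ 2 * v ^ 2)

noncomputable def rad (σ a v : ℝ) : ℝ := √(radSq σ a v)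

noncomputable def tubeMap (σ a : ℝ) (X Y Z C : ℝ → Vec 5) (V : Vec 5) (p : Vec 4) : Vec 5 :=
  (∫ w in (0 : ℝ)..p 0, X w) + p 1 • Y (p 0) + p 2 • Z (p 0) + p 3 • V
    + (1 / a * (1 - rad σ a (p 3))) • C (p 0)

def tubeDomain (q σ a : ℝ) : Set (Vec 4) := {p | p 2 + σ * q ≠ 0 ∧ 0 < radSq σ a (p 3)}

noncomputable def tubeNormal (q σ a : ℝ) (Y C : ℝ → Vec 5) (V : Vec 5) (p : Vec 4) : Vec 5 :=
  (-(σ * (q * p 2 / (p 2 + σ * q))) * rad σ a (p 3)) • Y (p 0) - (a * p 3) • V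
    + rad σ a (p 3) • C (p 0)

noncomputable def tubeFrame (q σ a : ℝ) (f : Vec 4 → Vec 5) (p : Vec 4) : Fin 4 → Vec 5 :=
  ![partialD f 1 p,
    ((p 2 + σ * q) ^ 2 / (2 * rad σ a (p 3))) • partialD f 2 p,
    (-(σ * ((p 2 + σ * q) ^ 3 / (2 * q * radSq σ a (p 3))))) • partialD f 0 p,
    (q * a * p 2 * p 3 / ((p 2 + σ * q) * rad σ a (p 3))) • partialD f 1 p + partialD f 3 p]

theorem hasDerivAt_rad {σ a v : ℝ} (h : 0 < radSq σ a v) :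
    HasDerivAt (rad σ a) (σ * a ^ 2 * v / rad σ a v) v := by
  have h1 : HasDerivAt (radSq σ a) (σ * (a ^ 2 * (2 * v))) v := by
    have := ((((hasDerivAt_id v).pow 2).const_mul (a ^ 2)).const_mul σ).const_add 1
    convert! this using 1
    simp
  have h2 := h1.sqrt h.ne'
  convert! h2 using 1
  unfold rad
  field_simp

theorem rad_sq {σ a v : ℝ} (h : 0 < radSq σ a v) : rad σ a v ^ 2 = radSq σ a v :=
  Real.sq_sqrt h.le

theorem rad_pos {σ a v : ℝ} (h : 0 < radSq σ a v) : 0 < rad σ a v := Real.sqrt_pos.2 h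

theorem continuous_radSq (σ a : ℝ) : Continuous (radSq σ a) := by
  unfold radSq
  fun_prop

theorem continuous_rad (σ a : ℝ) : Continuous (rad σ a) := (continuous_radSq σ a).sqrt

theorem contDiffOn_rad (σ a : ℝ) : ContDiffOn ℝ ∞ (rad σ a) {v | 0 < radSq σ a v} := by
  refine ContDiffOn.sqrt ?_ fun v hv => (ne_of_gt hv)
  unfold radSq
  fun_prop

theorem contDiffOn_pip {E : Type*} [NormedAddCommGroup E] [NormedSpace ℝ E] {s m : ℕ} {S : Set E}
    {f g : E → Vec m} (hf : ContDiffOn ℝ ∞ f S) (hg : ContDiffOn ℝ ∞ g S) :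
    ContDiffOn ℝ ∞ (fun y => pip s m (f y) (g y)) S := by
  simp only [pip_apply]
  exact ContDiffOn.sum fun i _ =>
    (contDiffOn_const.mul (contDiffOn_pi.1 hf i)).mul (contDiffOn_pi.1 hg i)

theorem hasFDerivAt_comp_coord {E : Type*} [NormedAddCommGroup E] [NormedSpace ℝ E] {m : ℕ}
    {A : ℝ → E} {A' : E} {p : Vec m} {i : Fin m} (hA : HasDerivAt A A' (p i)) :
    HasFDerivAt (fun y : Vec m => A (y i))
      ((ContinuousLinearMap.proj (R := ℝ) (φ := fun _ : Fin m => ℝ) i).smulRight A') p := by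
  have e : HasFDerivAt (fun y : Vec m => y i)
    (ContinuousLinearMap.proj (R := ℝ) (φ := fun _ : Fin m => ℝ) i) p := hasFDerivAt_apply i p
  have := hA.hasFDerivAt.comp p e
  convert! this using 1

theorem isOpen_tubeDomain (q σ a : ℝ) : IsOpen (tubeDomain q σ a) := by
  refine IsOpen.inter (s := {p : Vec 4 | p 2 + σ * q ≠ 0}) (t := {p | 0 < radSq σ a (p 3)})
    (isOpen_ne_fun (by fun_prop) continuous_const) (isOpen_lt continuous_const ?_)
  exact (continuous_radSq σ a).comp (continuous_apply 3)

namespace NullFrame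

variable {q σ : ℝ} {X Y Z C : ℝ → Vec 5} {V n k : Vec 5} (h : NullFrame q σ X Y Z C V n k)
include h

theorem q_ne_zero : q ≠ 0 := by
  rintro rfl
  have := h.sq_q
  norm_num at this

theorem sign_ne_zero : σ ≠ 0 := by
  rintro rfl
  have := h.sign
  norm_num at this

theorem nX (s : ℝ) : pip 2 5 n (X s) = -σ / q := by
  rw [h.n_eq s]
  simp [h.XX, pip_comm 2 (Y s) (X s), h.XY, pip_comm 2 (C s) (X s), h.XC]
  linear_combination (-σ / q) * h.sign

theorem nY (s : ℝ) : pip 2 5 n (Y s) = -1 / q := by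
  rw [h.n_eq s]
  simp [h.XY, h.YY, pip_comm 2 (C s) (Y s), h.YC]
  linear_combination (-1 / q) * h.sign

theorem nZ (s : ℝ) : pip 2 5 n (Z s) = 0 := by
  rw [h.n_eq s]
  simp [h.XZ, h.YZ, pip_comm 2 (C s) (Z s), h.ZC]

theorem nV : pip 2 5 n V = 0 := by
  rw [h.n_eq 0]
  simp [h.XV, h.YV, pip_comm 2 (C 0) V, h.VC]

theorem nC (s : ℝ) : pip 2 5 n (C s) = -σ := by
  rw [h.n_eq s]
  simp [h.XC, h.YC, h.CC]

theorem nn : pip 2 5 n n = 0 := by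
  nth_rw 2 [h.n_eq 0]
  have hq : 2 * (q⁻¹ * q⁻¹) = 1 := by
    have := h.q_ne_zero
    field_simp
    linear_combination -h.sq_q
  simp [h.nX, h.nY, h.nC]
  right
  linear_combination -σ * hq

theorem kX (s : ℝ) : pip 2 5 k (X s) = 1 := by
  rw [h.k_eq s]
  simp [h.XX, pip_comm 2 (Y s) (X s), h.XY]
  linear_combination h.sign

theorem kY (s : ℝ) : pip 2 5 k (Y s) = -σ := by
  rw [h.k_eq s]
  simp [h.XY, h.YY]

theorem kZ (s : ℝ) : pip 2 5 k (Z s) = 0 := by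
  rw [h.k_eq s]
  simp [h.XZ, h.YZ]

theorem kV : pip 2 5 k V = 0 := by
  rw [h.k_eq 0]
  simp [h.XV, h.YV]

theorem kC (s : ℝ) : pip 2 5 k (C s) = 0 := by
  rw [h.k_eq s]
  simp [h.XC, h.YC]

theorem kn : pip 2 5 k n = 0 := by
  rw [h.n_eq 0]
  simp [h.kX, h.kY, h.kC]
  right
  linear_combination -q⁻¹ * h.sign

theorem pip_integral {c : Vec 5} {m : ℝ} (hc : ∀ s, pip 2 5 c (X s) = m) (s : ℝ) :
    pip 2 5 c (∫ w in (0 : ℝ)..s, X w) = m * s := by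
  have := (pipL 2 c).intervalIntegral_comp_comm
    (h.contDiff_X.continuous.intervalIntegrable (μ := MeasureTheory.volume) 0 s)
  rw [← pipL_apply, ← this]
  simp [hc, mul_comm]

theorem hasDerivAt_integral (s : ℝ) : HasDerivAt (fun s => ∫ w in (0 : ℝ)..s, X w) (X s) s :=
  (h.contDiff_X.continuous.integral_hasStrictDerivAt 0 s).hasDerivAt

theorem contDiff_integral : ContDiff ℝ ∞ (fun s => ∫ w in (0 : ℝ)..s, X w) := by
  rw [contDiff_infty_iff_deriv]
  refine ⟨fun s => (h.hasDerivAt_integral s).differentiableAt, ?_⟩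
  rw [show deriv (fun s => ∫ w in (0 : ℝ)..s, X w) = X from
    funext fun s => (h.hasDerivAt_integral s).deriv]
  exact h.contDiff_X

theorem fderiv_tubeMap {a : ℝ} (ha : a ≠ 0) {p : Vec 4} (hp : 0 < radSq σ a (p 3)) (c : Vec 4) :
    fderiv ℝ (tubeMap σ a X Y Z C V) p c =
      c 0 • (X (p 0) + (p 1 * (σ * q / 2) + 1 / a * (1 - rad σ a (p 3))) • Z (p 0) + p 2 • n)
        + c 1 • Y (p 0) + c 2 • Z (p 0)
        + c 3 • (V - (σ * a * p 3 / rad σ a (p 3)) • C (p 0)) := by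
  have e : ∀ i : Fin 4, HasFDerivAt (fun q : Vec 4 => q i)
      (ContinuousLinearMap.proj (R := ℝ) (φ := fun _ : Fin 4 => ℝ) i) p := fun i =>
    hasFDerivAt_apply i p
  have hX : HasFDerivAt (fun q : Vec 4 => ∫ w in (0 : ℝ)..q 0, X w) _ p :=
    hasFDerivAt_comp_coord (h.hasDerivAt_integral (p 0))
  have hY : HasFDerivAt (fun q : Vec 4 => Y (q 0)) _ p :=
    hasFDerivAt_comp_coord (h.deriv_Y (p 0))
  have hZ : HasFDerivAt (fun q : Vec 4 => Z (q 0)) _ p :=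
    hasFDerivAt_comp_coord (h.deriv_Z (p 0))
  have hC : HasFDerivAt (fun q : Vec 4 => C (q 0)) _ p :=
    hasFDerivAt_comp_coord (h.deriv_C (p 0))
  have hr : HasFDerivAt (fun q : Vec 4 => 1 / a * (1 - rad σ a (q 3))) _ p :=
    ((hasFDerivAt_comp_coord (hasDerivAt_rad hp)).const_sub 1).const_mul (1 / a)
  have := (((hX.add ((e 1).smul hY)).add ((e 2).smul hZ)).add ((e 3).smul_const V)).add
    (hr.smul hC)
  have h2 : HasFDerivAt (tubeMap σ a X Y Z C V) _ p := this
  rw [h2.fderiv]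
  simp
  match_scalars <;> field_simp
  ring

theorem fderiv_tubeNormal {a : ℝ} {p : Vec 4} (hp : p ∈ tubeDomain q σ a) (c : Vec 4) :
    fderiv ℝ (tubeNormal q σ a Y C V) p c =
      (c 0 * (rad σ a (p 3) * σ * q / (p 2 + σ * q))) • Z (p 0)
        + (c 2 * (-2 / (p 2 + σ * q) ^ 2 * rad σ a (p 3))) • Y (p 0)
        + c 3 • ((-(σ * (q * p 2 / (p 2 + σ * q))) * (σ * a ^ 2 * p 3 / rad σ a (p 3))) • Y (p 0)
          - a • V + (σ * a ^ 2 * p 3 / rad σ a (p 3)) • C (p 0)) := by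
  have e : ∀ i : Fin 4, HasFDerivAt (fun q : Vec 4 => q i)
      (ContinuousLinearMap.proj (R := ℝ) (φ := fun _ : Fin 4 => ℝ) i) p := fun i =>
    hasFDerivAt_apply i p
  have ht : p 2 + σ * q ≠ 0 := hp.1
  have hY : HasFDerivAt (fun q : Vec 4 => Y (q 0)) _ p :=
    hasFDerivAt_comp_coord (h.deriv_Y (p 0))
  have hC : HasFDerivAt (fun q : Vec 4 => C (q 0)) _ p :=
    hasFDerivAt_comp_coord (h.deriv_C (p 0))
  have hr : HasFDerivAt (fun q : Vec 4 => rad σ a (q 3)) _ p :=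
    hasFDerivAt_comp_coord (hasDerivAt_rad hp.2)
  have hα : HasDerivAt (fun z => -(σ * (q * z / (z + σ * q)))) (-2 / (p 2 + σ * q) ^ 2) (p 2) := by
    have := ((((hasDerivAt_id (p 2)).const_mul q).div ((hasDerivAt_id (p 2)).add_const (σ * q))
      ht).const_mul σ).neg
    convert! this using 1
    simp
    field_simp
    linear_combination q ^ 2 * h.sign + h.sq_q
  have hα' : HasFDerivAt (fun y : Vec 4 => -(σ * (q * y 2 / (y 2 + σ * q)))) _ p :=
    hasFDerivAt_comp_coord hα
  have h2 : HasFDerivAt (tubeNormal q σ a Y C V) _ p :=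
    (((hα'.mul hr).smul hY).sub (((e 3).const_mul a).smul_const V)).add (hr.smul hC)
  rw [h2.fderiv]
  simp
  match_scalars
  · field_simp
    linear_combination (-(rad σ a (p 3) * c 0 * p 2 * q * q)) * h.sign
      - rad σ a (p 3) * c 0 * p 2 * h.sq_q
  · field_simp
    ring
  · field_simp
  · field_simp

end NullFrame

end PseudoIso

namespace PseudoIso

/-- A frame whose Gram matrix is antitriangular on the first three vectors can be normalized by a
matrix that commutes with a nilpotent Jordan block. -/
theorem exists_normalizing_matrix_three {σ β ρ : ℝ} (hσ : σ * σ = 1) (hβ : β ≠ 0) (hρ : ρ ≠ 0)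
    (a m l : ℝ) : ∃ S : Matrix (Fin 4) (Fin 4) ℝ,
      Sᵀ * !![0, 0, σ * β ^ 2, 0; 0, σ * β ^ 2, m, 0; σ * β ^ 2, m, l, 0; 0, 0, 0, -σ / ρ ^ 2] * S =
        !![0, 0, σ, 0; 0, σ, 0, 0; σ, 0, 0, 0; 0, 0, 0, -σ] ∧
      !![0, 1, 0, 0; 0, 0, 1, 0; 0, 0, 0, 0; 0, 0, 0, a] * S =
        S * !![0, 1, 0, 0; 0, 0, 1, 0; 0, 0, 0, 0; 0, 0, 0, a] := by
  obtain ⟨k, hk⟩ : ∃ k, k * β = 1 := ⟨β⁻¹, inv_mul_cancel₀ hβ⟩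
  obtain ⟨x, hx⟩ : ∃ x, x = -σ * m * k ^ 2 / 2 := ⟨_, rfl⟩
  obtain ⟨y, hy⟩ : ∃ y, y = (3 * x ^ 2 - σ * l * k ^ 2) / 2 := ⟨_, rfl⟩
  have hk2 : k ^ 2 * β ^ 2 = 1 := by rw [← mul_pow, hk, one_pow]
  have hm : m * k ^ 2 = -2 * σ * x := by
    rw [hx]
    linear_combination (-(m * k ^ 2)) * hσ
  have hl : l * k ^ 2 = σ * (3 * x ^ 2 - 2 * y) := by
    rw [hy]
    linear_combination (-(l * k ^ 2)) * hσ
  refine ⟨!![k, k * x, k * y, 0; 0, k, k * x, 0; 0, 0, k, 0; 0, 0, 0, ρ], ?_, ?_⟩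
  · ext i j
    fin_cases i <;> fin_cases j <;> simp [Matrix.mul_apply, Fin.sum_univ_four]
    · linear_combination σ * hk2
    · linear_combination σ * hk2
    · linear_combination hm + 2 * σ * x * hk2
    · linear_combination σ * hk2
    · linear_combination hm + 2 * σ * x * hk2
    · linear_combination hl + 2 * x * hm + (2 * σ * y + σ * x ^ 2) * hk2
    · field_simp
  · ext i j
    fin_cases i <;> fin_cases j <;> simp [Matrix.mul_apply, Fin.sum_univ_four] <;> ring

theorem tubeMap_sub_integral (σ a : ℝ) (X Y Z C : ℝ → Vec 5) (V : Vec 5) (p : Vec 4) :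
    tubeMap σ a X Y Z C V p - ∫ w in (0 : ℝ)..p 0, X w =
      p 1 • Y (p 0) + p 2 • Z (p 0) + p 3 • V + (1 / a * (1 - rad σ a (p 3))) • C (p 0) := by
  rw [tubeMap]
  abel

namespace NullFrame

variable {q σ : ℝ} {X Y Z C : ℝ → Vec 5} {V n k : Vec 5} (h : NullFrame q σ X Y Z C V n k)
include h

theorem tubeFrame_apply {a : ℝ} (ha : a ≠ 0) {p : Vec 4} (hp : 0 < radSq σ a (p 3)) :
    tubeFrame q σ a (tubeMap σ a X Y Z C V) p = ![Y (p 0),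
      ((p 2 + σ * q) ^ 2 / (2 * rad σ a (p 3))) • Z (p 0),
      (-(σ * ((p 2 + σ * q) ^ 3 / (2 * q * radSq σ a (p 3))))) • (X (p 0) +
        (p 1 * (σ * q / 2) + 1 / a * (1 - rad σ a (p 3))) • Z (p 0) + p 2 • n),
      (q * a * p 2 * p 3 / ((p 2 + σ * q) * rad σ a (p 3))) • Y (p 0) +
        (V - (σ * a * p 3 / rad σ a (p 3)) • C (p 0))] := by
  simp [tubeFrame, partialD, h.fderiv_tubeMap ha hp]

theorem exists_gram_tubeFrame {a : ℝ} (ha : a ≠ 0) {p : Vec 4} (hp : p ∈ tubeDomain q σ a) :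
    ∃ m l, gram 2 (tubeFrame q σ a (tubeMap σ a X Y Z C V) p) =
      !![0, 0, σ * ((p 2 + σ * q) ^ 2 / (2 * rad σ a (p 3))) ^ 2, 0;
        0, σ * ((p 2 + σ * q) ^ 2 / (2 * rad σ a (p 3))) ^ 2, m, 0;
        σ * ((p 2 + σ * q) ^ 2 / (2 * rad σ a (p 3))) ^ 2, m, l, 0;
        0, 0, 0, -σ / rad σ a (p 3) ^ 2] := by
  obtain ⟨κ, hκ⟩ : ∃ κ, κ = p 1 * (σ * q / 2) + 1 / a * (1 - rad σ a (p 3)) := ⟨_, rfl⟩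
  obtain ⟨γ, hγ⟩ : ∃ γ, γ = -(σ * ((p 2 + σ * q) ^ 3 / (2 * q * radSq σ a (p 3)))) := ⟨_, rfl⟩
  obtain ⟨β, hβ⟩ : ∃ β, β = (p 2 + σ * q) ^ 2 / (2 * rad σ a (p 3)) := ⟨_, rfl⟩
  obtain ⟨δ, hδ⟩ : ∃ δ, δ = q * a * p 2 * p 3 / ((p 2 + σ * q) * rad σ a (p 3)) := ⟨_, rfl⟩
  obtain ⟨ε, hε⟩ : ∃ ε, ε = σ * a * p 3 / rad σ a (p 3) := ⟨_, rfl⟩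
  have ht : p 2 + σ * q ≠ 0 := hp.1
  have ht' : p 2 + q * σ ≠ 0 := by rwa [mul_comm q σ]
  have hq := h.q_ne_zero
  have hρ : rad σ a (p 3) ≠ 0 := (rad_pos hp.2).ne'
  have hR := rad_sq hp.2
  have hσ := h.sign
  refine ⟨β * (γ * (κ * σ)), γ * (γ * (κ * (κ * σ) - 2 * p 2 * σ / q)), ?_⟩
  have e1 : γ * (-σ - p 2 / q) = σ * β ^ 2 := by
    rw [hγ, hβ, ← hR]
    field_simp
    linear_combination (-(σ * p 2) - σ ^ 2 * q) * h.sq_q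
  have e2 : δ * (-σ - p 2 / q) + ε * p 2 * σ = 0 := by
    rw [hδ, hε]
    field_simp
    linear_combination (p 2 * a * p 3 * (q * σ + p 2)) * hσ
  have e3 : -σ + ε ^ 2 = -σ / rad σ a (p 3) ^ 2 := by
    rw [hε]
    field_simp
    rw [hR, radSq]
    linear_combination (-(a ^ 2 * p 3 ^ 2) + a ^ 2 * p 3 ^ 2) * hσ
  rw [h.tubeFrame_apply ha hp.2, ← hκ, ← hγ, ← hβ, ← hδ, ← hε, ← e3]
  have c1 := h.XX (p 0)
  have c2 := h.XY (p 0)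
  have c3 := h.XZ (p 0)
  have c4 := h.XV (p 0)
  have c5 := h.XC (p 0)
  have c6 := h.YY (p 0)
  have c7 := h.YZ (p 0)
  have c8 := h.YV (p 0)
  have c9 := h.YC (p 0)
  have c10 := h.ZZ (p 0)
  have c11 := h.ZV (p 0)
  have c12 := h.ZC (p 0)
  have c13 := h.VV
  have c14 := h.VC (p 0)
  have c15 := h.CC (p 0)
  have c16 := h.nX (p 0)
  have c17 := h.nY (p 0)
  have c18 := h.nZ (p 0)
  have c19 := h.nV
  have c20 := h.nC (p 0)
  have c21 := h.nn
  generalize X (p 0) = x at *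
  generalize Y (p 0) = y at *
  generalize Z (p 0) = z at *
  generalize C (p 0) = c at *
  ext i j
  fin_cases i <;> fin_cases j <;> simp [gram, pip_comm 2 y x, pip_comm 2 z x, pip_comm 2 V x,
    pip_comm 2 c x, pip_comm 2 z y, pip_comm 2 V y, pip_comm 2 c y, pip_comm 2 V z,
    pip_comm 2 c z, pip_comm 2 c V, pip_comm 2 x n, pip_comm 2 y n, pip_comm 2 z n,
    pip_comm 2 V n, pip_comm 2 c n, c1, c2, c3, c4, c5, c6, c7, c8, c9, c10, c11, c12, c13, c14,
    c15, c16, c17, c18, c19, c20, c21]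
  · linear_combination e1
  · ring
  · linear_combination e1
  · ring
  · linear_combination γ * e2
  · linear_combination γ * e2
  · ring


theorem contDiffOn_tubeMap (a : ℝ) :
    ContDiffOn ℝ ∞ (tubeMap σ a X Y Z C V) (tubeDomain q σ a) := by
  have e : ∀ i : Fin 4, ContDiffOn ℝ ∞ (fun p : Vec 4 => p i) (tubeDomain q σ a) := fun i =>
    (contDiff_apply ℝ ℝ i).contDiffOn
  have hr : ContDiffOn ℝ ∞ (fun p : Vec 4 => rad σ a (p 3)) (tubeDomain q σ a) :=
    (contDiffOn_rad σ a).comp (e 3) fun p hp => hp.2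
  exact ((((h.contDiff_integral.comp_contDiffOn (e 0)).add
    ((e 1).smul (h.contDiff_Y.comp_contDiffOn (e 0)))).add
    ((e 2).smul (h.contDiff_Z.comp_contDiffOn (e 0)))).add
    ((e 3).smul contDiffOn_const)).add
    ((contDiffOn_const.mul (contDiffOn_const.sub hr)).smul (h.contDiff_C.comp_contDiffOn (e 0)))

theorem contDiffOn_tubeNormal (a : ℝ) :
    ContDiffOn ℝ ∞ (tubeNormal q σ a Y C V) (tubeDomain q σ a) := by
  have e : ∀ i : Fin 4, ContDiffOn ℝ ∞ (fun p : Vec 4 => p i) (tubeDomain q σ a) := fun i =>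
    (contDiff_apply ℝ ℝ i).contDiffOn
  have hr : ContDiffOn ℝ ∞ (fun p : Vec 4 => rad σ a (p 3)) (tubeDomain q σ a) :=
    (contDiffOn_rad σ a).comp (e 3) fun p hp => hp.2
  exact (((((contDiffOn_const.mul ((contDiffOn_const.mul (e 2)).div
    ((e 2).add contDiffOn_const) fun p hp => hp.1)).neg.mul hr).smul
    (h.contDiff_Y.comp_contDiffOn (e 0))).sub
    ((contDiffOn_const.mul (e 3)).smul contDiffOn_const)).add
    (hr.smul (h.contDiff_C.comp_contDiffOn (e 0))))

/-- The left inverse of `tubeMap`. -/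
noncomputable def _root_.PseudoIso.tubeInv (q σ a : ℝ) (X Z : ℝ → Vec 5) (V n k : Vec 5)
    (y : Vec 5) : Vec 4 :=
  let v := -σ * pip 2 5 V y
  let P := -σ * q * (pip 2 5 n y + σ * (1 / a * (1 - rad σ a v)))
  let Q := pip 2 5 k y
  let s := (P + Q) / 2
  ![s, σ * (P - Q) / 2, σ * pip 2 5 (Z s) (y - ∫ w in (0 : ℝ)..s, X w), v]

/-- The defining function of the image of `tubeMap`. -/
noncomputable def _root_.PseudoIso.tubeEqn (q σ a : ℝ) (X Z C : ℝ → Vec 5) (V n k : Vec 5)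
    (y : Vec 5) : ℝ :=
  let p := tubeInv q σ a X Z V n k y
  pip 2 5 (C (p 0)) (y - ∫ w in (0 : ℝ)..p 0, X w) - 1 / a * (1 - rad σ a (p 3))

theorem pip_V_tubeMap (a : ℝ) (p : Vec 4) :
    pip 2 5 V (tubeMap σ a X Y Z C V p) = -σ * p 3 := by
  have h1 := h.pip_integral (c := V) (m := 0) (fun s => by rw [pip_comm, h.XV]) (p 0)
  simp [tubeMap, h1, pip_comm 2 V (Y _), h.YV, pip_comm 2 V (Z _), h.ZV, h.VV, h.VC]
  ring

theorem pip_n_tubeMap (a : ℝ) (p : Vec 4) :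
    pip 2 5 n (tubeMap σ a X Y Z C V p) =
      -σ / q * p 0 - p 1 / q - σ * (1 / a * (1 - rad σ a (p 3))) := by
  simp [tubeMap, h.pip_integral h.nX, h.nY, h.nZ, h.nV, h.nC]
  ring

theorem pip_k_tubeMap (a : ℝ) (p : Vec 4) :
    pip 2 5 k (tubeMap σ a X Y Z C V p) = p 0 - σ * p 1 := by
  simp [tubeMap, h.pip_integral h.kX, h.kY, h.kZ, h.kV, h.kC]
  ring

theorem tubeInv_tubeMap (a : ℝ) (p : Vec 4) :
    tubeInv q σ a X Z V n k (tubeMap σ a X Y Z C V p) = p := by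
  have hq := h.q_ne_zero
  have hσ := h.sign
  have hv : -σ * pip 2 5 V (tubeMap σ a X Y Z C V p) = p 3 := by
    rw [h.pip_V_tubeMap]
    linear_combination p 3 * hσ
  have hP : -σ * q * (pip 2 5 n (tubeMap σ a X Y Z C V p) +
      σ * (1 / a * (1 - rad σ a (p 3)))) = p 0 + σ * p 1 := by
    rw [h.pip_n_tubeMap]
    generalize 1 / a * (1 - rad σ a (p 3)) = r
    field_simp
    linear_combination p 0 * hσ
  have hs : ((p 0 + σ * p 1) + (p 0 - σ * p 1)) / 2 = p 0 := by ring
  have hu : σ * ((p 0 + σ * p 1) - (p 0 - σ * p 1)) / 2 = p 1 := by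
    linear_combination p 1 * hσ
  have hz : σ * pip 2 5 (Z (p 0)) (tubeMap σ a X Y Z C V p - ∫ w in (0 : ℝ)..p 0, X w) = p 2 := by
    rw [tubeMap_sub_integral]
    simp [pip_comm 2 (Z _) (Y _), h.YZ, h.ZZ, h.ZV, h.ZC]
    linear_combination p 2 * hσ
  simp only [tubeInv, hv, hP, h.pip_k_tubeMap, hs, hu, hz]
  ext i
  fin_cases i <;> rfl

theorem tubeEqn_tubeMap (a : ℝ) (p : Vec 4) :
    tubeEqn q σ a X Z C V n k (tubeMap σ a X Y Z C V p) = 0 := by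
  simp only [tubeEqn, h.tubeInv_tubeMap, tubeMap_sub_integral]
  simp [pip_comm 2 (C _) (Y _), h.YC, pip_comm 2 (C _) (Z _), h.ZC, pip_comm 2 (C _) V, h.VC, h.CC]

theorem tubeMap_tubeInv {a : ℝ} {y : Vec 5} (hy : tubeEqn q σ a X Z C V n k y = 0) :
    tubeMap σ a X Y Z C V (tubeInv q σ a X Z V n k y) = y := by
  have hq := h.q_ne_zero
  have hσ := h.sign
  obtain ⟨p, hp⟩ : ∃ p, p = tubeInv q σ a X Z V n k y := ⟨_, rfl⟩
  have h3 : p 3 = -σ * pip 2 5 V y := by rw [hp]; rfl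
  have h0 : p 0 = (-σ * q * (pip 2 5 n y + σ * (1 / a * (1 - rad σ a (p 3)))) + pip 2 5 k y) / 2 := by
    rw [h3, hp]; rfl
  have h1 : p 1 =
      σ * (-σ * q * (pip 2 5 n y + σ * (1 / a * (1 - rad σ a (p 3)))) - pip 2 5 k y) / 2 := by
    rw [h3, hp]; rfl
  have h2 : p 2 = σ * pip 2 5 (Z (p 0)) (y - ∫ w in (0 : ℝ)..p 0, X w) := by rw [hp]; rfl
  have h4 : pip 2 5 (C (p 0)) (y - ∫ w in (0 : ℝ)..p 0, X w) = 1 / a * (1 - rad σ a (p 3)) := by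
    have : pip 2 5 (C (p 0)) (y - ∫ w in (0 : ℝ)..p 0, X w) - 1 / a * (1 - rad σ a (p 3)) = 0 := by
      rw [hp]; exact hy
    linarith
  rw [← hp, ← sub_eq_zero]
  have hsplit : tubeMap σ a X Y Z C V p - y =
      (tubeMap σ a X Y Z C V p - ∫ w in (0 : ℝ)..p 0, X w) - (y - ∫ w in (0 : ℝ)..p 0, X w) := by
    abel
  generalize hr : 1 / a * (1 - rad σ a (p 3)) = r at *
  generalize y - ∫ w in (0 : ℝ)..p 0, X w = w at *
  refine h.eq_zero (p 0) _ ?_ ?_ ?_ ?_ ?_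
  · rw [map_sub, h.pip_n_tubeMap, hr, h0, h1]
    generalize pip 2 5 n y = N
    generalize pip 2 5 k y = Q
    field_simp
    linear_combination (q * (2 * N + 2 * σ * r)) * hσ
  · rw [map_sub, h.pip_k_tubeMap]
    linear_combination h0 - σ * h1 + (σ * q * (pip 2 5 n y + σ * r) / 2 + pip 2 5 k y / 2) * hσ
  · rw [hsplit, map_sub, tubeMap_sub_integral]
    simp [pip_comm 2 (Z _) (Y _), h.YZ, h.ZZ, h.ZV, h.ZC]
    linear_combination σ * h2 + pip 2 5 (Z (p 0)) w * hσ
  · rw [map_sub, h.pip_V_tubeMap, h3]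
    linear_combination pip 2 5 V y * hσ
  · rw [hsplit, map_sub, tubeMap_sub_integral, h4, hr]
    simp [pip_comm 2 (C _) (Y _), h.YC, pip_comm 2 (C _) (Z _), h.ZC, pip_comm 2 (C _) V, h.VC,
      h.CC]

end NullFrame

end PseudoIso

namespace PseudoIso

theorem continuous_pip {E : Type*} [TopologicalSpace E] {s m : ℕ} {f g : E → Vec m}
    (hf : Continuous f) (hg : Continuous g) : Continuous fun y => pip s m (f y) (g y) := by
  simp only [pip_apply]
  exact continuous_finsetSum _ fun i _ => (continuous_const.mul
    (continuous_pi_iff.1 hf i)).mul (continuous_pi_iff.1 hg i)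

namespace NullFrame

variable {q σ : ℝ} {X Y Z C : ℝ → Vec 5} {V n k : Vec 5} (h : NullFrame q σ X Y Z C V n k)
include h

theorem continuous_tubeInv (a : ℝ) : Continuous (tubeInv q σ a X Z V n k) := by
  have c : ∀ w : Vec 5, Continuous fun y => pip 2 5 w y := fun w => (pipL 2 w).continuous
  have h3 : Continuous fun y => -σ * pip 2 5 V y := continuous_const.mul (c V)
  have hP : Continuous fun y => -σ * q *
      (pip 2 5 n y + σ * (1 / a * (1 - rad σ a (-σ * pip 2 5 V y)))) := by
    have := (continuous_rad σ a).comp h3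
    exact continuous_const.mul ((c n).add
      (continuous_const.mul (continuous_const.mul (continuous_const.sub this))))
  have h0 : Continuous fun y => tubeInv q σ a X Z V n k y 0 := (hP.add (c k)).div_const 2
  refine continuous_pi fun i => ?_
  fin_cases i
  · exact h0
  · exact (continuous_const.mul (hP.sub (c k))).div_const 2
  · refine continuous_const.mul ?_
    have := (h.contDiff_Z.continuous.comp h0)
    have h5 := continuous_id.sub (h.contDiff_integral.continuous.comp h0)
    exact continuous_pip this h5
  · exact h3

theorem contDiffOn_tubeInv (a : ℝ) : ContDiffOn ℝ ∞ (tubeInv q σ a X Z V n k)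
    (tubeInv q σ a X Z V n k ⁻¹' tubeDomain q σ a) := by
  set U := tubeInv q σ a X Z V n k ⁻¹' tubeDomain q σ a
  have c : ∀ w : Vec 5, ContDiffOn ℝ ∞ (fun y => pip 2 5 w y) U := fun w =>
    (pipL 2 w).contDiff.contDiffOn
  have h3 : ContDiffOn ℝ ∞ (fun y => -σ * pip 2 5 V y) U := contDiffOn_const.mul (c V)
  have hP : ContDiffOn ℝ ∞ (fun y => -σ * q *
      (pip 2 5 n y + σ * (1 / a * (1 - rad σ a (-σ * pip 2 5 V y))))) U := by
    have := (contDiffOn_rad σ a).comp h3 fun y hy => hy.2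
    exact contDiffOn_const.mul ((c n).add
      (contDiffOn_const.mul (contDiffOn_const.mul (contDiffOn_const.sub this))))
  have h0 : ContDiffOn ℝ ∞ (fun y => tubeInv q σ a X Z V n k y 0) U :=
    (hP.add (c k)).div_const 2
  refine contDiffOn_pi.2 fun i => ?_
  fin_cases i
  · exact h0
  · exact (contDiffOn_const.mul (hP.sub (c k))).div_const 2
  · exact contDiffOn_const.mul (contDiffOn_pip (h.contDiff_Z.comp_contDiffOn h0)
      (contDiffOn_id.sub (h.contDiff_integral.comp_contDiffOn h0)))
  · exact h3

theorem contDiffOn_tubeEqn (a : ℝ) : ContDiffOn ℝ ∞ (tubeEqn q σ a X Z C V n k)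
    (tubeInv q σ a X Z V n k ⁻¹' tubeDomain q σ a) := by
  have h0 := contDiffOn_pi.1 (h.contDiffOn_tubeInv a) 0
  have h3 := contDiffOn_pi.1 (h.contDiffOn_tubeInv a) 3
  exact (contDiffOn_pip (h.contDiff_C.comp_contDiffOn h0)
      (contDiffOn_id.sub (h.contDiff_integral.comp_contDiffOn h0))).sub
    (contDiffOn_const.mul (contDiffOn_const.sub
      ((contDiffOn_rad σ a).comp h3 fun y hy => hy.2)))

theorem tubeEqn_add_smul (a : ℝ) (y : Vec 5) (t : ℝ) :
    tubeEqn q σ a X Z C V n k (y + t • n) = tubeEqn q σ a X Z C V n k y - t * σ := by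
  have hs : ∀ s, pip 2 5 (C s) (y + t • n - ∫ w in (0 : ℝ)..s, X w) =
      pip 2 5 (C s) (y - ∫ w in (0 : ℝ)..s, X w) - t * σ := by
    intro s
    simp [pip_comm 2 (C s) n, h.nC]
    ring
  have e : ∀ w : Vec 5, pip 2 5 w n = 0 → pip 2 5 w (y + t • n) = pip 2 5 w y := fun w hw => by
    simp [hw]
  simp only [tubeEqn, tubeInv, e V (by rw [pip_comm, h.nV]), e n h.nn, e k h.kn,
    Matrix.cons_val_zero, Matrix.cons_val, hs]
  ring

theorem isParametrizedExample {a : ℝ} (ha : 0 < a) {τ : PetrovType}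
    (hJG : IsPetrovForm τ !![0, 1, 0, 0; 0, 0, 1, 0; 0, 0, 0, 0; 0, 0, 0, a]
      !![0, 0, σ, 0; 0, σ, 0, 0; σ, 0, 0, 0; 0, 0, 0, -σ]) :
    IsParametrizedExample (tubeMap σ a X Y Z C V) (tubeDomain q σ a) (tubeNormal q σ a Y C V) 1 τ
      (tubeFrame q σ a (tubeMap σ a X Y Z C V))
      !![0, 1, 0, 0; 0, 0, 1, 0; 0, 0, 0, 0; 0, 0, 0, a] := by
  have hq := h.q_ne_zero
  have hσ := h.sign
  have hσ0 := h.sign_ne_zero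
  refine isParametrizedExample_of (isOpen_tubeDomain q σ a) ⟨![0, 0, σ * q, 0], ?_⟩
    (h.contDiffOn_tubeMap a) (h.contDiffOn_tubeNormal a)
    ((isOpen_tubeDomain q σ a).preimage (h.continuous_tubeInv a)) (h.contDiffOn_tubeInv a)
    (h.contDiffOn_tubeEqn a) ?_ (fun p hp => ⟨?_, h.tubeInv_tubeMap a p, h.tubeEqn_tubeMap a p⟩)
    (fun y hy hy0 => ⟨hy, h.tubeMap_tubeInv hy0⟩) ?_ ?_ ?_ hJG ?_
  · constructor
    · simpa [← two_mul] using ⟨hσ0, hq⟩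
    · simp [radSq]
  · intro y hy
    refine ⟨n, fun h0 => hσ0 ?_⟩
    have h1 : HasFDerivAt (tubeEqn q σ a X Z C V n k) (fderiv ℝ (tubeEqn q σ a X Z C V n k) y)
        (y + (0 : ℝ) • n) := by
      rw [zero_smul, add_zero]
      exact (((h.contDiffOn_tubeEqn a).contDiffAt (((isOpen_tubeDomain q σ a).preimage
        (h.continuous_tubeInv a)).mem_nhds hy)).differentiableAt (by simp)).hasFDerivAt
    have h2 : HasDerivAt (fun t : ℝ => y + t • n) n 0 := by
      simpa using ((hasDerivAt_id (0 : ℝ)).smul_const n).const_add y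
    have h3 := h1.comp_hasDerivAt 0 h2
    rw [h0] at h3
    have h4 : HasDerivAt (fun t : ℝ => tubeEqn q σ a X Z C V n k (y + t • n)) (-σ) 0 := by
      simp only [h.tubeEqn_add_smul]
      simpa using ((hasDerivAt_id (0 : ℝ)).mul_const σ).const_sub (tubeEqn q σ a X Z C V n k y)
    have := h3.unique h4
    linarith
  · show tubeInv q σ a X Z V n k (tubeMap σ a X Y Z C V p) ∈ tubeDomain q σ a
    rwa [h.tubeInv_tubeMap]
  · intro p hp
    have := rad_sq hp.2
    rw [radSq] at this
    simp [tubeNormal, h.YY, h.YV, h.YC, h.VV, h.VC, h.CC, pip_comm 2 V (Y (p 0)),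
      pip_comm 2 (C (p 0)) (Y (p 0)), pip_comm 2 (C (p 0)) V]
    linear_combination this
  · intro p hp j
    have ht : p 2 + σ * q ≠ 0 := hp.1
    have ht' : p 2 + q * σ ≠ 0 := by rwa [mul_comm q σ]
    have hρ : rad σ a (p 3) ≠ 0 := (rad_pos hp.2).ne'
    rw [h.tubeFrame_apply ha.ne' hp.2]
    fin_cases j <;>
      simp [tubeNormal, h.YY, h.YV, h.YC, h.VV, h.VC, h.CC, h.XY, h.XZ, h.XV, h.XC, h.YZ, h.ZV,
        h.ZC, pip_comm 2 V (Y (p 0)), pip_comm 2 (C (p 0)) (Y (p 0)), pip_comm 2 (C (p 0)) V,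
        pip_comm 2 (Y (p 0)) (X (p 0)), pip_comm 2 V (X (p 0)), pip_comm 2 (C (p 0)) (X (p 0)), pip_comm 2 V (Z (p 0)),
        pip_comm 2 (C (p 0)) (Z (p 0)), pip_comm 2 (Y (p 0)) n, pip_comm 2 V n, pip_comm 2 (C (p 0)) n, h.nY,
        h.nV, h.nC]
    · generalize (p 2 + σ * q) ^ 3 / (2 * q * radSq σ a (p 3)) = g
      field_simp
      ring
    · field_simp
      ring
  · intro p hp
    have ht : p 2 + σ * q ≠ 0 := hp.1
    have ht' : p 2 + q * σ ≠ 0 := by rwa [mul_comm q σ]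
    have hρ : rad σ a (p 3) ≠ 0 := (rad_pos hp.2).ne'
    have hR := rad_sq hp.2
    refine ⟨![ev 1, ((p 2 + σ * q) ^ 2 / (2 * rad σ a (p 3))) • ev 2,
      (-(σ * ((p 2 + σ * q) ^ 3 / (2 * q * radSq σ a (p 3))))) • ev 0,
      (q * a * p 2 * p 3 / ((p 2 + σ * q) * rad σ a (p 3))) • ev 1 + ev 3], fun j => ⟨?_, ?_⟩⟩
    · fin_cases j <;> simp [tubeFrame, partialD]
    · rw [h.tubeFrame_apply ha.ne' hp.2]
      fin_cases j <;> simp [h.fderiv_tubeNormal hp, Fin.sum_univ_four, ← hR]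
      · match_scalars
        field_simp
      · match_scalars
        field_simp
        linear_combination hσ
      · match_scalars <;> field_simp
        linear_combination (p 2 * p 3) * hσ
  · intro p hp
    obtain ⟨m, l, hml⟩ := h.exists_gram_tubeFrame ha.ne' hp
    rw [hml]
    have hρ : rad σ a (p 3) ≠ 0 := (rad_pos hp.2).ne'
    exact exists_normalizing_matrix_three hσ
      (div_ne_zero (pow_ne_zero 2 hp.1) (mul_ne_zero two_ne_zero hρ)) hρ a m l

end NullFrame

end PseudoIso

namespace PseudoIso

theorem hasDerivAt_quadratic_curve {m : ℕ} (A B C : Vec m) (s : ℝ) :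
    HasDerivAt (fun s : ℝ => A + s • B + s ^ 2 • C) (B + (2 * s) • C) s := by
  have := (((hasDerivAt_id s).smul_const B).const_add A).add
    (((hasDerivAt_id s).pow 2).smul_const C)
  convert! this using 1
  simp

theorem contDiff_quadratic_curve {m : ℕ} (A B C : Vec m) :
    ContDiff ℝ ∞ (fun s : ℝ => A + s • B + s ^ 2 • C) := by
  fun_prop

theorem XK_eq : XK = fun s => ![√2 * 6 / 8 + 1 / 2, √2 / 2, √2 * 6 / 8 - √2 + 1 / 2, 0,
    1 + √2 / 2] + s • ![0, 0, 0, -(√2 / 2), 0] + s ^ 2 • ![√2 / 8, 0, √2 / 8, 0, 0] := by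
  ext s i
  fin_cases i <;> simp [XK] <;> ring

theorem YK_eq : YK = fun s => ![√2 * 6 / 8 - 1 / 2, √2 / 2, √2 * 6 / 8 - √2 - 1 / 2, 0,
    1 - √2 / 2] + s • ![0, 0, 0, -(√2 / 2), 0] + s ^ 2 • ![√2 / 8, 0, √2 / 8, 0, 0] := by
  ext s i
  fin_cases i <;> simp [YK] <;> ring

theorem ZK_eq : ZK = fun s => ![0, 0, 0, -1, 0] + s • ![1 / 2, 0, 1 / 2, 0, 0] +
    s ^ 2 • ![0, 0, 0, 0, 0] := by
  ext s i
  fin_cases i <;> simp [ZK] <;> ring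

theorem CK_eq : CK = fun s => ![1, 1, -1, 0, √2] + s • ![0, 0, 0, -1, 0] +
    s ^ 2 • ![1 / 4, 0, 1 / 4, 0, 0] := by
  ext s i
  fin_cases i <;> simp [CK] <;> ring

theorem nullFrame_K : NullFrame (√2) 1 XK YK ZK CK VK ![1 / 2, 0, 1 / 2, 0, 0]
    ![1, 0, 1, 0, √2] := by
  have hq : √2 * √2 = (2 : ℝ) := Real.mul_self_sqrt (by norm_num)
  have hq0 : √2 ≠ (0 : ℝ) := by positivity
  constructor
  · exact hq
  · norm_num
  · rw [XK_eq]; exact contDiff_quadratic_curve _ _ _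
  · rw [YK_eq]; exact contDiff_quadratic_curve _ _ _
  · rw [ZK_eq]; exact contDiff_quadratic_curve _ _ _
  · rw [CK_eq]; exact contDiff_quadratic_curve _ _ _
  · intro s
    rw [YK_eq]
    convert! hasDerivAt_quadratic_curve _ _ _ s using 1
    ext i
    fin_cases i <;> simp [ZK] <;> ring
  · intro s
    rw [ZK_eq]
    convert! hasDerivAt_quadratic_curve _ _ _ s using 1
    ext i
    fin_cases i <;> simp
  · intro s
    rw [CK_eq]
    convert! hasDerivAt_quadratic_curve _ _ _ s using 1
    ext i
    fin_cases i <;> simp [ZK] <;> ring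
  · intro s
    simp only [XK, YK, CK]
    generalize √2 = q at *
    ext i
    fin_cases i <;> simp <;> field_simp <;> grind
  · intro s
    ext i
    fin_cases i <;> simp [XK, YK] <;> ring
  case eq_zero =>
    intro s w h1 h2 h3 h4 h5
    simp [pip_two_five, ZK, VK, CK] at h1 h2 h3 h4 h5
    have e2 : w 2 = w 0 := by linarith
    have e1 : w 1 = 0 := by linear_combination h4 - h1
    have e3 : w 3 = 0 := by linear_combination -h3 + s * h1
    have e4 : w 4 = 0 := by
      have : √2 * w 4 = 0 := by linear_combination h2 - e2
      exact (mul_eq_zero.1 this).resolve_left hq0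
    have e0 : w 0 = 0 := by
      rw [e2, e1, e3, e4] at h5
      linear_combination -h5 / 2
    ext i
    fin_cases i <;> simp [e0, e1, e2, e3, e4]
  all_goals intros
  all_goals simp only [XK, YK, ZK, CK, VK] at *
  all_goals generalize √2 = q at *
  all_goals simp [pip_two_five] at *
  all_goals grind

theorem XL_eq : XL = fun s => ![√2 * 2 / 8 - √2, 0, √2 * 2 / 8, √2 / 2, √2 / 2] +
    s • ![0, √2 / 2, 0, 0, 0] + s ^ 2 • ![√2 / 8, 0, √2 / 8, 0, 0] := by
  ext s i
  fin_cases i <;> simp [XL] <;> ring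

theorem YL_eq : YL = fun s => ![-(√2 * 2 / 8) + √2, 0, -(√2 * 2 / 8), -(√2 / 2), √2 / 2] +
    s • ![0, -(√2 / 2), 0, 0, 0] + s ^ 2 • ![-(√2 / 8), 0, -(√2 / 8), 0, 0] := by
  ext s i
  fin_cases i <;> simp [YL] <;> ring

theorem ZL_eq : ZL = fun s => ![0, 1, 0, 0, 0] + s • ![1 / 2, 0, 1 / 2, 0, 0] +
    s ^ 2 • ![0, 0, 0, 0, 0] := by
  ext s i
  fin_cases i <;> simp [ZL] <;> ring

theorem CL_eq : CL = fun s => ![-1, 0, 1, 1, 0] + s • ![0, 1, 0, 0, 0] +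
    s ^ 2 • ![1 / 4, 0, 1 / 4, 0, 0] := by
  ext s i
  fin_cases i <;> simp [CL] <;> ring

theorem nullFrame_L : NullFrame (√2) (-1) XL YL ZL CL VL ![1 / 2, 0, 1 / 2, 0, 0]
    ![0, 0, 0, 0, √2] := by
  have hq : √2 * √2 = (2 : ℝ) := Real.mul_self_sqrt (by norm_num)
  have hq0 : √2 ≠ (0 : ℝ) := by positivity
  constructor
  · exact hq
  · norm_num
  · rw [XL_eq]; exact contDiff_quadratic_curve _ _ _
  · rw [YL_eq]; exact contDiff_quadratic_curve _ _ _
  · rw [ZL_eq]; exact contDiff_quadratic_curve _ _ _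
  · rw [CL_eq]; exact contDiff_quadratic_curve _ _ _
  · intro s
    rw [YL_eq]
    convert! hasDerivAt_quadratic_curve _ _ _ s using 1
    ext i
    fin_cases i <;> simp [ZL] <;> ring
  · intro s
    rw [ZL_eq]
    convert! hasDerivAt_quadratic_curve _ _ _ s using 1
    ext i
    fin_cases i <;> simp
  · intro s
    rw [CL_eq]
    convert! hasDerivAt_quadratic_curve _ _ _ s using 1
    ext i
    fin_cases i <;> simp [ZL] <;> ring
  · intro s
    simp only [XL, YL, CL]
    generalize √2 = q at *
    ext i
    fin_cases i <;> simp <;> field_simp <;> grind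
  · intro s
    ext i
    fin_cases i <;> simp [XL, YL] <;> ring
  case eq_zero =>
    intro s w h1 h2 h3 h4 h5
    simp [pip_two_five, ZL, VL, CL] at h1 h2 h3 h4 h5
    have e2 : w 2 = w 0 := by linarith
    have e1 : w 1 = 0 := by linear_combination -h3 + s * h1
    have e3 : w 3 = 0 := by linear_combination h1 - h4
    have e4 : w 4 = 0 := by simpa [hq0] using h2
    have e0 : w 0 = 0 := by
      rw [e2, e1, e3] at h5
      linear_combination h5 / 2
    ext i
    fin_cases i <;> simp [e0, e1, e2, e3, e4]
  all_goals intros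
  all_goals simp only [XL, YL, ZL, CL, VL] at *
  all_goals generalize √2 = q at *
  all_goals simp [pip_two_five] at *
  all_goals grind

theorem radSq_one (a v : ℝ) : radSq 1 a v = 1 + a ^ 2 * v ^ 2 := by
  simp [radSq]

theorem radSq_neg_one (a v : ℝ) : radSq (-1) a v = 1 - a ^ 2 * v ^ 2 := by
  simp [radSq, sub_eq_add_neg]

theorem radSq_one_pos (a v : ℝ) : 0 < radSq 1 a v := by
  rw [radSq_one]
  positivity

theorem fK_eq (a : ℝ) : fK a = tubeMap 1 a XK YK ZK CK VK := by
  ext1 p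
  simp only [fK, tubeMap, rad, radSq_one]

theorem frameK_eq (a : ℝ) : frameK a = tubeFrame (√2) 1 a (fK a) := by
  ext1 p
  simp only [frameK, tubeFrame, rad, radSq_one, one_mul]

theorem domK_eq (a : ℝ) : domK = tubeDomain (√2) 1 a := by
  ext p
  simp [domK, tubeDomain, radSq_one_pos]

theorem normalK_eq (a : ℝ) : normalK a = tubeNormal (√2) 1 a YK CK VK := by
  ext1 p
  simp only [normalK, tubeNormal, rad, radSq_one, one_mul]

theorem example_k (a : ℝ) (ha : 0 < a) :
    IsParametrizedExample (fK a) domK (normalK a) 1 .VIIii (frameK a)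
        !![0, 1, 0, 0; 0, 0, 1, 0; 0, 0, 0, 0; 0, 0, 0, a] ∧
      ∀ p ∈ domK, pip 2 5 (frameK a p 0) (frameK a p 3) = 0 ∧
        pip 2 5 (frameK a p 1) (frameK a p 3) = 0 ∧
        pip 2 5 (frameK a p 2) (frameK a p 3) = 0 ∧
        pip 2 5 (frameK a p 3) (frameK a p 3) = -(1 / (1 + a ^ 2 * p 3 ^ 2)) ∧
        -(1 / (1 + a ^ 2 * p 3 ^ 2)) < 0 := by
  rw [frameK_eq, fK_eq, domK_eq a, normalK_eq]
  refine ⟨nullFrame_K.isParametrizedExample ha ⟨0, a, rfl, rfl⟩, fun p hp => ?_⟩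
  obtain ⟨m, l, h⟩ := nullFrame_K.exists_gram_tubeFrame ha.ne' hp
  have hg : ∀ i j, pip 2 5 (tubeFrame (√2) 1 a (tubeMap 1 a XK YK ZK CK VK) p i)
      (tubeFrame (√2) 1 a (tubeMap 1 a XK YK ZK CK VK) p j) = _ := fun i j =>
    congrFun (congrFun h i) j
  refine ⟨hg 0 3, hg 1 3, hg 2 3, (hg 3 3).trans ?_, ?_⟩
  · show -1 / rad 1 a (p 3) ^ 2 = _
    rw [rad_sq hp.2, radSq_one]
    ring
  · have : 0 < 1 / (1 + a ^ 2 * p 3 ^ 2) := by positivity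
    linarith

theorem fL_eq (a : ℝ) : fL a = tubeMap (-1) a XL YL ZL CL VL := by
  ext1 p
  simp only [fL, tubeMap, rad, radSq_neg_one]

theorem frameL_eq (a : ℝ) : frameL a = tubeFrame (√2) (-1) a (fL a) := by
  ext1 p
  simp only [frameL, tubeFrame, rad, radSq_neg_one, neg_mul, one_mul, neg_neg, sub_eq_add_neg]

theorem domL_eq {a : ℝ} (ha : 0 < a) : domL a = tubeDomain (√2) (-1) a := by
  ext p
  have h : p 3 ∈ Set.Ioo (-(1 / a)) (1 / a) ↔ 0 < radSq (-1) a (p 3) := by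
    rw [radSq_neg_one, Set.mem_Ioo, ← abs_lt, lt_div_iff₀ ha, sub_pos, ← mul_pow, sq_lt_one_iff_abs_lt_one,
      abs_mul, abs_of_pos ha, mul_comm]
  simp only [domL, tubeDomain, Set.mem_ofPred_eq, h, neg_mul, one_mul, sub_eq_add_neg]

theorem normalL_eq (a : ℝ) : normalL a = tubeNormal (√2) (-1) a YL CL VL := by
  ext1 p
  simp only [normalL, tubeNormal, rad, radSq_neg_one, neg_mul, one_mul, neg_neg, sub_eq_add_neg]

theorem example_l (a : ℝ) (ha : 0 < a) :
    IsParametrizedExample (fL a) (domL a) (normalL a) 1 .VIIi (frameL a)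
        !![0, 1, 0, 0; 0, 0, 1, 0; 0, 0, 0, 0; 0, 0, 0, a] ∧
      ∀ p ∈ domL a, pip 2 5 (frameL a p 0) (frameL a p 3) = 0 ∧
        pip 2 5 (frameL a p 1) (frameL a p 3) = 0 ∧
        pip 2 5 (frameL a p 2) (frameL a p 3) = 0 ∧
        pip 2 5 (frameL a p 3) (frameL a p 3) = 1 / (1 - a ^ 2 * p 3 ^ 2) ∧
        0 < 1 / (1 - a ^ 2 * p 3 ^ 2) := by
  rw [frameL_eq, fL_eq, domL_eq ha, normalL_eq]
  refine ⟨nullFrame_L.isParametrizedExample ha ⟨0, a, rfl, by simp⟩, fun p hp => ?_⟩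
  obtain ⟨m, l, h⟩ := nullFrame_L.exists_gram_tubeFrame ha.ne' hp
  have hg : ∀ i j, pip 2 5 (tubeFrame (√2) (-1) a (tubeMap (-1) a XL YL ZL CL VL) p i)
      (tubeFrame (√2) (-1) a (tubeMap (-1) a XL YL ZL CL VL) p j) = _ := fun i j =>
    congrFun (congrFun h i) j
  have hR := hp.2
  rw [radSq_neg_one] at hR
  refine ⟨hg 0 3, hg 1 3, hg 2 3, (hg 3 3).trans ?_, by positivity⟩
  show -(-1) / rad (-1) a (p 3) ^ 2 = _
  rw [rad_sq hp.2, radSq_neg_one, neg_neg]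

end PseudoIso

namespace PseudoIso

/-- A frame whose Gram matrix is antitriangular and Hankel can be normalized by a matrix that
commutes with the nilpotent Jordan block. -/
theorem exists_normalizing_matrix_four (a b c : ℝ) : ∃ S : Matrix (Fin 4) (Fin 4) ℝ,
    Sᵀ * !![0, 0, 0, -1; 0, 0, -1, a; 0, -1, a, b; -1, a, b, c] * S =
      !![0, 0, 0, -1; 0, 0, -1, 0; 0, -1, 0, 0; -1, 0, 0, 0] ∧
    !![0, 1, 0, 0; 0, 0, 1, 0; 0, 0, 0, 1; 0, 0, 0, 0] * S =
      S * !![0, 1, 0, 0; 0, 0, 1, 0; 0, 0, 0, 1; 0, 0, 0, 0] := by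
  obtain ⟨l, hl⟩ : ∃ l, l = a / 2 := ⟨_, rfl⟩
  obtain ⟨m, hm⟩ : ∃ m, m = (a ^ 2 + b - l ^ 2) / 2 := ⟨_, rfl⟩
  obtain ⟨n, hn⟩ : ∃ n, n = (a ^ 3 + 2 * a * b + c - 2 * l * m) / 2 := ⟨_, rfl⟩
  refine ⟨!![1, l, m, n; 0, 1, l, m; 0, 0, 1, l; 0, 0, 0, 1], ?_, ?_⟩
  · ext i j
    fin_cases i <;> fin_cases j <;> simp [Matrix.mul_apply, Fin.sum_univ_four] <;>
      simp only [hn, hm, hl] <;> ring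
  · ext i j
    fin_cases i <;> fin_cases j <;> simp [Matrix.mul_apply, Fin.sum_univ_four]

theorem hasDerivAt_WM (u : ℝ) : HasDerivAt WM ![u, 0, u, 1, 0] u := by
  have hW : WM = fun s => ![1 / 2, 0, -1 / 2, 0, 0] + s • ![0, 0, 0, 1, 0] +
      s ^ 2 • ![1 / 2, 0, 1 / 2, 0, 0] := by
    ext s i
    fin_cases i <;> simp [WM] <;> ring
  rw [hW]
  convert! hasDerivAt_quadratic_curve _ _ _ u using 1
  ext i
  fin_cases i <;> simp <;> ring

theorem hasDerivAt_CM (u : ℝ) : HasDerivAt CM ![-1, 0, -1, 0, 0] u := by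
  have hC : CM = fun s => ![0, 1, 0, -1, -1] + s • ![-1, 0, -1, 0, 0] + s ^ 2 • 0 := by
    ext s i
    fin_cases i <;> simp [CM]
  rw [hC]
  convert! hasDerivAt_quadratic_curve _ _ _ u using 1
  ext i
  fin_cases i <;> simp

theorem hasDerivAt_primitive_YM (u : ℝ) :
    HasDerivAt (fun u : ℝ => ![u ^ 2 / 2, -u, u ^ 2 / 2, u, 0]) (YM u) u := by
  have h : (fun u : ℝ => (![u ^ 2 / 2, -u, u ^ 2 / 2, u, 0] : Vec 5)) =
      fun s => 0 + s • ![0, -1, 0, 1, 0] + s ^ 2 • ![1 / 2, 0, 1 / 2, 0, 0] := by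
    ext s i
    fin_cases i <;> simp <;> ring
  rw [h]
  convert! hasDerivAt_quadratic_curve _ _ _ u using 1
  ext i
  fin_cases i <;> simp [YM] <;> ring

theorem fM_eq : fM = fun p => p 0 • XM + p 1 • WM (p 3) + p 2 • ZM - (p 2 ^ 2 / 2) • CM (p 3) +
    ![p 3 ^ 2 / 2, -p 3, p 3 ^ 2 / 2, p 3, 0] := by
  ext1 p
  have hY : Continuous YM := by
    refine continuous_pi fun i => ?_
    fin_cases i <;> simp [YM] <;> fun_prop
  have h := intervalIntegral.integral_eq_sub_of_hasDerivAt (a := 0) (b := p 3)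
    (fun u _ => hasDerivAt_primitive_YM u) (hY.intervalIntegrable _ _)
  rw [fM, h, intervalIntegral.integral_const, sub_zero]
  congr 1
  ext i
  fin_cases i <;> simp

theorem fM_apply (p : Vec 4) : fM p =
    ![p 1 * (p 3 ^ 2 + 1) / 2 + p 2 + p 2 ^ 2 / 2 * p 3 + p 3 ^ 2 / 2,
      -p 0 - p 2 ^ 2 / 2 - p 3,
      p 1 * (p 3 ^ 2 - 1) / 2 + p 2 + p 2 ^ 2 / 2 * p 3 + p 3 ^ 2 / 2,
      p 1 * p 3 + p 2 ^ 2 / 2 + p 3,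
      p 0 + p 2 ^ 2 / 2] := by
  rw [fM_eq]
  ext i
  fin_cases i <;> simp [XM, WM, ZM, CM] <;> ring

theorem contDiff_fM : ContDiff ℝ ∞ fM := by
  refine contDiff_pi.2 fun i => ?_
  simp only [fM_apply]
  fin_cases i <;> simp <;> fun_prop

theorem contDiff_normalM : ContDiff ℝ ∞ normalM := by
  refine contDiff_pi.2 fun i => ?_
  fin_cases i <;> simp [normalM, XM, WM, CM] <;> fun_prop

theorem fderiv_fM (p c : Vec 4) : fderiv ℝ fM p c =
    c 0 • XM + c 1 • WM (p 3) + c 2 • (ZM - p 2 • CM (p 3)) +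
      c 3 • (p 1 • ![p 3, 0, p 3, 1, 0] - (p 2 ^ 2 / 2) • ![-1, 0, -1, 0, 0] + YM (p 3)) := by
  have e : ∀ i : Fin 4, HasFDerivAt (fun q : Vec 4 => q i)
      (ContinuousLinearMap.proj (R := ℝ) (φ := fun _ : Fin 4 => ℝ) i) p := fun i =>
    hasFDerivAt_apply i p
  have hW' := hasDerivAt_WM (p 3)
  have hC' := hasDerivAt_CM (p 3)
  generalize (![p 3, 0, p 3, 1, 0] : Vec 5) = W' at *
  generalize (![-1, 0, -1, 0, 0] : Vec 5) = C' at *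
  have hW : HasFDerivAt (fun q : Vec 4 => WM (q 3)) _ p := hasFDerivAt_comp_coord hW'
  have hC : HasFDerivAt (fun q : Vec 4 => CM (q 3)) _ p := hasFDerivAt_comp_coord hC'
  have hY : HasFDerivAt (fun q : Vec 4 => (![q 3 ^ 2 / 2, -q 3, q 3 ^ 2 / 2, q 3, 0] : Vec 5)) _ p :=
    hasFDerivAt_comp_coord (hasDerivAt_primitive_YM (p 3))
  have hz : HasFDerivAt (fun q : Vec 4 => q 2 ^ 2 / 2) _ p :=
    hasFDerivAt_comp_coord (A := fun z : ℝ => z ^ 2 / 2) (((hasDerivAt_id (p 2)).pow 2).div_const 2)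
  have := (((((e 0).smul_const XM).add ((e 1).smul hW)).add ((e 2).smul_const ZM)).sub
    (hz.smul hC)).add hY
  have h2 := this.congr_of_eventuallyEq (f₁ := fM) (.of_eq fM_eq)
  rw [h2.fderiv]
  simp
  module

theorem fderiv_normalM (p c : Vec 4) : fderiv ℝ normalM p c =
    (-c 1 + c 2 * (3 * p 2 ^ 2 / 2)) • XM - c 2 • WM (p 3) +
      c 3 • (-(p 2 • ![p 3, 0, p 3, 1, 0]) + ![-1, 0, -1, 0, 0]) := by
  have e : ∀ i : Fin 4, HasFDerivAt (fun q : Vec 4 => q i)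
      (ContinuousLinearMap.proj (R := ℝ) (φ := fun _ : Fin 4 => ℝ) i) p := fun i =>
    hasFDerivAt_apply i p
  have hW' := hasDerivAt_WM (p 3)
  have hC' := hasDerivAt_CM (p 3)
  generalize (![p 3, 0, p 3, 1, 0] : Vec 5) = W' at *
  generalize (![-1, 0, -1, 0, 0] : Vec 5) = C' at *
  have hW : HasFDerivAt (fun q : Vec 4 => WM (q 3)) _ p := hasFDerivAt_comp_coord hW'
  have hC : HasFDerivAt (fun q : Vec 4 => CM (q 3)) _ p := hasFDerivAt_comp_coord hC'
  have hz : HasFDerivAt (fun q : Vec 4 => q 2 ^ 3 / 2) _ p :=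
    hasFDerivAt_comp_coord (A := fun z : ℝ => z ^ 3 / 2) (((hasDerivAt_id (p 2)).pow 3).div_const 2)
  have := ((((e 1).neg.add hz).smul_const XM).sub ((e 2).smul hW)).add hC
  have h2 : HasFDerivAt normalM _ p := this
  rw [h2.fderiv]
  simp
  module

theorem frameM_apply (p : Vec 4) : frameM p =
    ![XM, WM (p 3), (3 * p 2 ^ 2 / 2) • WM (p 3) + (ZM - p 2 • CM (p 3)),
      (9 * p 2 ^ 4 / 4 + p 2) • WM (p 3) + (3 * p 2 ^ 2 / 2) • (ZM - p 2 • CM (p 3)) +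
        (p 1 • ![p 3, 0, p 3, 1, 0] - (p 2 ^ 2 / 2) • ![-1, 0, -1, 0, 0] + YM (p 3))] := by
  ext1 i
  fin_cases i <;> simp [frameM, partialD, fderiv_fM]

theorem exists_gram_frameM (p : Vec 4) : ∃ a b c,
    gram 2 (frameM p) = !![0, 0, 0, -1; 0, 0, -1, a; 0, -1, a, b; -1, a, b, c] := by
  refine ⟨pip 2 5 (frameM p 1) (frameM p 3), pip 2 5 (frameM p 2) (frameM p 3),
    pip 2 5 (frameM p 3) (frameM p 3), ?_⟩
  ext i j
  rw [frameM_apply]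
  fin_cases i <;> fin_cases j <;> simp only [gram, Matrix.of_apply] <;>
    first
    | rfl
    | (simp [pip_two_five, XM, WM, ZM, CM, YM] <;> ring)

noncomputable def heightM (y : Vec 5) : ℝ := y 3 + (y 0 - y 2 + 1) * (y 1 + y 4)

noncomputable def coordM (y : Vec 5) : ℝ :=
  y 0 - (y 0 - y 2) * ((y 1 + y 4) ^ 2 + 1) / 2 + (y 1 + y 4) * heightM y - (y 1 + y 4) ^ 2 / 2

noncomputable def invM (y : Vec 5) : Vec 4 :=
  ![y 4 - coordM y ^ 2 / 2, y 0 - y 2, coordM y, -(y 1 + y 4)]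

noncomputable def eqnM (y : Vec 5) : ℝ := coordM y ^ 2 / 2 - heightM y

theorem contDiff_invM : ContDiff ℝ ∞ invM := by
  refine contDiff_pi.2 fun i => ?_
  fin_cases i <;> simp [invM, coordM, heightM] <;> fun_prop

theorem contDiff_eqnM : ContDiff ℝ ∞ eqnM := by
  unfold eqnM coordM heightM
  fun_prop

theorem eqnM_add_smul (y : Vec 5) (t : ℝ) :
    eqnM (y + t • ![-(y 1 + y 4), 0, -(y 1 + y 4), 1, 0]) = eqnM y - t := by
  simp [eqnM, coordM, heightM]
  ring

theorem heightM_fM (p : Vec 4) : heightM (fM p) = p 2 ^ 2 / 2 := by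
  simp [heightM, fM_apply]
  ring

theorem coordM_fM (p : Vec 4) : coordM (fM p) = p 2 := by
  rw [coordM, heightM_fM]
  simp [fM_apply]
  ring

theorem invM_fM (p : Vec 4) : invM (fM p) = p := by
  ext i
  fin_cases i <;> simp [invM, coordM_fM] <;> simp [fM_apply] <;> ring

theorem fM_invM {y : Vec 5} (hy : eqnM y = 0) : fM (invM y) = y := by
  have h : coordM y ^ 2 / 2 = heightM y := by
    rw [eqnM] at hy
    linarith
  have hc : coordM y = y 0 - (y 0 - y 2) * ((y 1 + y 4) ^ 2 + 1) / 2 +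
    (y 1 + y 4) * heightM y - (y 1 + y 4) ^ 2 / 2 := rfl
  have hh : heightM y = y 3 + (y 0 - y 2 + 1) * (y 1 + y 4) := rfl
  rw [fM_apply, invM]
  ext i
  fin_cases i <;> simp [h]
  · linear_combination hc
  · linear_combination hc
  · linear_combination hh

theorem example_m :
    IsParametrizedExample fM Set.univ normalM 1 .VI frameM
        !![0, 1, 0, 0; 0, 0, 1, 0; 0, 0, 0, 1; 0, 0, 0, 0] ∧
      IsConnected (fM '' Set.univ) := by
  refine ⟨?_, isConnected_univ.image _ contDiff_fM.continuous.continuousOn⟩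
  refine isParametrizedExample_of isOpen_univ Set.univ_nonempty contDiff_fM.contDiffOn
    contDiff_normalM.contDiffOn isOpen_univ contDiff_invM.contDiffOn contDiff_eqnM.contDiffOn ?_
    (fun p _ => ⟨Set.mem_univ _, invM_fM p, ?_⟩)
    (fun y _ hy => ⟨Set.mem_univ _, fM_invM hy⟩) ?_ ?_ ?_ ⟨0, -1, Or.inr rfl, rfl, rfl⟩ ?_
  · intro y _
    refine ⟨![-(y 1 + y 4), 0, -(y 1 + y 4), 1, 0], fun h0 => ?_⟩
    have h1 : HasDerivAt (fun t : ℝ => eqnM (y + t • ![-(y 1 + y 4), 0, -(y 1 + y 4), 1, 0]))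
        (fderiv ℝ eqnM y ![-(y 1 + y 4), 0, -(y 1 + y 4), 1, 0]) 0 :=
      ((contDiff_eqnM.differentiable (by simp)) y).hasFDerivAt.hasLineDerivAt _
    simp only [eqnM_add_smul, h0] at h1
    have := h1.unique ((hasDerivAt_id (0 : ℝ)).const_sub (eqnM y))
    norm_num at this
  · rw [eqnM, coordM_fM, heightM_fM, sub_self]
  · intro p _
    simp [pip_two_five, normalM, XM, WM, CM]
    ring
  · intro p _ j
    rw [frameM_apply]
    fin_cases j <;> simp [pip_two_five, normalM, XM, WM, CM, ZM, YM] <;> ring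
  · intro p _
    refine ⟨![ev 0, ev 1, (3 * p 2 ^ 2 / 2) • ev 1 + ev 2,
      (9 * p 2 ^ 4 / 4 + p 2) • ev 1 + (3 * p 2 ^ 2 / 2) • ev 2 + ev 3], fun j => ⟨?_, ?_⟩⟩
    · fin_cases j <;> simp [frameM, partialD]
    · rw [frameM_apply]
      fin_cases j <;> simp [fderiv_normalM, Fin.sum_univ_four]
      ext i
      fin_cases i <;> simp [XM, WM, CM, ZM] <;> ring
  · intro p _
    obtain ⟨a, b, c, h⟩ := exists_gram_frameM p
    rw [h]
    exact exists_normalizing_matrix_four a b c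

end PseudoIso

theorem mainTheorem11 :
    -- (a)
    (IsFlatQuadricExample (-1) 0 (-1) (ev 2) 1 .XI (fun M ξ =>
        M = spaceForm .sphere 2 5 ∧
        ∀ x ∈ M, IsShapeOperatorAt .flat 2 M ξ x LinearMap.id) ∧
      levelSet .flat 2 (fun x : Vec 5 => pip 2 5 ((-1 : Matrix (Fin 5) (Fin 5) ℝ) *ᵥ x) x
        + 2 * pip 2 5 0 x) (-1) = spaceForm .sphere 2 5) ∧
    -- (b)
    IsFlatQuadricExample PB (ev 2) 1 (ev 0) 1 .X (fun M ξ => ∀ x ∈ M,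
      HasShapeMatrix .flat 2 M ξ x (frameB x)
        !![0, 1, 0, 0; 0, 0, 0, 0; 0, 0, 0, 0; 0, 0, 0, 0]) ∧
    -- (c)
    IsFlatQuadricExample PC (ev 3) 1 ((1 / 2 : ℝ) • ev 3) 1 .IXii (fun M ξ => ∀ x ∈ M,
      HasShapeMatrix .flat 2 M ξ x (frameC x)
        !![0, 1, 0, 0; 0, 0, 0, 0; 0, 0, 0, 1; 0, 0, 0, 0] ∧
      gram 2 (frameC x) = !![0, 1, 0, 0; 1, 0, 0, 0; 0, 0, 0, -1; 0, 0, -1, 0]) ∧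
    -- (d)
    IsFlatQuadricExample PD (ev 3) 1 ((1 / 2 : ℝ) • ev 3) 1 .IXi (fun M ξ => ∀ x ∈ M,
      HasShapeMatrix .flat 2 M ξ x (frameD x)
        !![0, 1, 0, 0; 0, 0, 0, 0; 0, 0, 0, 1; 0, 0, 0, 0] ∧
      gram 2 (frameD x) = !![0, 1, 0, 0; 1, 0, 0, 0; 0, 0, 0, 1; 0, 0, 1, 0]) ∧
    -- (e)
    IsSphereQuadricExample 2 PE (Polynomial.X ^ 2 - 1) 0 (ev 5) 1 .XI (fun M ξ => ∀ x ∈ M,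
      ∃ A : Module.End ℝ (tangentAt M x), IsShapeOperatorAt .sphere 2 M ξ x A ∧
        IsDiagonalizable A ∧ principalCurvatures A = {-1, -1, 1, 1}) ∧
    -- (f)
    IsSphereQuadricExample 3 PF (Polynomial.X ^ 2 - 1) 3
      ((-(1 / √2)) • ev 0 + (1 / √2) • ev 2 + √2 • ev 4) (-1) .XI (fun M ξ => ∀ x ∈ M,
      ∃ A : Module.End ℝ (tangentAt M x), IsShapeOperatorAt .sphere 3 M ξ x A ∧
        IsDiagonalizable A ∧ principalCurvatures A =
          {((1 / √2 : ℝ) : ℂ), ((1 / √2 : ℝ) : ℂ), ((1 / √2 : ℝ) : ℂ), ((√2 : ℝ) : ℂ)}) ∧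
    -- (g)
    IsSphereQuadricExample 3 PG (Polynomial.X ^ 2) 1 ((1 / √2) • ev 3 + (1 / √2) • ev 5) (-1) .X
      (fun M ξ => ∀ x ∈ M, x 0 + x 3 ≠ 0 → -x 2 + x 5 ≠ 0 →
        (∀ i, vecG x i ∈ tangentAt M x) ∧
        HasShapeMatrix .sphere 3 M ξ x (frameG x)
          !![1, 1, 0, 0; 0, 1, 0, 0; 0, 0, 1, 0; 0, 0, 0, 1]) ∧
    -- (h)
    IsSphereQuadricExample 3 PH (Polynomial.X ^ 2) (-1) (ev 4) (-1) .IXii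
      (fun M ξ =>
        (∀ x ∈ M, x 1 + x 4 ≠ 0 → (∀ i, vecH x i ∈ tangentAt M x) ∧
          HasShapeMatrix .sphere 3 M ξ x (frameH x)
            !![-1, 1, 0, 0; 0, -1, 0, 0; 0, 0, -1, 1; 0, 0, 0, -1]) ∧
        (ev 4 ∈ M → HasShapeMatrix .sphere 3 M ξ (ev 4) pointFrameH
            !![-1, 1, 0, 0; 0, -1, 0, 0; 0, 0, -1, 1; 0, 0, 0, -1] ∧
          gram 3 pointFrameH = !![0, 1, 0, 0; 1, 0, 0, 0; 0, 0, 0, -1; 0, 0, -1, 0])) ∧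
    -- (i)
    IsSphereQuadricExample 3 PI (Polynomial.X ^ 2) (-1) (ev 4) (-1) .IXi
      (fun M ξ =>
        (∀ x ∈ M, x 1 + x 4 ≠ 0 → (∀ i, vecI x i ∈ tangentAt M x) ∧
          HasShapeMatrix .sphere 3 M ξ x (frameI x)
            !![-1, 1, 0, 0; 0, -1, 0, 0; 0, 0, -1, 1; 0, 0, 0, -1]) ∧
        (ev 4 ∈ M → HasShapeMatrix .sphere 3 M ξ (ev 4) pointFrameI
            !![-1, 1, 0, 0; 0, -1, 0, 0; 0, 0, -1, 1; 0, 0, 0, -1] ∧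
          gram 3 pointFrameI = !![0, 1, 0, 0; 1, 0, 0, 0; 0, 0, 0, 1; 0, 0, 1, 0])) ∧
    -- (j)
    IsSphereQuadricExample 3 PJ (Polynomial.X ^ 2 - 2 * Polynomial.X + 2) 1 (ev 3) (-1) .II
      (fun M ξ => ∀ x ∈ M,
        ∃ A : Module.End ℝ (tangentAt M x), IsShapeOperatorAt .sphere 3 M ξ x A ∧
          IsDiagonalizable (K := ℂ) (V := ℂ ⊗[ℝ] tangentAt M x) (LinearMap.baseChange ℂ A) ∧
          principalCurvatures A = {-Complex.I, -Complex.I, Complex.I, Complex.I}) ∧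
    -- (k)
    (∀ a : ℝ, 0 < a →
      IsParametrizedExample (fK a) domK (normalK a) 1 .VIIii (frameK a)
        !![0, 1, 0, 0; 0, 0, 1, 0; 0, 0, 0, 0; 0, 0, 0, a] ∧
      ∀ p ∈ domK, pip 2 5 (frameK a p 0) (frameK a p 3) = 0 ∧
        pip 2 5 (frameK a p 1) (frameK a p 3) = 0 ∧
        pip 2 5 (frameK a p 2) (frameK a p 3) = 0 ∧
        pip 2 5 (frameK a p 3) (frameK a p 3) = -(1 / (1 + a ^ 2 * p 3 ^ 2)) ∧
        -(1 / (1 + a ^ 2 * p 3 ^ 2)) < 0) ∧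
    -- (l)
    (∀ a : ℝ, 0 < a →
      IsParametrizedExample (fL a) (domL a) (normalL a) 1 .VIIi (frameL a)
        !![0, 1, 0, 0; 0, 0, 1, 0; 0, 0, 0, 0; 0, 0, 0, a] ∧
      ∀ p ∈ domL a, pip 2 5 (frameL a p 0) (frameL a p 3) = 0 ∧
        pip 2 5 (frameL a p 1) (frameL a p 3) = 0 ∧
        pip 2 5 (frameL a p 2) (frameL a p 3) = 0 ∧
        pip 2 5 (frameL a p 3) (frameL a p 3) = 1 / (1 - a ^ 2 * p 3 ^ 2) ∧
        0 < 1 / (1 - a ^ 2 * p 3 ^ 2)) ∧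
    -- (m)
    (IsParametrizedExample fM Set.univ normalM 1 .VI frameM
        !![0, 1, 0, 0; 0, 0, 1, 0; 0, 0, 0, 1; 0, 0, 0, 0] ∧
      IsConnected (fM '' Set.univ)) := by
  exact ⟨example_a, example_b, example_c, example_d, example_e, example_f, example_g, example_h, example_i, example_j, example_k, example_l, example_m⟩
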